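/- For every $n\ge 1$ let $Y_1,\dots,Y_n$ be i.i.d. mean-zero random vectors in $\mathbb R^{p_n}$ ($p_n\ge 1$) with covariance matrix $\Sigma_{0n}$, defined on a probability space with measure $\mathbb P_{0n}$, and let $S=\frac1n\sum_{i=1}^n Y_iY_i^{T}$. Write $\|\cdot\|$ for the spectral norm, and for a random vector $X$ let $\|X\|_{\psi_2}=\sup_{\|u\|_2=1}\sup_{q\ge 1}q^{-1/2}(E|u^TX|^q)^{1/q}$. Assume: (1) there are constants $k_\sigma\in(0,1]$ and $\sigma_0>0$, independent of $n$, such that all eigenvalues of $\Sigma_{0n}$ lie in $[k_\sigma,1/k_\sigma]$ and $\|\Sigma_{0n}^{-1/2}Y_1\|_{\psi_2}\le\sigma_0$; (2) $p_n^5/n\to0$. Consider the working model in which the data are i.i.d. $N_{p_n}(0,\Sigma)$, with log-likelihood $l_n(\Sigma)=-\frac{np_n}{2}\log(2\pi)-\frac n2\log\det\Sigma-\frac n2\operatorname{tr}(\Sigma^{-1}S)$, and $\Sigma$ has the diagonal scale-mixed inverse Wishart (DSIW) prior $$\Sigma\mid\Delta\sim IW(\nu+p_n-1,\;c_\nu\Delta),\qquad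 \Delta=\operatorname{diag}(\delta_1,\dots,\delta_{p_n}),\qquad \delta_i\sim\pi_i\ \text{independently},$$ where $\nu>0$ and $c_\nu>0$ are fixed and $\pi_1,\dots,\pi_{p_n}$ (which may depend on $n$) are probability densities supported in $(0,\infty)$. Here $IW(m,\Psi)$ has density proportional to $\det(\Sigma)^{-(m+p_n+1)/2}\exp\{-\operatorname{tr}(\Psi\Sigma^{-1})/2\}$ on the symmetric positive definite $p_n\times p_n$ matrices, so that the prior density of $\Sigma$ is $$\pi_{1n}(\Sigma)\propto\det(\Sigma)^{-(\nu+2p_n)/2}\prod_{i=1}^{p_n}\int_0^\infty\delta^{(\nu+p_n-1)/2}\exp\Big\{-\frac{c_\nu}{2}(\Sigma^{-1})_{ii}\,\delta\Big\}\pi_i(\delta)\,d\delta .$$ Suppose there is a constant $k$, independent of $n$ and $i$, such that every $\pi_i$ is non-increasing on $(k,\infty)$. Let $\Pi_n(\cdot\mid Y^n)$ be the posterior distribution of $\Sigma$, with density proportional to $e^{l_n}\pi_{1n}$ with respect to Lebesgue measure on symmetric matrices, and put $\epsilon_n=\sqrt{p_n/n}$. Then, as $n\to\infty$: (a) (flatness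 around $S$) for every constant $M>0$, $$\sup\left\{\left|\frac{\pi_{1n}(S+T/\sqrt n)}{\pi_{1n}(S)}-1\right| : T=T^T,\ S+T/\sqrt n\ \text{positive definite},\ \|T\|\le\sqrt n\,M\epsilon_n\right\}\to0$$ in probability under $\mathbb P_{0n}$; (b) (posterior contraction at rate $\sqrt{p_n/n}$) for every sequence $M_n\to\infty$, $\Pi_n(\|\Sigma-\Sigma_{0n}\|>M_n\epsilon_n\mid Y^n)\to0$ in probability under $\mathbb P_{0n}$; and if $p_n\to\infty$, then there is a constant $M_0>0$ such that for every constant $M\ge M_0$, $\Pi_n(\|\Sigma-\Sigma_{0n}\|>M\epsilon_n\mid Y^n)\to0$ in probability under $\mathbb P_{0n}$. -/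

import Mathlib

open MeasureTheory ProbabilityTheory Filter Topology
open scoped ENNReal Matrix

noncomputable section

/-- Spectral norm of a real square matrix: the operator norm for the Euclidean norm on `ℝ^p`. -/
def specNorm {p : ℕ} (A : Matrix (Fin p) (Fin p) ℝ) : ℝ :=
  ‖Matrix.toEuclideanCLM (n := Fin p) (𝕜 := ℝ) A‖

/-- The product σ-algebra on matrices. -/
instance matrixMeasurableSpace {p : ℕ} : MeasurableSpace (Matrix (Fin p) (Fin p) ℝ) :=
  inferInstanceAs (MeasurableSpace (Fin p → Fin p → ℝ))

/-- Lebesgue measure on the space of symmetric `p × p` matrices, in the `p (p + 1) / 2` coordinates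
given by the entries on and below the diagonal (indexed by unordered pairs of indices). It is viewed
as a measure on all square matrices that is carried by the symmetric ones. -/
def symLebesgue (p : ℕ) : Measure (Matrix (Fin p) (Fin p) ℝ) :=
  Measure.map (fun v : Sym2 (Fin p) → ℝ => Matrix.of fun i j => v s(i, j)) volume

/-! ### The sub-Gaussian norm -/

/-- `‖X‖_{ψ₂} = sup_{q ≥ 1} q^{-1/2} (E |X|^q)^{1/q}`, with values in `[0, ∞]`. -/
def psiTwoNorm {Ω : Type*} [MeasurableSpace Ω] (P : Measure Ω) (X : Ω → ℝ) : ℝ≥0∞ :=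
  ⨆ (q : ℝ) (_ : 1 ≤ q), eLpNorm X (ENNReal.ofReal q) P / ENNReal.ofReal (√q)

/-- Sub-Gaussian norm of a random vector: supremum of `‖uᵀ X‖_{ψ₂}` over Euclidean unit vectors. -/
def psiTwoNormVec {Ω : Type*} [MeasurableSpace Ω] (P : Measure Ω) {p : ℕ}
    (X : Ω → Fin p → ℝ) : ℝ≥0∞ :=
  ⨆ (u : Fin p → ℝ) (_ : u ⬝ᵥ u = 1), psiTwoNorm P fun ω => u ⬝ᵥ X ω

/-- `A^{-1/2}` for a symmetric positive definite matrix `A` (continuous functional calculus). -/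
def invSqrt {p : ℕ} (A : Matrix (Fin p) (Fin p) ℝ) : Matrix (Fin p) (Fin p) ℝ :=
  cfc (fun x : ℝ => (√x)⁻¹) A

/-! ### The true data-generating mechanism -/

/-- `Y 0, …, Y (n - 1)` are i.i.d. random vectors in `ℝ^p` with mean zero and covariance `S0`. -/
structure IsIIDSample {Ω : Type*} [MeasurableSpace Ω] (P : Measure Ω) {n p : ℕ}
    (Y : Fin n → Ω → Fin p → ℝ) (S0 : Matrix (Fin p) (Fin p) ℝ) : Prop where
  indep : iIndepFun Y P
  ident : ∀ i j, IdentDistrib (Y i) (Y j) P P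
  mean : ∀ i a, ∫ ω, Y i ω a ∂P = 0
  cov : ∀ i a b, ∫ ω, Y i ω a * Y i ω b ∂P = S0 a b

/-- The class of symmetric matrices with all eigenvalues in `[κ, 1/κ]`. -/
def WellConditioned (κ : ℝ) {p : ℕ} (S0 : Matrix (Fin p) (Fin p) ℝ) : Prop :=
  ∃ h : S0.IsHermitian, ∀ i, κ ≤ h.eigenvalues i ∧ h.eigenvalues i ≤ 1 / κ

/-- `S = n⁻¹ ∑ Y_i Y_iᵀ`. -/
def sampleCov {n p : ℕ} (y : Fin n → Fin p → ℝ) : Matrix (Fin p) (Fin p) ℝ :=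
  (n : ℝ)⁻¹ • ∑ i, Matrix.vecMulVec (y i) (y i)

/-! ### The working Gaussian model and the posterior -/

/-- Gaussian log-likelihood at the covariance matrix `A`, for sample size `n` and sample
covariance matrix `S`. -/
def logLik (n : ℕ) {p : ℕ} (S A : Matrix (Fin p) (Fin p) ℝ) : ℝ :=
  -(n * p / 2 : ℝ) * Real.log (2 * Real.pi) - (n / 2 : ℝ) * Real.log A.det
    - (n / 2 : ℝ) * (A⁻¹ * S).trace

/-- Unnormalised posterior of the covariance matrix for the prior density `pri`. -/
def unnormPosterior (n : ℕ) {p : ℕ} (pri : Matrix (Fin p) (Fin p) ℝ → ℝ)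
    (S : Matrix (Fin p) (Fin p) ℝ) : Measure (Matrix (Fin p) (Fin p) ℝ) :=
  (symLebesgue p).withDensity fun A => ENNReal.ofReal (Real.exp (logLik n S A) * pri A)

/-- Posterior distribution of the covariance matrix (Bayes' formula); prior densities vanish outside
the cone of positive definite matrices. -/
def posterior (n : ℕ) {p : ℕ} (pri : Matrix (Fin p) (Fin p) ℝ → ℝ)
    (S : Matrix (Fin p) (Fin p) ℝ) : Measure (Matrix (Fin p) (Fin p) ℝ) :=
  (unnormPosterior n pri S Set.univ)⁻¹ • unnormPosterior n pri S

/-- `ρ(ε) = sup |π(S + T/√n) / π(S) - 1|` over symmetric `T` with `S + T/√n` positive definite and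
`‖T‖ ≤ √n ε`, with values in `[0, ∞]`. -/
def flatness (n : ℕ) {p : ℕ} (pri : Matrix (Fin p) (Fin p) ℝ → ℝ)
    (S : Matrix (Fin p) (Fin p) ℝ) (ε : ℝ) : ℝ≥0∞ :=
  ⨆ (T : Matrix (Fin p) (Fin p) ℝ)
    (_ : T.IsSymm ∧ (S + (√(n : ℝ))⁻¹ • T).PosDef ∧ specNorm T ≤ √(n : ℝ) * ε),
    ENNReal.ofReal |pri (S + (√(n : ℝ))⁻¹ • T) / pri S - 1|

/-! ### The diagonal scale-mixed inverse Wishart prior -/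

/-- The multivariate gamma function `Γ_p(a) = π^{p(p-1)/4} ∏_{j=1}^p Γ(a - (j-1)/2)`. -/
def multiGamma (p : ℕ) (a : ℝ) : ℝ :=
  Real.pi ^ ((p : ℝ) * (p - 1) / 4) * ∏ j : Fin p, Real.Gamma (a - (j : ℕ) / 2)

open Classical in
/-- Density of the inverse Wishart distribution `IW(m, Ψ)` on positive definite matrices. -/
def iwDensity {p : ℕ} (m : ℝ) (Ψ A : Matrix (Fin p) (Fin p) ℝ) : ℝ :=
  if A.PosDef then
    Ψ.det ^ (m / 2) / (2 ^ (m * p / 2) * multiGamma p (m / 2)) *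
      A.det ^ (-(m + p + 1) / 2) * Real.exp (-(Ψ * A⁻¹).trace / 2)
  else 0

/-- A probability density on the real line which is supported in the positive half-line. -/
structure IsPosDensity (f : ℝ → ℝ) : Prop where
  measurable : Measurable f
  nonneg : ∀ x, 0 ≤ f x
  support : ∀ x ≤ 0, f x = 0
  mass : ∫⁻ x, ENNReal.ofReal (f x) = 1

/-- Density of the DSIW prior: `A ∣ Δ ∼ IW(ν + p - 1, c Δ)` with `Δ = diag(δ_1, …, δ_p)` and
independent `δ_i` with densities `mix i`. -/
def dsiwDensity {p : ℕ} (ν c : ℝ) (mix : Fin p → ℝ → ℝ) (A : Matrix (Fin p) (Fin p) ℝ) : ℝ :=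
  ∫ δ : Fin p → ℝ, iwDensity (ν + p - 1) (c • Matrix.diagonal δ) A * ∏ i, mix i (δ i)

/-! ### Asymptotic notions -/

/-- `X n → 0` in probability, where `X n` is defined on the probability space `(Ω n, P n)`. -/
def TendstoZeroInProb {Ω : ℕ → Type*} [∀ n, MeasurableSpace (Ω n)] (P : ∀ n, Measure (Ω n))
    (X : ∀ n, Ω n → ℝ≥0∞) : Prop :=
  ∀ η : ℝ≥0∞, 0 < η → Tendsto (fun n => P n {ω | η ≤ X n ω}) atTop (𝓝 0)

/-- The posterior probability of `‖Σ - Σ₀ₙ‖ > ε n` tends to zero in probability. -/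
def PosteriorContracts {Ω : ℕ → Type*} [∀ n, MeasurableSpace (Ω n)] (P : ∀ n, Measure (Ω n))
    (p : ℕ → ℕ) (Y : ∀ n, Fin n → Ω n → Fin (p n) → ℝ)
    (S0 : ∀ n, Matrix (Fin (p n)) (Fin (p n)) ℝ)
    (pri : ∀ n, Matrix (Fin (p n)) (Fin (p n)) ℝ → ℝ) (ε : ℕ → ℝ) : Prop :=
  TendstoZeroInProb P fun n ω =>
    posterior n (pri n) (sampleCov fun i => Y n i ω) {A | ε n < specNorm (A - S0 n)}

/-- Flatness of the priors around the sample covariance matrix, at radius `ε n`. -/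
def FlatAroundSampleCov {Ω : ℕ → Type*} [∀ n, MeasurableSpace (Ω n)] (P : ∀ n, Measure (Ω n))
    (p : ℕ → ℕ) (Y : ∀ n, Fin n → Ω n → Fin (p n) → ℝ)
    (pri : ∀ n, Matrix (Fin (p n)) (Fin (p n)) ℝ → ℝ) (ε : ℕ → ℝ) : Prop :=
  TendstoZeroInProb P fun n ω => flatness n (pri n) (sampleCov fun i => Y n i ω) (ε n)

end

/-! Conjugacy. Given the scales δ, the prior is inverse Wishart, so the posterior of Σ is a mixture
over δ of inverse Wishart laws with scale Ψ = nS + cΔ and determinant exponent -(n + ν + 2p)/2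
(`unnormPosterior_eq`). With m = n + ν + 2p, the integral of the kernel is a constant times
det(Ψ)^{-(m-p-1)/2} (`iwIntegral_eq`), because A ↦ BABᵀ has Jacobian |det B|^{p+1} on symmetric
matrices (`det_congrSym`). The constant is never evaluated: only ratios of such integrals occur.

Contraction. Tilting the kernel by exp(-s uᵀA⁻¹u/2) replaces Ψ by Ψ + s uuᵀ, so Laplace transforms
of uᵀA⁻¹u are powers of a rank-one determinant ratio and Chernoff's bound is explicit
(`setLIntegral_iwKernel_le`). If no cδ_i exceeds a small multiple of nh, then Ψ is nS up to a factor
1 + h/4, and a union bound over 2·25^p test vectors leaves relative mass exp(O(p) - nh²/16) outside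
‖A - S‖ = O(h) (`setLIntegral_iwKernel_specNorm_le`). Large δ_i are negligible: passing from s to 2s
raises the weight by at most 2^{(ν+p-1)/2}, since the mixing density is non-increasing there, while
the determinant lowers the integral by a factor exponentially small in nh
(`setLIntegral_scaleWeight_le`). With h = t√(p/n) one has nh² = t²p, which beats O(p) once t is a
large constant. Bernstein's inequality on the same kind of test vectors puts S within t√(p/n) of Σ₀.

Flatness. Up to constants the log-density is -(ν+2p)/2 · log det Σ plus p logarithms of integrals
that depend on Σ only through (Σ⁻¹)_ii. Within distance ρ of S the first term moves by O(p·pρ). The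
logarithmic derivative of each integral is, up to the factor -c/2, the mean of δ_i under a tilted
density, which is O(p) by the same doubling argument (`integral_mul_scaleTerm_le`). The total change
is O(p²ρ), that is O(√(p⁵/n)) for ρ = M√(p/n); this is what the growth condition makes small. -/

/-! ### Norm properties of the spectral norm. -/

section SpectralNorm

open scoped Matrix.Norms.L2Operator

variable {p : ℕ}

theorem specNorm_eq_norm (A : Matrix (Fin p) (Fin p) ℝ) : specNorm A = ‖A‖ := rfl

theorem specNorm_nonneg (A : Matrix (Fin p) (Fin p) ℝ) : 0 ≤ specNorm A := norm_nonneg _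

theorem specNorm_mul_le (A B : Matrix (Fin p) (Fin p) ℝ) :
    specNorm (A * B) ≤ specNorm A * specNorm B := by
  simpa only [specNorm_eq_norm] using norm_mul_le A B

theorem specNorm_add_le (A B : Matrix (Fin p) (Fin p) ℝ) :
    specNorm (A + B) ≤ specNorm A + specNorm B := by
  simpa only [specNorm_eq_norm] using norm_add_le A B

theorem specNorm_neg (A : Matrix (Fin p) (Fin p) ℝ) : specNorm (-A) = specNorm A := by
  simp only [specNorm_eq_norm, norm_neg]

theorem specNorm_smul (a : ℝ) (A : Matrix (Fin p) (Fin p) ℝ) :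
    specNorm (a • A) = |a| * specNorm A := by
  simp only [specNorm_eq_norm, norm_smul, Real.norm_eq_abs]

end SpectralNorm

/-! ### Quadratic forms, nets on the sphere and finite families of test vectors. -/

section QuadraticForms

variable {p : ℕ}

theorem dotProduct_mulVec_eq_inner (A : Matrix (Fin p) (Fin p) ℝ) (v w : Fin p → ℝ) :
    v ⬝ᵥ A *ᵥ w = inner ℝ (WithLp.toLp 2 v : EuclideanSpace ℝ (Fin p))
      (Matrix.toEuclideanCLM (n := Fin p) (𝕜 := ℝ) A (WithLp.toLp 2 w)) := by
  rw [Matrix.toEuclideanCLM_toLp, EuclideanSpace.inner_toLp_toLp]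
  simp [dotProduct_comm]

theorem dotProduct_self_eq_norm_sq (v : Fin p → ℝ) :
    v ⬝ᵥ v = ‖(WithLp.toLp 2 v : EuclideanSpace ℝ (Fin p))‖ ^ 2 := by
  rw [← real_inner_self_eq_norm_sq, EuclideanSpace.inner_toLp_toLp]
  simp

theorem abs_dotProduct_mulVec_le (A : Matrix (Fin p) (Fin p) ℝ) (v : Fin p → ℝ) :
    |v ⬝ᵥ A *ᵥ v| ≤ specNorm A * (v ⬝ᵥ v) := by
  rw [dotProduct_mulVec_eq_inner, dotProduct_self_eq_norm_sq]
  refine (abs_real_inner_le_norm _ _).trans ?_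
  have := (Matrix.toEuclideanCLM (n := Fin p) (𝕜 := ℝ) A).le_opNorm (WithLp.toLp 2 v)
  calc _ ≤ ‖(WithLp.toLp 2 v : EuclideanSpace ℝ (Fin p))‖ * (specNorm A * ‖WithLp.toLp 2 v‖) := by
        gcongr; exact this
    _ = _ := by ring

theorem abs_apply_self_le_specNorm (A : Matrix (Fin p) (Fin p) ℝ) (i : Fin p) :
    |A i i| ≤ specNorm A := by
  simpa using abs_dotProduct_mulVec_le A (Pi.single i 1)

theorem abs_trace_le (A : Matrix (Fin p) (Fin p) ℝ) : |A.trace| ≤ p * specNorm A := by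
  calc |A.trace| ≤ ∑ i, |A i i| := Finset.abs_sum_le_sum_abs _ _
    _ ≤ ∑ _i : Fin p, specNorm A := Finset.sum_le_sum fun i _ => abs_apply_self_le_specNorm A i
    _ = _ := by simp

theorem dotProduct_mulVec_comm_of_isSymm {A : Matrix (Fin p) (Fin p) ℝ} (hA : A.IsSymm)
    (v w : Fin p → ℝ) : v ⬝ᵥ A *ᵥ w = w ⬝ᵥ A *ᵥ v := by
  rw [Matrix.dotProduct_mulVec, ← Matrix.mulVec_transpose, hA.eq, dotProduct_comm]

/-- Polarization of the quadratic form of a symmetric matrix. -/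
theorem abs_dotProduct_mulVec_le_of_quadForm {A : Matrix (Fin p) (Fin p) ℝ} (hA : A.IsSymm)
    {β : ℝ} {v w : Fin p → ℝ}
    (h₁ : |(v + w) ⬝ᵥ A *ᵥ (v + w)| ≤ β * ((v + w) ⬝ᵥ (v + w)))
    (h₂ : |(v - w) ⬝ᵥ A *ᵥ (v - w)| ≤ β * ((v - w) ⬝ᵥ (v - w))) :
    |v ⬝ᵥ A *ᵥ w| ≤ β / 2 * (v ⬝ᵥ v + w ⬝ᵥ w) := by
  have hs := dotProduct_mulVec_comm_of_isSymm hA v w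
  have e := dotProduct_comm v w
  simp only [Matrix.mulVec_add, Matrix.mulVec_sub, dotProduct_add, add_dotProduct,
    dotProduct_sub, sub_dotProduct] at h₁ h₂
  -- 4 vᵀAw is the difference of the two forms, and the parallelogram law sums the two right-hand
  -- sides.
  rw [abs_le] at *
  constructor <;> nlinarith

/-- Replacing a unit vector by its net point costs at most half the norm, so ‖f‖ ≤ b + ‖f‖/2. -/
theorem norm_le_of_half_net {E F : Type*} [NormedAddCommGroup E] [NormedSpace ℝ E]
    [NormedAddCommGroup F] [NormedSpace ℝ F] {N : Set E}
    (hN : ∀ x : E, ‖x‖ = 1 → ∃ y ∈ N, ‖x - y‖ ≤ 1 / 2) (f : E →L[ℝ] F) {b : ℝ} (hb : 0 ≤ b)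
    (hf : ∀ y ∈ N, ‖f y‖ ≤ b) : ‖f‖ ≤ 2 * b := by
  have : ‖f‖ ≤ b + ‖f‖ / 2 := by
    refine ContinuousLinearMap.opNorm_le_of_unit_norm (by positivity) fun x hx => ?_
    obtain ⟨y, hy, hxy⟩ := hN x hx
    calc ‖f x‖ = ‖f y + f (x - y)‖ := by rw [← map_add]; congr 2; abel
      _ ≤ ‖f y‖ + ‖f (x - y)‖ := norm_add_le _ _
      _ ≤ b + ‖f‖ * (1 / 2) := by
        gcongr
        · exact hf y hy
        · exact (f.le_opNorm _).trans (by gcongr)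
      _ = _ := by ring
  linarith

/-- A maximal separated subset of the unit sphere is a `1/2`-net with at most `5 ^ p` points. -/
theorem exists_half_net (p : ℕ) : ∃ N : Finset (EuclideanSpace ℝ (Fin p)), N.card ≤ 5 ^ p ∧
    (∀ y ∈ N, ‖y‖ = 1) ∧ ∀ x : EuclideanSpace ℝ (Fin p), ‖x‖ = 1 → ∃ y ∈ N, ‖x - y‖ ≤ 1 / 2 := by
  classical
  let good : Finset (EuclideanSpace ℝ (Fin p)) → Prop := fun N =>
    (∀ y ∈ N, ‖y‖ = 1) ∧ ∀ c ∈ N, ∀ d ∈ N, c ≠ d → 1 / 2 ≤ ‖c - d‖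
  have hcard : ∀ N, good N → N.card ≤ 5 ^ p := by
    intro N hN
    -- Doubling turns 1/2-separated unit vectors into 1-separated vectors of norm at most 2, the
    -- normalisation in which the packing bound is 5 to the dimension.
    have hinj : Function.Injective fun x : EuclideanSpace ℝ (Fin p) => (2 : ℝ) • x :=
      smul_right_injective _ two_ne_zero
    have := Besicovitch.card_le_of_separated (N.image fun x => (2 : ℝ) • x) ?_ ?_
    · rwa [Finset.card_image_of_injective _ hinj, finrank_euclideanSpace_fin] at this
    · intro c hc
      obtain ⟨x, hx, rfl⟩ := Finset.mem_image.1 hc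
      simp [norm_smul, hN.1 x hx]
    · intro c hc d hd hcd
      obtain ⟨x, hx, rfl⟩ := Finset.mem_image.1 hc
      obtain ⟨y, hy, rfl⟩ := Finset.mem_image.1 hd
      rw [← smul_sub, norm_smul]
      have := hN.2 x hx y hy fun h => hcd (by rw [h])
      norm_num at this ⊢
      linarith
  obtain ⟨N, hN, hmax⟩ : ∃ N, good N ∧ ∀ N', good N' → N'.card ≤ N.card := by
    have hfin : ({k | ∃ N, good N ∧ N.card = k} : Set ℕ).Finite :=
      (Set.finite_Iic (5 ^ p)).subset fun k ⟨N, hN, h⟩ => h ▸ hcard N hN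
    obtain ⟨k, ⟨N, hN, rfl⟩, hk⟩ := hfin.exists_maximal ⟨0, ∅, by simp [good], by simp⟩
    refine ⟨N, hN, fun N' hN' => ?_⟩
    by_contra! hlt
    exact absurd (hk ⟨N', hN', rfl⟩ hlt.le) (by simpa using hlt)
  refine ⟨N, hcard N hN, hN.1, fun x hx => ?_⟩
  by_contra! hfar
  have hxN : x ∉ N := fun h => by simpa using (hfar x h).trans_le' (by norm_num : (0:ℝ) ≤ 1 / 2)
  have := hmax (insert x N) ⟨?_, ?_⟩
  · rw [Finset.card_insert_of_notMem hxN] at this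
    omega
  · intro y hy
    rcases Finset.mem_insert.1 hy with rfl | hy
    exacts [hx, hN.1 y hy]
  · intro c hc d hd hcd
    rcases Finset.mem_insert.1 hc with rfl | hc' <;> rcases Finset.mem_insert.1 hd with rfl | hd'
    · exact absurd rfl hcd
    · exact (hfar d hd').le
    · rw [norm_sub_rev]; exact (hfar c hc').le
    · exact hN.2 c hc' d hd' hcd

/-- Finitely many test vectors control the spectral norm of every symmetric matrix. -/
theorem exists_test_vectors (p : ℕ) : ∃ T : Finset (Fin p → ℝ), T.card ≤ 2 * 25 ^ p ∧
    (∀ v ∈ T, v ≠ 0) ∧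
    ∀ A : Matrix (Fin p) (Fin p) ℝ, A.IsSymm → ∀ β : ℝ, 0 ≤ β →
      (∀ v ∈ T, |v ⬝ᵥ A *ᵥ v| ≤ β * (v ⬝ᵥ v)) → specNorm A ≤ 4 * β := by
  classical
  obtain ⟨N, hcard, hN1, hN⟩ := exists_half_net p
  -- Sums and differences of net points are what polarization needs. The zero vector is removed
  -- later so that each test vector can be normalised.
  let T₁ := (N ×ˢ N).image fun q => (WithLp.ofLp q.1 + WithLp.ofLp q.2 : Fin p → ℝ)
  let T₂ := (N ×ˢ N).image fun q => (WithLp.ofLp q.1 - WithLp.ofLp q.2 : Fin p → ℝ)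
  refine ⟨(T₁ ∪ T₂).erase 0, ?_, fun v hv => (Finset.mem_erase.1 hv).1, ?_⟩
  · have hNN : (N ×ˢ N).card ≤ 25 ^ p := by
      rw [Finset.card_product]
      calc N.card * N.card ≤ 5 ^ p * 5 ^ p := Nat.mul_le_mul hcard hcard
        _ = 25 ^ p := by rw [← mul_pow]; norm_num
    calc _ ≤ (T₁ ∪ T₂).card := Finset.card_erase_le
      _ ≤ T₁.card + T₂.card := Finset.card_union_le _ _
      _ ≤ 25 ^ p + 25 ^ p :=
        add_le_add (Finset.card_image_le.trans hNN) (Finset.card_image_le.trans hNN)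
      _ = _ := by ring
  · intro A hA β hβ h
    have h' : ∀ v ∈ T₁ ∪ T₂, |v ⬝ᵥ A *ᵥ v| ≤ β * (v ⬝ᵥ v) := by
      intro v hv
      by_cases h0 : v = 0
      · simp [h0]
      · exact h v (Finset.mem_erase.2 ⟨h0, hv⟩)
    have key : ∀ x ∈ N, ∀ y ∈ N,
        |inner ℝ x (Matrix.toEuclideanCLM (n := Fin p) (𝕜 := ℝ) A y)| ≤ β := by
      intro x hx y hy
      have e := abs_dotProduct_mulVec_le_of_quadForm hA (v := WithLp.ofLp x) (w := WithLp.ofLp y)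
        (h' _ (Finset.mem_union_left _ (Finset.mem_image.2 ⟨(x, y), by simp [hx, hy], rfl⟩)))
        (h' _ (Finset.mem_union_right _ (Finset.mem_image.2 ⟨(x, y), by simp [hx, hy], rfl⟩)))
      rw [dotProduct_mulVec_eq_inner, dotProduct_self_eq_norm_sq, dotProduct_self_eq_norm_sq] at e
      simp only [WithLp.toLp_ofLp, hN1 x hx, hN1 y hy] at e
      linarith
    -- The net is used twice, once for each argument of the bilinear form; each use costs a factor
    -- 2, whence 4β.
    have h1 : ∀ y ∈ N, ‖Matrix.toEuclideanCLM (n := Fin p) (𝕜 := ℝ) A y‖ ≤ 2 * β := by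
      intro y hy
      rw [← innerSL_apply_norm ℝ]
      refine norm_le_of_half_net (N := (N : Set _)) (fun x hx => by simpa using hN x hx) _ hβ ?_
      intro x hx
      rw [innerSL_apply_apply, real_inner_comm]
      exact key x hx y hy
    have := norm_le_of_half_net (N := (N : Set (EuclideanSpace ℝ (Fin p))))
      (fun x hx => by simpa using hN x hx)
      (Matrix.toEuclideanCLM (n := Fin p) (𝕜 := ℝ) A) (b := 2 * β) (by positivity) h1
    rw [specNorm]
    linarith

end QuadraticForms

/-! ### Positive definite matrices: inverses, rank-one updates, determinants. -/

section PositiveDefinite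

variable {p : ℕ} {A B : Matrix (Fin p) (Fin p) ℝ}

theorem posDef_iff_real : A.PosDef ↔ A.IsSymm ∧ ∀ v : Fin p → ℝ, v ≠ 0 → 0 < v ⬝ᵥ A *ᵥ v := by
  rw [Matrix.posDef_iff_dotProduct_mulVec]
  simp only [star_trivial]
  exact Iff.and (by simp [Matrix.IsHermitian, Matrix.IsSymm, Matrix.conjTranspose_eq_transpose_of_trivial])
    (by tauto)

theorem dotProduct_self_pos {v : Fin p → ℝ} (hv : v ≠ 0) : 0 < v ⬝ᵥ v := by
  rw [dotProduct_self_eq_norm_sq]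
  have : (WithLp.toLp 2 v : EuclideanSpace ℝ (Fin p)) ≠ 0 := by simpa using hv
  positivity

theorem posDef_of_le_quadForm (hA : A.IsSymm) {κ : ℝ} (hκ : 0 < κ)
    (h : ∀ v, κ * (v ⬝ᵥ v) ≤ v ⬝ᵥ A *ᵥ v) : A.PosDef :=
  posDef_iff_real.2 ⟨hA, fun v hv => (mul_pos hκ (dotProduct_self_pos hv)).trans_le (h v)⟩

theorem Matrix.PosDef.isSymm (hA : A.PosDef) : A.IsSymm := (posDef_iff_real.1 hA).1

theorem Matrix.PosDef.quadForm_pos (hA : A.PosDef) {v : Fin p → ℝ} (hv : v ≠ 0) :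
    0 < v ⬝ᵥ A *ᵥ v := (posDef_iff_real.1 hA).2 v hv

theorem Matrix.PosDef.quadForm_nonneg (hA : A.PosDef) (v : Fin p → ℝ) : 0 ≤ v ⬝ᵥ A *ᵥ v := by
  by_cases h : v = 0
  · simp [h]
  · exact (hA.quadForm_pos h).le

theorem Matrix.PosDef.isUnit_det (hA : A.PosDef) : IsUnit A.det := hA.det_pos.ne'.isUnit

theorem Matrix.PosDef.mulVec_inv_mulVec (hA : A.PosDef) (u : Fin p → ℝ) : A *ᵥ A⁻¹ *ᵥ u = u := by
  rw [Matrix.mulVec_mulVec, Matrix.mul_nonsing_inv _ hA.isUnit_det, Matrix.one_mulVec]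

/-- The variational lower bound for the quadratic form of the inverse. -/
theorem Matrix.PosDef.two_mul_sub_le_inv (hA : A.PosDef) (u v : Fin p → ℝ) :
    2 * (u ⬝ᵥ v) - v ⬝ᵥ A *ᵥ v ≤ u ⬝ᵥ A⁻¹ *ᵥ u := by
  have h := hA.quadForm_nonneg (v - A⁻¹ *ᵥ u)
  have hs := dotProduct_mulVec_comm_of_isSymm hA.isSymm v (A⁻¹ *ᵥ u)
  have h1 := dotProduct_comm (A⁻¹ *ᵥ u) u
  have h2 := dotProduct_comm v u
  simp only [Matrix.mulVec_sub, dotProduct_sub, sub_dotProduct, hA.mulVec_inv_mulVec] at h hs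
  linarith

theorem Matrix.PosDef.two_mul_sub_eq_inv (hA : A.PosDef) (u : Fin p → ℝ) :
    2 * (u ⬝ᵥ A⁻¹ *ᵥ u) - (A⁻¹ *ᵥ u) ⬝ᵥ A *ᵥ (A⁻¹ *ᵥ u) = u ⬝ᵥ A⁻¹ *ᵥ u := by
  rw [hA.mulVec_inv_mulVec, dotProduct_comm (A⁻¹ *ᵥ u) u]
  ring

/-- The maximiser B⁻¹u of the variational problem for B is a competitor in the problem for A. -/
theorem Matrix.PosDef.inv_quadForm_anti (hA : A.PosDef) (hB : B.PosDef)
    (h : ∀ v, v ⬝ᵥ A *ᵥ v ≤ v ⬝ᵥ B *ᵥ v) (u : Fin p → ℝ) :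
    u ⬝ᵥ B⁻¹ *ᵥ u ≤ u ⬝ᵥ A⁻¹ *ᵥ u := by
  have h1 := hA.two_mul_sub_le_inv u (B⁻¹ *ᵥ u)
  have h2 := hB.two_mul_sub_eq_inv u
  linarith [h (B⁻¹ *ᵥ u)]

/-- The variational bound at eᵢ/Aᵢᵢ. It turns upper bounds on the diagonal of a matrix into lower
bounds on the diagonal of its inverse. -/
theorem Matrix.PosDef.inv_apply_self_ge (hA : A.PosDef) (i : Fin p) : (A i i)⁻¹ ≤ A⁻¹ i i := by
  have hi : 0 < A i i := hA.diag_pos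
  have h := hA.two_mul_sub_le_inv (Pi.single i 1) (Pi.single i (A i i)⁻¹)
  have e : Pi.single i (A i i)⁻¹ ⬝ᵥ A *ᵥ Pi.single i (A i i)⁻¹ = (A i i)⁻¹ := by
    simp [hi.ne']
  rw [e] at h
  simp at h
  linarith

theorem Matrix.PosDef.det_add_smul_vecMulVec (hA : A.PosDef) (s : ℝ) (u : Fin p → ℝ) :
    (A + s • Matrix.vecMulVec u u).det = A.det * (1 + s * (u ⬝ᵥ A⁻¹ *ᵥ u)) := by
  have h := Matrix.det_add_replicateCol_mul_replicateRow (ι := Unit) hA.isUnit_det (s • u) u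
  rw [← Matrix.vecMulVec_eq, Matrix.smul_vecMulVec] at h
  rw [h]
  congr 1
  simp only [Matrix.det_unique, Matrix.add_apply, Matrix.one_apply_eq]
  congr 1
  rw [Matrix.mul_assoc, Matrix.mul_apply]
  simp [dotProduct, Matrix.mulVec, Matrix.mul_apply, Finset.mul_sum]
  exact Finset.sum_congr rfl fun i _ => Finset.sum_congr rfl fun j _ => by ring

theorem quadForm_add_smul_vecMulVec (A : Matrix (Fin p) (Fin p) ℝ) (s : ℝ) (u v : Fin p → ℝ) :
    v ⬝ᵥ (A + s • Matrix.vecMulVec u u) *ᵥ v = v ⬝ᵥ A *ᵥ v + s * (u ⬝ᵥ v) ^ 2 := by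
  rw [Matrix.add_mulVec, dotProduct_add, Matrix.smul_mulVec, dotProduct_smul,
    Matrix.vecMulVec_mulVec]
  simp [dotProduct_comm v u, pow_two]

theorem isSymm_add_smul_vecMulVec (hA : A.IsSymm) (s : ℝ) (u : Fin p → ℝ) :
    (A + s • Matrix.vecMulVec u u).IsSymm := by
  refine hA.add (Matrix.IsSymm.smul ?_ s)
  simp [Matrix.IsSymm, Matrix.transpose_vecMulVec]

theorem Matrix.PosDef.add_smul_vecMulVec (hA : A.PosDef) {s : ℝ} (hs : 0 ≤ s) (u : Fin p → ℝ) :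
    (A + s • Matrix.vecMulVec u u).PosDef := by
  refine posDef_iff_real.2 ⟨isSymm_add_smul_vecMulVec hA.isSymm s u, fun v hv => ?_⟩
  rw [quadForm_add_smul_vecMulVec]
  have := hA.quadForm_pos hv
  positivity

/-- Cauchy–Schwarz for the inner product of A, obtained by optimising the variational bound along
the line spanned by v. -/
theorem Matrix.PosDef.sq_dotProduct_le (hA : A.PosDef) (u v : Fin p → ℝ) :
    (u ⬝ᵥ v) ^ 2 ≤ (u ⬝ᵥ A⁻¹ *ᵥ u) * (v ⬝ᵥ A *ᵥ v) := by
  by_cases hv : v = 0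
  · simp [hv]
  have hpos := hA.quadForm_pos hv
  have h := hA.two_mul_sub_le_inv u ((u ⬝ᵥ v / v ⬝ᵥ A *ᵥ v) • v)
  simp only [Matrix.mulVec_smul, dotProduct_smul, smul_dotProduct, smul_eq_mul] at h
  have e : 2 * (u ⬝ᵥ v / v ⬝ᵥ A *ᵥ v * (u ⬝ᵥ v)) -
      u ⬝ᵥ v / v ⬝ᵥ A *ᵥ v * (u ⬝ᵥ v / v ⬝ᵥ A *ᵥ v * (v ⬝ᵥ A *ᵥ v)) =
      (u ⬝ᵥ v) ^ 2 / (v ⬝ᵥ A *ᵥ v) := by field_simp; ring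
  rw [e, div_le_iff₀ hpos] at h
  exact h

theorem Matrix.PosDef.sub_smul_vecMulVec (hA : A.PosDef) {s : ℝ} {u : Fin p → ℝ}
    (hs : 0 ≤ s) (h : s * (u ⬝ᵥ A⁻¹ *ᵥ u) < 1) : (A + (-s) • Matrix.vecMulVec u u).PosDef := by
  refine posDef_iff_real.2 ⟨isSymm_add_smul_vecMulVec hA.isSymm _ u, fun v hv => ?_⟩
  rw [quadForm_add_smul_vecMulVec]
  have h1 := hA.quadForm_pos hv
  have h2 := mul_le_mul_of_nonneg_left (hA.sq_dotProduct_le u v) hs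
  nlinarith

/-- The spectral norm of a symmetric matrix is bounded by its quadratic form. -/
theorem specNorm_le_of_quadForm (hA : A.IsSymm) {β : ℝ} (hβ : 0 ≤ β)
    (h : ∀ v, |v ⬝ᵥ A *ᵥ v| ≤ β * (v ⬝ᵥ v)) : specNorm A ≤ β := by
  refine ContinuousLinearMap.opNorm_le_of_unit_norm hβ fun x hx => ?_
  set z := Matrix.toEuclideanCLM (n := Fin p) (𝕜 := ℝ) A x with hz
  by_cases h0 : z = 0
  · rw [h0]; simpa using hβ
  have hz0 : 0 < ‖z‖ := norm_pos_iff.2 h0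
  -- Polarizing between x and the normalised image z/‖z‖ recovers ‖z‖ itself, so no factor is lost.
  have e := abs_dotProduct_mulVec_le_of_quadForm hA (v := WithLp.ofLp (‖z‖⁻¹ • z))
    (w := WithLp.ofLp x) (h _) (h _)
  rw [dotProduct_mulVec_eq_inner, dotProduct_self_eq_norm_sq, dotProduct_self_eq_norm_sq] at e
  simp only [WithLp.toLp_ofLp, hx] at e
  rw [← hz, inner_smul_left, real_inner_self_eq_norm_sq, norm_smul] at e
  simp only [norm_inv, norm_norm, inv_mul_cancel₀ hz0.ne'] at e
  have e2 : (starRingEnd ℝ) ‖z‖⁻¹ * ‖z‖ ^ 2 = ‖z‖ := by simp; field_simp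
  rw [e2, abs_of_pos hz0] at e
  linarith

theorem Matrix.PosDef.specNorm_inv_le (hA : A.PosDef) {κ : ℝ} (hκ : 0 < κ)
    (h : ∀ v, κ * (v ⬝ᵥ v) ≤ v ⬝ᵥ A *ᵥ v) : specNorm A⁻¹ ≤ κ⁻¹ := by
  refine specNorm_le_of_quadForm hA.inv.isSymm (by positivity) fun u => ?_
  rw [abs_of_nonneg (hA.inv.quadForm_nonneg u)]
  have h1 := hA.two_mul_sub_eq_inv u
  have h2 := h (A⁻¹ *ᵥ u)
  set y := A⁻¹ *ᵥ u
  -- With y = A⁻¹u, expanding this square and using uᵀy = yᵀAy ≥ κ yᵀy leaves κ uᵀy ≤ uᵀu.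
  have h3 : 0 ≤ (κ • y - u) ⬝ᵥ (κ • y - u) := by
    rw [dotProduct_self_eq_norm_sq]; positivity
  have e := dotProduct_comm y u
  simp only [dotProduct_sub, sub_dotProduct, dotProduct_smul, smul_dotProduct, smul_eq_mul] at h3
  rw [← mul_le_mul_iff_right₀ hκ, mul_inv_cancel_left₀ hκ.ne']
  nlinarith

theorem quadForm_le_of_sub {κ κ' : ℝ} (h : ∀ v, κ * (v ⬝ᵥ v) ≤ v ⬝ᵥ B *ᵥ v)
    (hAB : specNorm (A - B) ≤ κ') (v : Fin p → ℝ) : (κ - κ') * (v ⬝ᵥ v) ≤ v ⬝ᵥ A *ᵥ v := by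
  have h1 := abs_dotProduct_mulVec_le (A - B) v
  have h2 : 0 ≤ v ⬝ᵥ v := by rw [dotProduct_self_eq_norm_sq]; positivity
  rw [Matrix.sub_mulVec, dotProduct_sub] at h1
  have h3 := mul_le_mul_of_nonneg_right hAB h2
  have := (abs_le.1 h1).1
  linarith [h v]

theorem quadForm_ge_of_sub {κ κ' : ℝ} (h : ∀ v, v ⬝ᵥ B *ᵥ v ≤ κ * (v ⬝ᵥ v))
    (hAB : specNorm (A - B) ≤ κ') (v : Fin p → ℝ) : v ⬝ᵥ A *ᵥ v ≤ (κ + κ') * (v ⬝ᵥ v) := by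
  have h1 := abs_dotProduct_mulVec_le (A - B) v
  have h2 : 0 ≤ v ⬝ᵥ v := by rw [dotProduct_self_eq_norm_sq]; positivity
  rw [Matrix.sub_mulVec, dotProduct_sub] at h1
  have h3 := mul_le_mul_of_nonneg_right hAB h2
  have := (abs_le.1 h1).2
  linarith [h v]

/-- Resolvent identity A⁻¹ - B⁻¹ = -A⁻¹(A - B)B⁻¹. -/
theorem specNorm_inv_sub_inv_le (hA : A.PosDef) (hB : B.PosDef) :
    specNorm (A⁻¹ - B⁻¹) ≤ specNorm A⁻¹ * specNorm (A - B) * specNorm B⁻¹ := by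
  have e : A⁻¹ - B⁻¹ = -(A⁻¹ * (A - B) * B⁻¹) := by
    rw [Matrix.mul_sub, Matrix.sub_mul, Matrix.nonsing_inv_mul _ hA.isUnit_det, Matrix.mul_assoc,
      Matrix.mul_nonsing_inv _ hB.isUnit_det]
    simp
  rw [e, specNorm_neg]
  exact (specNorm_mul_le _ _).trans
    (mul_le_mul_of_nonneg_right (specNorm_mul_le _ _) (specNorm_nonneg _))

open scoped MatrixOrder Matrix.Norms.L2Operator in
theorem Matrix.PosDef.exists_eq_mul_transpose (hA : A.PosDef) :
    ∃ C : Matrix (Fin p) (Fin p) ℝ, IsUnit C.det ∧ A = C * Cᵀ := by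
  obtain ⟨C, hC⟩ := CStarAlgebra.nonneg_iff_eq_star_mul_self.mp hA.posSemidef.nonneg
  refine ⟨Cᵀ, ?_, ?_⟩
  · have h := hA.det_pos.ne'
    rw [hC, Matrix.det_mul] at h
    rw [Matrix.det_transpose]
    exact (right_ne_zero_of_mul h).isUnit
  · rw [hC, Matrix.transpose_transpose, Matrix.star_eq_conjTranspose,
      Matrix.conjTranspose_eq_transpose_of_trivial]

/-- Sum log λ ≤ λ - 1 over the eigenvalues. This is the case B = 1 of
`Matrix.PosDef.log_det_sub_le`. -/
theorem Matrix.PosDef.log_det_le (hA : A.PosDef) : Real.log A.det ≤ A.trace - p := by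
  have h1 := hA.isHermitian.det_eq_prod_eigenvalues
  have h2 := hA.isHermitian.trace_eq_sum_eigenvalues
  simp only [RCLike.ofReal_real_eq_id, id] at h1 h2
  rw [h1, h2, Real.log_prod fun i _ => (hA.eigenvalues_pos i).ne']
  have : ((p : ℕ) : ℝ) = ∑ _i : Fin p, (1 : ℝ) := by simp
  rw [this, ← Finset.sum_sub_distrib]
  exact Finset.sum_le_sum fun i _ => Real.log_le_sub_one_of_pos (hA.eigenvalues_pos i)

/-- Concavity of the logarithm of the determinant. -/
theorem Matrix.PosDef.log_det_sub_le (hA : A.PosDef) (hB : B.PosDef) :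
    Real.log A.det - Real.log B.det ≤ (B⁻¹ * (A - B)).trace := by
  -- Congruence by C⁻¹ moves B = CCᵀ to the identity and keeps both sides of the inequality.
  obtain ⟨C, hC, rfl⟩ := hB.exists_eq_mul_transpose
  have hCu : IsUnit C⁻¹ := by
    rw [Matrix.isUnit_iff_isUnit_det]; exact Matrix.isUnit_nonsing_inv_det _ hC
  have hCt : IsUnit Cᵀ.det := by rwa [Matrix.det_transpose]
  have hM : (C⁻¹ * A * C⁻¹ᵀ).PosDef := by
    have := (Matrix.IsUnit.posDef_star_right_conjugate_iff (x := A) hCu).2 hA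
    rwa [Matrix.star_eq_conjTranspose, Matrix.conjTranspose_eq_transpose_of_trivial] at this
  have h := hM.log_det_le
  have hd : (C⁻¹ * A * C⁻¹ᵀ).det = A.det / (C * Cᵀ).det := by
    have : C.det ≠ 0 := hC.ne_zero
    simp only [Matrix.det_mul, Matrix.det_transpose, Matrix.det_nonsing_inv, Ring.inverse_eq_inv']
    field_simp
  have ht : (C⁻¹ * A * C⁻¹ᵀ).trace = ((C * Cᵀ)⁻¹ * A).trace := by
    rw [Matrix.mul_assoc, Matrix.trace_mul_comm, Matrix.mul_inv_rev, Matrix.mul_assoc,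
      Matrix.transpose_nonsing_inv, Matrix.trace_mul_comm, Matrix.mul_assoc, ← Matrix.mul_assoc,
      Matrix.trace_mul_comm]
  rw [hd, Real.log_div hA.det_pos.ne' hB.det_pos.ne', ht] at h
  rw [Matrix.mul_sub, Matrix.trace_sub, Matrix.nonsing_inv_mul _ hB.isUnit_det, Matrix.trace_one]
  simpa using h

/-- Concavity applied in both directions, with the trace bounded by p times the norm. -/
theorem Matrix.PosDef.abs_log_det_sub_le (hA : A.PosDef) (hB : B.PosDef) {b : ℝ}
    (hAb : specNorm A⁻¹ ≤ b) (hBb : specNorm B⁻¹ ≤ b) :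
    |Real.log A.det - Real.log B.det| ≤ p * (b * specNorm (A - B)) := by
  have key : ∀ {A B : Matrix (Fin p) (Fin p) ℝ}, A.PosDef → B.PosDef → specNorm B⁻¹ ≤ b →
      Real.log A.det - Real.log B.det ≤ p * (b * specNorm (A - B)) := fun hA hB hb => by
    refine (hA.log_det_sub_le hB).trans ((le_abs_self _).trans ((abs_trace_le _).trans ?_))
    gcongr
    exact (specNorm_mul_le _ _).trans (mul_le_mul_of_nonneg_right hb (specNorm_nonneg _))
  rw [abs_sub_le_iff]
  refine ⟨key hA hB hBb, ?_⟩
  have := key hB hA hAb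
  rwa [← neg_sub A B, specNorm_neg] at this

theorem WellConditioned.quadForm_bounds {κ : ℝ} (h : WellConditioned κ A) (v : Fin p → ℝ) :
    κ * (v ⬝ᵥ v) ≤ v ⬝ᵥ A *ᵥ v ∧ v ⬝ᵥ A *ᵥ v ≤ 1 / κ * (v ⬝ᵥ v) := by
  obtain ⟨hA, hev⟩ := h
  set U : Matrix (Fin p) (Fin p) ℝ := (hA.eigenvectorUnitary).1 with hU
  have hUU : U * Uᵀ = 1 := by
    have := Unitary.mul_star_self_of_mem hA.eigenvectorUnitary.2
    rwa [Matrix.star_eq_conjTranspose, Matrix.conjTranspose_eq_transpose_of_trivial] at this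
  have hsp : A = U * Matrix.diagonal hA.eigenvalues * Uᵀ := by
    have := hA.spectral_theorem
    rw [Unitary.conjStarAlgAut_apply] at this
    rw [Matrix.star_eq_conjTranspose, Matrix.conjTranspose_eq_transpose_of_trivial] at this
    simpa using this
  have hq : v ⬝ᵥ A *ᵥ v = ∑ i, hA.eigenvalues i * (Uᵀ *ᵥ v) i ^ 2 := by
    conv_lhs => rw [hsp]
    rw [← Matrix.mulVec_mulVec, ← Matrix.mulVec_mulVec, Matrix.dotProduct_mulVec,
      ← Matrix.mulVec_transpose, dotProduct]
    refine Finset.sum_congr rfl fun i _ => ?_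
    rw [Matrix.mulVec_diagonal]; ring
  have hn : v ⬝ᵥ v = ∑ i, (Uᵀ *ᵥ v) i ^ 2 := by
    have : v ⬝ᵥ v = v ⬝ᵥ (U * Uᵀ) *ᵥ v := by rw [hUU, Matrix.one_mulVec]
    rw [this, ← Matrix.mulVec_mulVec, Matrix.dotProduct_mulVec, ← Matrix.mulVec_transpose,
      dotProduct]
    exact Finset.sum_congr rfl fun i _ => by ring
  rw [hq, hn, Finset.mul_sum, Finset.mul_sum]
  exact ⟨Finset.sum_le_sum fun i _ => mul_le_mul_of_nonneg_right (hev i).1 (sq_nonneg _),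
    Finset.sum_le_sum fun i _ => mul_le_mul_of_nonneg_right (hev i).2 (sq_nonneg _)⟩

theorem WellConditioned.isSymm {κ : ℝ} (h : WellConditioned κ A) : A.IsSymm := by
  obtain ⟨hA, -⟩ := h
  rwa [Matrix.IsHermitian, Matrix.conjTranspose_eq_transpose_of_trivial] at hA

end PositiveDefinite

/-! ### The Jacobian of congruence on symmetric matrices. -/

section SymmetricCoordinates

variable {p : ℕ}

/-- The symmetric matrix with prescribed coordinates on unordered pairs of indices. -/
def symMatrix (v : Sym2 (Fin p) → ℝ) : Matrix (Fin p) (Fin p) ℝ := Matrix.of fun i j => v s(i, j)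

theorem symMatrix_isSymm (v : Sym2 (Fin p) → ℝ) : (symMatrix v).IsSymm := by
  ext i j
  simp [symMatrix, Sym2.eq_swap]

theorem symMatrix_injective : Function.Injective (symMatrix (p := p)) := by
  intro v w h
  ext e
  induction e with
  | _ i j => exact congrFun (congrFun h i) j

/-- Congruence `A ↦ B A Bᵀ` in the coordinates of symmetric matrices. -/
def congrSym (B : Matrix (Fin p) (Fin p) ℝ) :
    (Sym2 (Fin p) → ℝ) →ₗ[ℝ] (Sym2 (Fin p) → ℝ) where
  toFun v e := Sym2.lift ⟨fun i j => (B * symMatrix v * Bᵀ) i j, fun i j => by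
    have h : (B * symMatrix v * Bᵀ)ᵀ = B * symMatrix v * Bᵀ := by
      rw [Matrix.transpose_mul, Matrix.transpose_mul, (symMatrix_isSymm v).eq,
        Matrix.transpose_transpose, Matrix.mul_assoc]
    exact (congrFun (congrFun h j) i)⟩ e
  map_add' v w := by
    ext e
    induction e with
    | _ i j =>
      have : symMatrix (v + w) = symMatrix v + symMatrix w := rfl
      simp [this, Matrix.mul_add, Matrix.add_mul]
  map_smul' a v := by
    ext e
    induction e with
    | _ i j =>
      have : symMatrix (a • v) = a • symMatrix v := rfl
      simp [this]

theorem symMatrix_congrSym (B : Matrix (Fin p) (Fin p) ℝ) (v : Sym2 (Fin p) → ℝ) :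
    symMatrix (congrSym B v) = B * symMatrix v * Bᵀ := rfl

theorem congrSym_mul (B C : Matrix (Fin p) (Fin p) ℝ) :
    congrSym (B * C) = congrSym B ∘ₗ congrSym C := by
  refine LinearMap.ext fun v => symMatrix_injective ?_
  simp only [LinearMap.comp_apply, symMatrix_congrSym, Matrix.transpose_mul, Matrix.mul_assoc]

theorem congrSym_one : congrSym (1 : Matrix (Fin p) (Fin p) ℝ) = LinearMap.id := by
  refine LinearMap.ext fun v => symMatrix_injective ?_
  simp [symMatrix_congrSym]

theorem det_congrSym_mul (B C : Matrix (Fin p) (Fin p) ℝ) :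
    LinearMap.det (congrSym (B * C)) = LinearMap.det (congrSym B) * LinearMap.det (congrSym C) := by
  rw [congrSym_mul, LinearMap.det_comp]

/-- Among ordered pairs i ≤ j, an index is the smaller entry p - i times and the larger entry i + 1
times (counting from 0, the diagonal pair counted in both), so b i occurs p + 1 times. -/
theorem prod_sym2_mul (b : Fin p → ℝ) :
    ∏ e : Sym2 (Fin p), Sym2.lift ⟨fun i j => b i * b j, fun _ _ => mul_comm _ _⟩ e =
      (∏ i, b i) ^ (p + 1) := by
  have hset : ∀ f : Fin p × Fin p → ℝ, ∏ q : {q : Fin p × Fin p // q.1 ≤ q.2}, f q =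
      ∏ q : Fin p × Fin p, if q.1 ≤ q.2 then f q else 1 := fun f => by
    rw [← Finset.prod_filter, ← Finset.prod_subtype]
    simp
  rw [← Equiv.prod_comp Sym2.sortEquiv.symm]
  have : ∀ q : {q : Fin p × Fin p // q.1 ≤ q.2},
      Sym2.lift ⟨fun i j => b i * b j, fun _ _ => mul_comm _ _⟩ (Sym2.sortEquiv.symm q) =
        (fun q : Fin p × Fin p => b q.1 * b q.2) q := fun q => rfl
  simp_rw [this]
  rw [hset fun q => b q.1 * b q.2]
  have hsplit : ∀ q : Fin p × Fin p, (if q.1 ≤ q.2 then b q.1 * b q.2 else 1) =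
      (if q.1 ≤ q.2 then b q.1 else 1) * (if q.1 ≤ q.2 then b q.2 else 1) := fun q => by
    split_ifs <;> simp
  simp_rw [hsplit]
  rw [Finset.prod_mul_distrib, Fintype.prod_prod_type, Fintype.prod_prod_type_right]
  simp only
  rw [← Finset.prod_mul_distrib, ← Finset.prod_pow]
  refine Finset.prod_congr rfl fun i _ => ?_
  rw [← Finset.prod_filter, ← Finset.prod_filter, Finset.prod_const, Finset.prod_const, ← pow_add]
  congr 1
  have h1 : (Finset.univ.filter fun j => i ≤ j) = Finset.Ici i := by ext; simp
  have h2 : (Finset.univ.filter fun j => j ≤ i) = Finset.Iic i := by ext; simp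
  rw [h1, h2, Fin.card_Ici, Fin.card_Iic]
  have := i.2
  omega

theorem det_congrSym_diagonal (b : Fin p → ℝ) :
    LinearMap.det (congrSym (Matrix.diagonal b)) = (∏ i, b i) ^ (p + 1) := by
  have h : congrSym (Matrix.diagonal b) = Matrix.toLin' (Matrix.diagonal
      fun e => Sym2.lift ⟨fun i j => b i * b j, fun _ _ => mul_comm _ _⟩ e) := by
    refine LinearMap.ext fun v => funext fun e => ?_
    rw [Matrix.toLin'_apply, Matrix.mulVec_diagonal]
    induction e with
    | _ i j =>
      change (Matrix.diagonal b * symMatrix v * (Matrix.diagonal b)ᵀ) i j = b i * b j * v s(i, j)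
      rw [Matrix.diagonal_transpose, Matrix.mul_diagonal, Matrix.diagonal_mul]
      simp only [symMatrix, Matrix.of_apply]
      ring
  rw [h, LinearMap.det_toLin', Matrix.det_diagonal, prod_sym2_mul]

theorem det_congrSym_ne_zero {B : Matrix (Fin p) (Fin p) ℝ} (hB : IsUnit B.det) :
    LinearMap.det (congrSym B) ≠ 0 := by
  intro h
  have := det_congrSym_mul B B⁻¹
  rw [Matrix.mul_nonsing_inv _ hB, congrSym_one, LinearMap.det_id, h, zero_mul] at this
  exact one_ne_zero this

/-- Conjugation by a diagonal matrix with the entry 2 at position i turns the transvection T into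
T². Hence the nonzero determinant d of its congruence satisfies d = d². -/
theorem det_congrSym_transvection {i j : Fin p} (hij : i ≠ j) (t : ℝ) :
    LinearMap.det (congrSym (Matrix.transvection i j t)) = 1 := by
  set D : Matrix (Fin p) (Fin p) ℝ := Matrix.diagonal (Function.update 1 i 2) with hD
  have hcomm : D * Matrix.transvection i j t =
      Matrix.transvection i j t * Matrix.transvection i j t * D := by
    rw [Matrix.transvection_mul_transvection_same _ _ hij, Matrix.transvection,
      Matrix.transvection, Matrix.mul_add, Matrix.add_mul, mul_one, one_mul]
    congr 1
    ext k l
    rw [hD, Matrix.diagonal_mul, Matrix.mul_diagonal]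
    by_cases hk : i = k
    · subst hk
      by_cases hl : j = l
      · subst hl
        simp [Function.update_of_ne hij.symm]
        ring
      · simp [Matrix.single_apply_of_col_ne _ _ hl]
    · simp [Matrix.single_apply_of_row_ne hk]
  have hT : IsUnit (Matrix.transvection i j t).det := by
    rw [Matrix.det_transvection_of_ne _ _ hij]; exact isUnit_one
  have hDu : IsUnit D.det := by
    rw [hD, Matrix.det_diagonal, isUnit_iff_ne_zero, Finset.prod_ne_zero_iff]
    intro k _
    by_cases hk : k = i
    · subst hk; simp
    · simp [Function.update_of_ne hk]
  have h := congrArg (fun M => LinearMap.det (congrSym M)) hcomm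
  simp only [det_congrSym_mul] at h
  have h1 := det_congrSym_ne_zero hT
  have h2 := det_congrSym_ne_zero hDu
  rw [mul_comm] at h
  have h3 := mul_right_cancel₀ h2 h
  exact (mul_left_cancel₀ h1 (by rw [mul_one]; exact h3)).symm

/-- Both sides are multiplicative, and diagonal matrices and transvections generate the invertible
matrices. -/
theorem det_congrSym {B : Matrix (Fin p) (Fin p) ℝ} (hB : B.det ≠ 0) :
    LinearMap.det (congrSym B) = B.det ^ (p + 1) := by
  refine Matrix.diagonal_transvection_induction_of_det_ne_zero
    (fun B => LinearMap.det (congrSym B) = B.det ^ (p + 1)) B hB ?_ ?_ ?_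
  · intro b _
    rw [det_congrSym_diagonal, Matrix.det_diagonal]
  · intro t
    rw [Matrix.TransvectionStruct.det, one_pow]
    exact det_congrSym_transvection t.hij t.c
  · intro A C _ _ hA hC
    rw [det_congrSym_mul, hA, hC, Matrix.det_mul, mul_pow]

end SymmetricCoordinates

/-! ### Measurability of matrix operations. -/

section MatrixMeasurability

variable {p : ℕ} {α : Type*} [MeasurableSpace α]

instance matrixBorelSpace : BorelSpace (Matrix (Fin p) (Fin p) ℝ) :=
  inferInstanceAs (BorelSpace (Fin p → Fin p → ℝ))

theorem measurable_matrix_iff {f : α → Matrix (Fin p) (Fin p) ℝ} :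
    Measurable f ↔ ∀ i j, Measurable fun x => f x i j := by
  constructor
  · exact fun h i j => (measurable_pi_apply j).comp ((measurable_pi_apply i).comp h)
  · exact fun h => measurable_pi_lambda _ fun i => measurable_pi_lambda _ fun j => h i j

theorem Measurable.matrixDet {f : α → Matrix (Fin p) (Fin p) ℝ} (hf : Measurable f) :
    Measurable fun x => (f x).det :=
  (Continuous.matrix_det continuous_id).measurable.comp hf

theorem Measurable.matrixInv {f : α → Matrix (Fin p) (Fin p) ℝ} (hf : Measurable f) :
    Measurable fun x => (f x)⁻¹ := by
  simp only [Matrix.inv_def, Ring.inverse_eq_inv']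
  refine measurable_matrix_iff.2 fun i j => ?_
  simp only [Matrix.smul_apply, smul_eq_mul]
  have h : Measurable fun A : Matrix (Fin p) (Fin p) ℝ => A.adjugate :=
    (Continuous.matrix_adjugate continuous_id).measurable
  exact hf.matrixDet.inv.mul (measurable_matrix_iff.1 (h.comp hf) i j)

theorem Measurable.traceMul {f g : α → Matrix (Fin p) (Fin p) ℝ} (hf : Measurable f)
    (hg : Measurable g) : Measurable fun x => (f x * g x).trace := by
  simp only [Matrix.trace, Matrix.diag, Matrix.mul_apply]
  exact Finset.measurable_sum _ fun i _ => Finset.measurable_sum _ fun j _ =>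
    (measurable_matrix_iff.1 hf i j).mul (measurable_matrix_iff.1 hg j i)

theorem measurableSet_posDef : MeasurableSet {A : Matrix (Fin p) (Fin p) ℝ | A.PosDef} := by
  have e : {A : Matrix (Fin p) (Fin p) ℝ | A.PosDef} =
      -- The positive definite cone is the closed semidefinite cone minus the zero set of the
      -- determinant.
      ({A | A.IsSymm} ∩ ⋂ v : Fin p → ℝ, {A | 0 ≤ v ⬝ᵥ A *ᵥ v}) ∩ {A | A.det ≠ 0} := by
    ext A
    simp only [Set.mem_inter_iff, Set.mem_iInter, Set.mem_ofPred_eq]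
    constructor
    · exact fun h => ⟨⟨h.isSymm, h.quadForm_nonneg⟩, h.det_pos.ne'⟩
    · rintro ⟨⟨h1, h2⟩, h3⟩
      have h : A.PosSemidef := Matrix.PosSemidef.of_dotProduct_mulVec_nonneg
        (by rwa [Matrix.IsHermitian, Matrix.conjTranspose_eq_transpose_of_trivial])
        (by simpa using h2)
      exact h.posDef_iff_det_ne_zero.2 h3
  rw [e]
  refine MeasurableSet.inter (IsClosed.measurableSet (IsClosed.inter ?_ (isClosed_iInter
    fun v => ?_))) ?_
  · exact isClosed_eq (Continuous.matrix_transpose continuous_id) continuous_id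
  · refine isClosed_le continuous_const ?_
    exact Continuous.dotProduct continuous_const (continuous_id.matrix_mulVec continuous_const)
  · exact (measurableSet_singleton (0 : ℝ)).compl.preimage measurable_id.matrixDet

end MatrixMeasurability

/-! ### The inverse Wishart integral as a function of the scale matrix. -/

section ChangeOfVariables

variable {p : ℕ}

theorem measurable_symMatrix : Measurable (symMatrix (p := p)) :=
  measurable_matrix_iff.2 fun _ _ => measurable_pi_apply _

theorem lintegral_symLebesgue {f : Matrix (Fin p) (Fin p) ℝ → ℝ≥0∞} (hf : Measurable f) :
    ∫⁻ A, f A ∂symLebesgue p = ∫⁻ v, f (symMatrix v) :=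
  lintegral_map hf measurable_symMatrix

instance : SFinite (symLebesgue p) := by
  unfold symLebesgue
  infer_instance

theorem lintegral_congr_symLebesgue {f : Matrix (Fin p) (Fin p) ℝ → ℝ≥0∞} (hf : Measurable f)
    {B : Matrix (Fin p) (Fin p) ℝ} (hB : B.det ≠ 0) :
    ∫⁻ A, f A ∂symLebesgue p =
      ENNReal.ofReal (|B.det| ^ (p + 1)) * ∫⁻ A, f (B * A * Bᵀ) ∂symLebesgue p := by
  have hm : Measurable fun A : Matrix (Fin p) (Fin p) ℝ => B * A * Bᵀ := by
    apply Continuous.measurable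
    fun_prop
  have hd : LinearMap.det (congrSym B) ≠ 0 := det_congrSym_ne_zero hB.isUnit
  have hL : Measurable (congrSym B) := (congrSym B).continuous_of_finiteDimensional.measurable
  rw [lintegral_symLebesgue hf, lintegral_symLebesgue (f := fun A => f (B * A * Bᵀ)) (hf.comp hm)]
  have h := lintegral_map (μ := volume) (hf.comp measurable_symMatrix) hL
  rw [Real.map_linearMap_volume_pi_eq_smul_volume_pi hd, lintegral_smul_measure] at h
  simp only [Function.comp_apply, symMatrix_congrSym, smul_eq_mul] at h
  rw [← h, ← mul_assoc, ← ENNReal.ofReal_mul (by positivity), det_congrSym hB, abs_inv, abs_pow,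
    mul_inv_cancel₀ (by positivity), ENNReal.ofReal_one, one_mul]

open Classical in
/-- The inverse Wishart kernel `det(A)^{-m/2} exp(-tr(A⁻¹ Ψ)/2)` on positive definite matrices. -/
noncomputable def iwKernel (m : ℝ) (Ψ A : Matrix (Fin p) (Fin p) ℝ) : ℝ≥0∞ :=
  if A.PosDef then ENNReal.ofReal (A.det ^ (-m / 2) * Real.exp (-(A⁻¹ * Ψ).trace / 2)) else 0

theorem measurable_iwKernel {α : Type*} [MeasurableSpace α] (m : ℝ)
    {f g : α → Matrix (Fin p) (Fin p) ℝ} (hf : Measurable f) (hg : Measurable g) :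
    Measurable fun x => iwKernel m (f x) (g x) := by
  refine Measurable.ite (measurableSet_posDef.preimage hg) ?_ measurable_const
  exact ((hg.matrixDet.pow_const _).mul
    (((hg.matrixInv.traceMul hf).neg.div_const 2).exp)).ennreal_ofReal

/-- The normalizing integral of the inverse Wishart kernel. -/
noncomputable def iwIntegral (m : ℝ) (Ψ : Matrix (Fin p) (Fin p) ℝ) : ℝ≥0∞ :=
  ∫⁻ A, iwKernel m Ψ A ∂symLebesgue p

theorem iwKernel_congr (m : ℝ) {B : Matrix (Fin p) (Fin p) ℝ} (hB : IsUnit B.det)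
    (A : Matrix (Fin p) (Fin p) ℝ) :
    iwKernel m (B * Bᵀ) (B * A * Bᵀ) = ENNReal.ofReal (|B.det| ^ (-m)) * iwKernel m 1 A := by
  have hBu : IsUnit B := (Matrix.isUnit_iff_isUnit_det _).2 hB
  have hpd : (B * A * Bᵀ).PosDef ↔ A.PosDef := by
    have := Matrix.IsUnit.posDef_star_right_conjugate_iff (x := A) hBu
    rwa [Matrix.star_eq_conjTranspose, Matrix.conjTranspose_eq_transpose_of_trivial] at this
  unfold iwKernel
  by_cases hA : A.PosDef
  · rw [if_pos hA, if_pos (hpd.2 hA), ← ENNReal.ofReal_mul (by positivity)]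
    congr 1
    have hBt : IsUnit Bᵀ.det := by rwa [Matrix.det_transpose]
    have ht : ((B * A * Bᵀ)⁻¹ * (B * Bᵀ)).trace = (A⁻¹ * 1).trace := by
      rw [Matrix.mul_inv_rev, Matrix.mul_inv_rev, Matrix.mul_assoc, Matrix.trace_mul_comm,
        Matrix.mul_assoc, Matrix.mul_assoc, Matrix.mul_assoc, Matrix.mul_nonsing_inv _ hBt,
        Matrix.mul_one, Matrix.mul_one, Matrix.nonsing_inv_mul _ hB, Matrix.mul_one]
    have hd : (B * A * Bᵀ).det = |B.det| ^ (2 : ℝ) * A.det := by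
      rw [Matrix.det_mul, Matrix.det_mul, Matrix.det_transpose, Real.rpow_two, sq_abs]
      ring
    rw [ht, hd, Real.mul_rpow (by positivity) hA.det_pos.le, ← Real.rpow_mul (abs_nonneg _)]
    rw [show 2 * (-m / 2) = -m by ring]
    ring
  · rw [if_neg hA, if_neg (mt hpd.1 hA), mul_zero]

/-- Write Ψ = BBᵀ and substitute A ↦ BABᵀ: the Jacobian gives |det B|^{p+1} and the kernel |det
B|^{-m}. The integral is in `ℝ≥0∞`, so its finiteness is not needed. -/
theorem iwIntegral_eq {Ψ : Matrix (Fin p) (Fin p) ℝ} (hΨ : Ψ.PosDef) (m : ℝ) :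
    iwIntegral m Ψ = ENNReal.ofReal (Ψ.det ^ (-(m - p - 1) / 2)) * iwIntegral (p := p) m 1 := by
  obtain ⟨B, hB, rfl⟩ := hΨ.exists_eq_mul_transpose
  have h0 : 0 < |B.det| := abs_pos.2 hB.ne_zero
  unfold iwIntegral
  rw [lintegral_congr_symLebesgue (f := fun A => iwKernel m (B * Bᵀ) A)
    (measurable_iwKernel m measurable_const measurable_id) hB.ne_zero]
  simp_rw [iwKernel_congr m hB]
  rw [lintegral_const_mul _ (f := fun A => iwKernel m 1 A)
    (measurable_iwKernel m measurable_const measurable_id), ← mul_assoc,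
    ← ENNReal.ofReal_mul (by positivity)]
  congr 2
  rw [Matrix.det_mul, Matrix.det_transpose, ← abs_mul_abs_self, ← pow_two, ← Real.rpow_natCast,
    ← Real.rpow_natCast, ← Real.rpow_mul h0.le, ← Real.rpow_add h0]
  congr 1
  push_cast
  ring

end ChangeOfVariables

/-! ### Chernoff bounds and spectral concentration for the inverse Wishart kernel. -/

section InverseWishartTails

variable {p : ℕ}

theorem trace_mul_add_smul_vecMulVec (M Ψ : Matrix (Fin p) (Fin p) ℝ) (s : ℝ) (u : Fin p → ℝ) :
    (M * (Ψ + s • Matrix.vecMulVec u u)).trace = (M * Ψ).trace + s * (u ⬝ᵥ M *ᵥ u) := by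
  rw [Matrix.mul_add, Matrix.trace_add, Matrix.mul_smul, Matrix.trace_smul, Matrix.mul_vecMulVec,
    Matrix.trace_vecMulVec, dotProduct_comm, smul_eq_mul]

/-- The family of kernels is closed under exponential tilting in uᵀA⁻¹u; this makes Laplace
transforms computable. -/
theorem exp_mul_iwKernel (m s : ℝ) (Ψ A : Matrix (Fin p) (Fin p) ℝ) (u : Fin p → ℝ) :
    ENNReal.ofReal (Real.exp (-s / 2 * (u ⬝ᵥ A⁻¹ *ᵥ u))) * iwKernel m Ψ A =
      iwKernel m (Ψ + s • Matrix.vecMulVec u u) A := by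
  unfold iwKernel
  split_ifs
  · rw [← ENNReal.ofReal_mul (by positivity), trace_mul_add_smul_vecMulVec]
    congr 1
    rw [mul_left_comm, ← Real.exp_add]
    congr 2
    ring
  · simp

/-- Chernoff bound for quadratic forms of the inverse of an inverse Wishart matrix. -/
theorem setLIntegral_iwKernel_le {m s c : ℝ} {Ψ : Matrix (Fin p) (Fin p) ℝ} {u : Fin p → ℝ}
    (hΨ : Ψ.PosDef) (hs : (Ψ + s • Matrix.vecMulVec u u).PosDef)
    {E : Set (Matrix (Fin p) (Fin p) ℝ)} (hE : ∀ A ∈ E, c ≤ -s / 2 * (u ⬝ᵥ A⁻¹ *ᵥ u)) :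
    ∫⁻ A in E, iwKernel m Ψ A ∂symLebesgue p ≤
      ENNReal.ofReal (Real.exp (-c) * (1 + s * (u ⬝ᵥ Ψ⁻¹ *ᵥ u)) ^ (-(m - p - 1) / 2)) *
        iwIntegral m Ψ := by
  have hk : Measurable fun A : Matrix (Fin p) (Fin p) ℝ =>
      iwKernel m (Ψ + s • Matrix.vecMulVec u u) A :=
    measurable_iwKernel m measurable_const measurable_id
  -- The sign of s is free here: upper tails use negative s, and positivity is read off from the
  -- determinant of the updated scale matrix.
  have hpos : 0 < 1 + s * (u ⬝ᵥ Ψ⁻¹ *ᵥ u) := by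
    have := hs.det_pos
    rw [hΨ.det_add_smul_vecMulVec] at this
    exact (mul_pos_iff_of_pos_left hΨ.det_pos).1 this
  calc ∫⁻ A in E, iwKernel m Ψ A ∂symLebesgue p
      ≤ ∫⁻ A in E, ENNReal.ofReal (Real.exp (-c)) *
          iwKernel m (Ψ + s • Matrix.vecMulVec u u) A ∂symLebesgue p := by
        refine setLIntegral_mono (hk.const_mul _) fun A hA => ?_
        rw [← exp_mul_iwKernel, ← mul_assoc, ← ENNReal.ofReal_mul (by positivity), ← Real.exp_add]
        refine le_mul_of_one_le_left' ?_
        rw [ENNReal.one_le_ofReal, Real.one_le_exp_iff]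
        linarith [hE A hA]
    _ ≤ ∫⁻ A, ENNReal.ofReal (Real.exp (-c)) *
          iwKernel m (Ψ + s • Matrix.vecMulVec u u) A ∂symLebesgue p := setLIntegral_le_lintegral _ _
    _ = ENNReal.ofReal (Real.exp (-c)) * iwIntegral m (Ψ + s • Matrix.vecMulVec u u) := by
        rw [lintegral_const_mul _ hk, iwIntegral]
    _ = _ := by
        rw [iwIntegral_eq hs, iwIntegral_eq hΨ, ← mul_assoc, ← mul_assoc,
          ← ENNReal.ofReal_mul (by positivity), ← ENNReal.ofReal_mul (by positivity),
          hΨ.det_add_smul_vecMulVec, Real.mul_rpow hΨ.det_pos.le hpos.le]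
        congr 2
        ring

/-- This bound and the next one both come from log x ≥ 1 - 1/x, with the second-order term kept
explicit. -/
theorem one_sub_rpow_neg_le {y r : ℝ} (hy2 : y ≤ 1 / 2) (hr : 0 ≤ r) :
    (1 - y) ^ (-r) ≤ Real.exp (r * (y + 2 * y ^ 2)) := by
  have h1 : (0 : ℝ) < 1 - y := by linarith
  rw [Real.rpow_def_of_pos h1, Real.exp_le_exp]
  have h2 := Real.one_sub_inv_le_log_of_pos h1
  have h3 : (1 - y)⁻¹ ≤ 1 + (y + 2 * y ^ 2) := by
    rw [inv_le_iff_one_le_mul₀ h1]; nlinarith [sq_nonneg y]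
  nlinarith

theorem one_add_rpow_neg_le {z r : ℝ} (hz : 0 ≤ z) (hr : 0 ≤ r) :
    (1 + z) ^ (-r) ≤ Real.exp (-(r * (z - z ^ 2))) := by
  have h1 : (0 : ℝ) < 1 + z := by linarith
  rw [Real.rpow_def_of_pos h1, Real.exp_le_exp]
  have h2 : z - z ^ 2 ≤ Real.log (1 + z) := by
    have := Real.one_sub_inv_le_log_of_pos h1
    have h3 : z - z ^ 2 ≤ 1 - (1 + z)⁻¹ := by
      have : 1 - (1 + z)⁻¹ = z / (1 + z) := by field_simp; ring
      rw [this, le_div_iff₀ h1]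
      nlinarith [mul_nonneg (mul_nonneg hz hz) hz]
    linarith
  nlinarith

theorem inv_smul_quadForm {A : Matrix (Fin p) (Fin p) ℝ} (hA : A.PosDef) {a : ℝ} (ha : 0 < a)
    (u : Fin p → ℝ) : u ⬝ᵥ (a • A)⁻¹ *ᵥ u = a⁻¹ * (u ⬝ᵥ A⁻¹ *ᵥ u) := by
  have := invertibleOfNonzero ha.ne'
  rw [Matrix.inv_smul _ _ hA.isUnit_det, Matrix.smul_mulVec, dotProduct_smul, invOf_eq_inv,
    smul_eq_mul]

theorem smul_quadForm (A : Matrix (Fin p) (Fin p) ℝ) (a : ℝ) (v : Fin p → ℝ) :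
    v ⬝ᵥ (a • A) *ᵥ v = a * (v ⬝ᵥ A *ᵥ v) := by
  rw [Matrix.smul_mulVec, dotProduct_smul, smul_eq_mul]

/-- Two-sided concentration of quadratic forms of the inverse. -/
theorem setLIntegral_iwKernel_quadForm_le {S Ψ : Matrix (Fin p) (Fin p) ℝ} (hp : 1 ≤ p)
    (hS : S.PosDef) (hΨ : Ψ.PosDef) {n ν h : ℝ} (hn : 0 < n) (hν : 0 < ν) (hh : 0 < h)
    (hh1 : h ≤ 1) (hlow : ∀ v, n * (v ⬝ᵥ S *ᵥ v) ≤ v ⬝ᵥ Ψ *ᵥ v)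
    (hup : ∀ v, v ⬝ᵥ Ψ *ᵥ v ≤ n * (1 + h / 4) * (v ⬝ᵥ S *ᵥ v)) {u : Fin p → ℝ} (hu : u ≠ 0) :
    ∫⁻ A in {A | (1 + h) * (u ⬝ᵥ S⁻¹ *ᵥ u) ≤ u ⬝ᵥ A⁻¹ *ᵥ u}, iwKernel (n + ν + 2 * p) Ψ A
        ∂symLebesgue p ≤
      ENNReal.ofReal (Real.exp (-(n * h ^ 2 / 16) + (ν + p))) * iwIntegral (n + ν + 2 * p) Ψ ∧
    ∫⁻ A in {A | u ⬝ᵥ A⁻¹ *ᵥ u ≤ (1 - h) * (u ⬝ᵥ S⁻¹ *ᵥ u)}, iwKernel (n + ν + 2 * p) Ψ A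
        ∂symLebesgue p ≤
      ENNReal.ofReal (Real.exp (-(n * h ^ 2 / 16) + (ν + p))) * iwIntegral (n + ν + 2 * p) Ψ := by
  have hp' : (1 : ℝ) ≤ p := by exact_mod_cast hp
  set s0 := u ⬝ᵥ S⁻¹ *ᵥ u with hs0
  have hs0p : 0 < s0 := hS.inv.quadForm_pos hu
  set q := u ⬝ᵥ Ψ⁻¹ *ᵥ u with hq
  have hq1 : n * q ≤ s0 := by
    have := (hS.smul hn).inv_quadForm_anti hΨ (fun v => by rw [smul_quadForm]; exact hlow v) u
    rw [inv_smul_quadForm hS hn] at this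
    rwa [← le_inv_mul_iff₀ hn]
  have hq2 : s0 ≤ (1 + h / 4) * (n * q) := by
    have hpos : 0 < n * (1 + h / 4) := by positivity
    have := hΨ.inv_quadForm_anti (hS.smul hpos) (fun v => by rw [smul_quadForm]; exact hup v) u
    rw [inv_smul_quadForm hS hpos, inv_mul_le_iff₀ hpos] at this
    linarith
  have hq0 : 0 < q := hΨ.inv.quadForm_pos hu
  set y := h / 4 with hy
  -- The tilt is chosen so that s·s0 = nh/4. The exponent is then -nyh/2 + ny² = -nh²/16 in both
  -- tails, up to terms of order ν + p.
  set s := n * y / s0 with hs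
  have hsq : s * q = y * (n * q / s0) := by rw [hs]; ring
  have hss : s * s0 = n * y := by rw [hs]; field_simp
  have hs_pos : 0 < s := by positivity
  have hw1 : n * q / s0 ≤ 1 := (div_le_one hs0p).2 hq1
  have hw2 : 1 - y ≤ n * q / s0 := by
    rw [le_div_iff₀ hs0p]
    have : (1 - y) * s0 ≤ (1 - y) * ((1 + y) * (n * q)) :=
      mul_le_mul_of_nonneg_left hq2 (by rw [hy]; linarith)
    nlinarith [mul_pos hn hq0, mul_nonneg (sq_nonneg y) (mul_pos hn hq0).le]
  have hr : -(n + ν + 2 * p - p - 1) / 2 = -((n + ν + p - 1) / 2) := by ring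
  have hr0 : 0 ≤ (n + ν + p - 1) / 2 := by linarith
  constructor
  · have hsq1 : s * q ≤ y := by rw [hsq]; exact mul_le_of_le_one_right (by positivity) hw1
    refine (setLIntegral_iwKernel_le (s := -s) (c := n * y * (1 + h) / 2) (u := u) hΨ
      (hΨ.sub_smul_vecMulVec hs_pos.le (by rw [← hq]; linarith)) ?_).trans ?_
    · intro A hA
      rw [Set.mem_ofPred_eq] at hA
      have := mul_le_mul_of_nonneg_left hA hs_pos.le
      nlinarith
    · gcongr
      rw [hr, ← hq]
      calc _ ≤ Real.exp (-(n * y * (1 + h) / 2)) * (1 - y) ^ (-((n + ν + p - 1) / 2)) := by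
            refine mul_le_mul_of_nonneg_left ?_ (Real.exp_pos _).le
            exact Real.rpow_le_rpow_of_nonpos (by linarith) (by linarith) (by linarith)
        _ ≤ Real.exp (-(n * y * (1 + h) / 2)) *
            Real.exp ((n + ν + p - 1) / 2 * (y + 2 * y ^ 2)) := by
            gcongr
            exact one_sub_rpow_neg_le (by linarith) hr0
        _ ≤ _ := by
            rw [← Real.exp_add, Real.exp_le_exp]
            have e : (ν + p - 1) / 2 * (y + 2 * y ^ 2) ≤ ν + p := by
              have : y + 2 * y ^ 2 ≤ 1 := by nlinarith
              nlinarith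
            have e2 : 0 ≤ n * h ^ 2 := by positivity
            rw [hy] at *
            nlinarith
  · refine (setLIntegral_iwKernel_le (s := s) (c := -(n * y * (1 - h) / 2)) (u := u) hΨ
      (hΨ.add_smul_vecMulVec hs_pos.le u) ?_).trans ?_
    · intro A hA
      rw [Set.mem_ofPred_eq] at hA
      have := mul_le_mul_of_nonneg_left hA hs_pos.le
      nlinarith
    · gcongr
      rw [hr, ← hq, neg_neg]
      set z := y * (1 - y) with hz
      have hz0 : 0 ≤ z := mul_nonneg (by positivity) (by linarith)
      have hzq : z ≤ s * q := by rw [hsq]; exact mul_le_mul_of_nonneg_left hw2 (by positivity)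
      have hzz : y - 2 * y ^ 2 ≤ z - z ^ 2 := by
        have : z ≤ y := mul_le_of_le_one_right (by positivity) (by linarith [hy, hh])
        nlinarith
      calc _ ≤ Real.exp (n * y * (1 - h) / 2) * (1 + z) ^ (-((n + ν + p - 1) / 2)) := by
            refine mul_le_mul_of_nonneg_left ?_ (Real.exp_pos _).le
            exact Real.rpow_le_rpow_of_nonpos (by linarith) (by linarith) (by linarith)
        _ ≤ Real.exp (n * y * (1 - h) / 2) *
            Real.exp (-((n + ν + p - 1) / 2 * (z - z ^ 2))) := by
            gcongr
            exact one_add_rpow_neg_le hz0 hr0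
        _ ≤ _ := by
            rw [← Real.exp_add, Real.exp_le_exp]
            have hy2 : 0 ≤ y - 2 * y ^ 2 := by nlinarith
            have e : n / 2 * (y - 2 * y ^ 2) ≤ (n + ν + p - 1) / 2 * (z - z ^ 2) :=
              mul_le_mul (by linarith) hzz hy2 hr0
            have e2 : 0 ≤ n * h ^ 2 := by positivity
            rw [hy] at *
            nlinarith

/-- Concentration in spectral norm under the inverse Wishart kernel. -/
theorem setLIntegral_iwKernel_specNorm_le {S Ψ : Matrix (Fin p) (Fin p) ℝ} (hp : 1 ≤ p)
    (hΨ : Ψ.PosDef) {n ν h κ : ℝ} (hn : 0 < n) (hν : 0 < ν) (hh : 0 < h)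
    (hκ : 0 < κ) (hκ1 : κ ≤ 1) (hhκ : h ≤ κ ^ 2 / 8) (hS : S.IsSymm)
    (hSlow : ∀ v, κ * (v ⬝ᵥ v) ≤ v ⬝ᵥ S *ᵥ v) (hSup : ∀ v, v ⬝ᵥ S *ᵥ v ≤ κ⁻¹ * (v ⬝ᵥ v))
    (hlow : ∀ v, n * (v ⬝ᵥ S *ᵥ v) ≤ v ⬝ᵥ Ψ *ᵥ v)
    (hup : ∀ v, v ⬝ᵥ Ψ *ᵥ v ≤ n * (1 + h / 4) * (v ⬝ᵥ S *ᵥ v)) :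
    ∫⁻ A in {A | 8 * h / κ ^ 3 < specNorm (A - S)}, iwKernel (n + ν + 2 * p) Ψ A ∂symLebesgue p ≤
      ENNReal.ofReal (4 * 25 ^ p * Real.exp (-(n * h ^ 2 / 16) + (ν + p))) *
        iwIntegral (n + ν + 2 * p) Ψ := by
  obtain ⟨T, hcard, hT0, hT⟩ := exists_test_vectors p
  have hSpd : S.PosDef := posDef_of_le_quadForm hS hκ hSlow
  have hh1 : h ≤ 1 := by nlinarith
  have hvv : ∀ v : Fin p → ℝ, 0 ≤ v ⬝ᵥ v := fun v => by
    rw [dotProduct_self_eq_norm_sq]; positivity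
  set μ := (symLebesgue p).withDensity (iwKernel (n + ν + 2 * p) Ψ) with hμ
  set b := ENNReal.ofReal (Real.exp (-(n * h ^ 2 / 16) + (ν + p))) *
    iwIntegral (n + ν + 2 * p) Ψ with hb
  let U : (Fin p → ℝ) → Set (Matrix (Fin p) (Fin p) ℝ) := fun u =>
    {A | (1 + h) * (u ⬝ᵥ S⁻¹ *ᵥ u) ≤ u ⬝ᵥ A⁻¹ *ᵥ u} ∪
    {A | u ⬝ᵥ A⁻¹ *ᵥ u ≤ (1 - h) * (u ⬝ᵥ S⁻¹ *ᵥ u)}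
  have hU : ∀ u ∈ T, μ (U u) ≤ 2 * b := by
    intro u hu
    have := setLIntegral_iwKernel_quadForm_le hp hSpd hΨ hn hν hh hh1 hlow hup (hT0 u hu)
    refine (measure_union_le _ _).trans ?_
    rw [hμ, withDensity_apply', withDensity_apply', two_mul b]
    exact add_le_add this.1 this.2
  have hN : μ {A | ¬ A.PosDef} = 0 := by
    rw [hμ, withDensity_apply']
    exact (setLIntegral_congr_fun (g := fun _ => 0) measurableSet_posDef.compl
      (fun A hA => if_neg hA)).trans (by simp)
  have hSinv_low : ∀ v, κ * (v ⬝ᵥ v) ≤ v ⬝ᵥ S⁻¹ *ᵥ v := fun v => by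
    have hκ' : 0 < κ⁻¹ := by positivity
    have h1 := hSpd.inv_quadForm_anti (Matrix.PosDef.one.smul hκ')
      (fun v => by rw [smul_quadForm, Matrix.one_mulVec]; exact hSup v) v
    rw [inv_smul_quadForm Matrix.PosDef.one hκ'] at h1
    simpa using h1
  have hSinv := hSpd.specNorm_inv_le hκ hSlow
  have hSn : specNorm S ≤ κ⁻¹ := by
    refine specNorm_le_of_quadForm hS (by positivity) fun v => ?_
    rw [abs_of_nonneg (hSpd.quadForm_nonneg v)]
    exact hSup v
  have hsub : {A | 8 * h / κ ^ 3 < specNorm (A - S)} ⊆ {A | ¬ A.PosDef} ∪ ⋃ u ∈ T, U u := by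
    -- If all tests pass, then ‖A⁻¹ - S⁻¹‖ ≤ 4h/κ ≤ κ/2, which keeps A⁻¹ above κ/2; inverting back
    -- gives ‖A - S‖ ≤ (2/κ)(4h/κ)(1/κ) = 8h/κ³.
    intro A hA
    by_contra hcon
    simp only [U, Set.mem_union, Set.mem_iUnion, Set.mem_ofPred_eq, not_or, not_not, not_exists,
      not_le] at hcon hA
    obtain ⟨hApd, hAT⟩ := hcon
    have hd : specNorm (A⁻¹ - S⁻¹) ≤ 4 * (h * κ⁻¹) := by
      refine hT _ (hApd.inv.isSymm.sub hSpd.inv.isSymm) _ (by positivity) fun u hu => ?_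
      obtain ⟨h1, h2⟩ := hAT u hu
      have h3 := (abs_le.1 (abs_dotProduct_mulVec_le S⁻¹ u)).2
      have h4 := mul_le_mul_of_nonneg_right hSinv (hvv u)
      have h5 : h * (u ⬝ᵥ S⁻¹ *ᵥ u) ≤ h * (κ⁻¹ * (u ⬝ᵥ u)) := by gcongr; linarith
      rw [Matrix.sub_mulVec, dotProduct_sub, abs_le]
      constructor <;> linarith
    have hd2 : 4 * (h * κ⁻¹) ≤ κ / 2 := by
      have : h * κ⁻¹ ≤ κ ^ 2 / 8 * κ⁻¹ := by gcongr
      have e : κ ^ 2 / 8 * κ⁻¹ = κ / 8 := by field_simp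
      linarith
    have hAinv_low : ∀ v, κ / 2 * (v ⬝ᵥ v) ≤ v ⬝ᵥ A⁻¹ *ᵥ v := fun v => by
      have := quadForm_le_of_sub hSinv_low (hd.trans hd2) v
      linarith
    have hAn := hApd.inv.specNorm_inv_le (by positivity : 0 < κ / 2) hAinv_low
    have hfin := specNorm_inv_sub_inv_le hApd.inv hSpd.inv
    rw [Matrix.nonsing_inv_nonsing_inv _ hApd.isUnit_det] at hfin hAn
    rw [Matrix.nonsing_inv_nonsing_inv _ hSpd.isUnit_det] at hfin
    have : specNorm (A - S) ≤ (κ / 2)⁻¹ * (4 * (h * κ⁻¹)) * κ⁻¹ := by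
      refine hfin.trans ?_
      have := specNorm_nonneg A
      have := specNorm_nonneg S
      have := specNorm_nonneg (A⁻¹ - S⁻¹)
      gcongr
    have e : (κ / 2)⁻¹ * (4 * (h * κ⁻¹)) * κ⁻¹ = 8 * h / κ ^ 3 := by field_simp; ring
    linarith
  rw [← withDensity_apply' (iwKernel (n + ν + 2 * p) Ψ), ← hμ]
  calc μ {A | 8 * h / κ ^ 3 < specNorm (A - S)}
      ≤ μ {A | ¬ A.PosDef} + μ (⋃ u ∈ T, U u) := (measure_mono hsub).trans (measure_union_le _ _)
    _ ≤ 0 + ∑ u ∈ T, μ (U u) := add_le_add hN.le (measure_biUnion_finset_le _ _)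
    _ ≤ T.card • (2 * b) := by rw [zero_add]; exact Finset.sum_le_card_nsmul _ _ _ hU
    _ ≤ ((2 * 25 ^ p : ℕ) : ℝ≥0∞) * (2 * b) := by
        rw [nsmul_eq_mul]; gcongr
    _ = _ := by
        rw [ENNReal.ofReal_mul (by positivity), hb]
        have : ENNReal.ofReal (4 * 25 ^ p) = ((2 * 25 ^ p : ℕ) : ℝ≥0∞) * 2 := by
          rw [← ENNReal.ofReal_natCast, ← ENNReal.ofReal_ofNat, ← ENNReal.ofReal_mul (by positivity)]
          congr 1
          push_cast
          ring
        rw [this]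
        ring

end InverseWishartTails

/-! ### Integrals over one scale parameter and their dependence on the tilt. -/

section MixingDensities

theorem lintegral_two_mul (F : ℝ → ℝ≥0∞) (hF : Measurable F) :
    ∫⁻ t, F t = 2 * ∫⁻ s, F (2 * s) := by
  have h := Real.smul_map_volume_mul_left (two_ne_zero (α := ℝ))
  conv_lhs => rw [← h, lintegral_smul_measure, lintegral_map hF (measurable_const_mul 2)]
  simp

/-- The substitution t = 2s bounds a tail by a full integral whenever doubling the argument shrinks
the integrand. It serves both the mean of a scale and the mass of large scales. -/
theorem setLIntegral_Ioi_le_of_scaling {F : ℝ → ℝ≥0∞} (hF : Measurable F) {τ : ℝ}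
    {G : ℝ → ℝ≥0∞} (h : ∀ s, τ / 2 < s → 2 * F (2 * s) ≤ G s) :
    ∫⁻ t in Set.Ioi τ, F t ≤ ∫⁻ t, G t := by
  rw [← lintegral_indicator measurableSet_Ioi, lintegral_two_mul _ (hF.indicator measurableSet_Ioi),
    ← lintegral_const_mul' _ _ ENNReal.ofNat_ne_top]
  refine lintegral_mono fun s => ?_
  by_cases hs : τ / 2 < s
  · rw [Set.indicator_of_mem (show 2 * s ∈ Set.Ioi τ by rw [Set.mem_Ioi]; linarith)]
    exact h s hs
  · rw [Set.indicator_of_notMem (by rw [Set.mem_Ioi]; linarith)]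
    simp

/-- The integrand of the mixture over one scale parameter. -/
noncomputable def scaleTerm (a c : ℝ) (f : ℝ → ℝ) (x t : ℝ) : ℝ :=
  (c * t) ^ a * Real.exp (-(c * x * t / 2)) * f t

variable {f : ℝ → ℝ} {a c k x : ℝ}

theorem IsPosDensity.integrable (hf : IsPosDensity f) : Integrable f := by
  refine ⟨hf.measurable.aestronglyMeasurable, ?_⟩
  rw [hasFiniteIntegral_iff_ofReal (ae_of_all _ hf.nonneg), hf.mass]
  exact ENNReal.one_lt_top

theorem measurable_scaleTerm (hf : IsPosDensity f) : Measurable (scaleTerm a c f x) := by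
  unfold scaleTerm
  exact (((measurable_const_mul c).pow_const a).mul
    ((((measurable_const_mul (c * x)).div_const 2).neg).exp)).mul hf.measurable

theorem scaleTerm_nonneg (hf : IsPosDensity f) (hc : 0 < c) (t : ℝ) :
    0 ≤ scaleTerm a c f x t := by
  unfold scaleTerm
  by_cases ht : t ≤ 0
  · simp [hf.support t ht]
  · have := hf.nonneg t
    have : 0 < t := not_le.1 ht
    positivity

theorem rpow_mul_exp_neg_le {s : ℝ} (ha : 0 < a) (hx : 0 < x) (hs : 0 ≤ s) :
    s ^ a * Real.exp (-(x * s)) ≤ (a / x) ^ a := by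
  have h1 : s ≤ a / x * Real.exp (x * s / a) := by
    have h2 := Real.add_one_le_exp (x * s / a)
    have h3 : s = a / x * (x * s / a) := by field_simp
    calc s = a / x * (x * s / a) := h3
      _ ≤ _ := by gcongr; linarith
  calc s ^ a * Real.exp (-(x * s)) ≤ (a / x * Real.exp (x * s / a)) ^ a * Real.exp (-(x * s)) := by
        gcongr
    _ = (a / x) ^ a := by
        rw [Real.mul_rpow (by positivity) (by positivity), ← Real.exp_mul, mul_assoc,
          ← Real.exp_add]
        have : x * s / a * a + -(x * s) = 0 := by field_simp; ring
        rw [this, Real.exp_zero, mul_one]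

theorem integrable_scaleTerm (hf : IsPosDensity f) (ha : 0 < a) (hc : 0 < c) (hx : 0 < x) :
    Integrable (scaleTerm a c f x) := by
  refine (hf.integrable.const_mul ((a / (x / 2)) ^ a)).mono'
    (measurable_scaleTerm hf).aestronglyMeasurable (ae_of_all _ fun t => ?_)
  rw [Real.norm_of_nonneg (scaleTerm_nonneg hf hc t)]
  by_cases ht : t ≤ 0
  · simp [scaleTerm, hf.support t ht]
  · refine mul_le_mul_of_nonneg_right ?_ (hf.nonneg t)
    have := rpow_mul_exp_neg_le ha (half_pos hx) (mul_pos hc (not_le.1 ht)).le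
    rwa [show x / 2 * (c * t) = c * x * t / 2 by ring] at this

/-- A factor t only raises the exponent a by one, so integrability of the first moment needs no
separate argument. -/
theorem mul_scaleTerm (hf : IsPosDensity f) (hc : 0 < c) (t : ℝ) :
    t * scaleTerm a c f x t = c⁻¹ * scaleTerm (a + 1) c f x t := by
  by_cases ht : t ≤ 0
  · simp [scaleTerm, hf.support t ht]
  · have ht' : 0 < c * t := mul_pos hc (not_le.1 ht)
    rw [scaleTerm, scaleTerm, Real.rpow_add_one ht'.ne']
    field_simp

theorem integrable_mul_scaleTerm (hf : IsPosDensity f) (ha : 0 < a) (hc : 0 < c) (hx : 0 < x) :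
    Integrable fun t => t * scaleTerm a c f x t := by
  simp_rw [mul_scaleTerm hf hc]
  exact (integrable_scaleTerm hf (by positivity) hc hx).const_mul _

theorem integral_scaleTerm_pos (hf : IsPosDensity f) (ha : 0 < a) (hc : 0 < c) (hx : 0 < x) :
    0 < ∫ t, scaleTerm a c f x t := by
  rw [integral_pos_iff_support_of_nonneg (scaleTerm_nonneg hf hc)
    (integrable_scaleTerm hf ha hc hx)]
  have hsub : Function.support f ⊆ Function.support (scaleTerm a c f x) := by
    intro t ht
    have ht0 : 0 < t := not_le.1 fun h => ht (hf.support t h)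
    have := Real.rpow_pos_of_pos (mul_pos hc ht0) a
    exact mul_ne_zero (mul_pos this (Real.exp_pos _)).ne' ht
  refine lt_of_lt_of_le ?_ (measure_mono hsub)
  rw [← integral_pos_iff_support_of_nonneg hf.nonneg hf.integrable,
    integral_eq_lintegral_of_nonneg_ae (ae_of_all _ hf.nonneg)
      hf.measurable.aestronglyMeasurable, hf.mass]
  simp

/-- The mean of a scale parameter is at most of the order of the exponent. -/
theorem integral_mul_scaleTerm_le (hf : IsPosDensity f) (hk : AntitoneOn f (Set.Ioi k))
    (ha : 0 < a) (hc : 0 < c) (hx : 0 < x) :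
    ∫ t, t * scaleTerm a c f x t ≤
      (2 * |k| + (8 * a + 18) / (c * x)) * ∫ t, scaleTerm a c f x t := by
  set b := c * x / 2 with hb
  have hb0 : 0 < b := by positivity
  -- Below τ the factor t is at most τ. The threshold makes s > τ/2 imply both s > k, where f is
  -- non-increasing, and bs ≥ 2(a + 2), so that exp(-bs/2) beats 2^{a+2}.
  set τ := 2 * |k| + 4 * (a + 2) / b with hτ
  have hτ0 : 0 < τ := by positivity
  have hnn : ∀ t, 0 ≤ t * scaleTerm a c f x t := fun t => by
    by_cases ht : t ≤ 0
    · simp [scaleTerm, hf.support t ht]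
    · exact mul_nonneg (not_le.1 ht).le (scaleTerm_nonneg hf hc t)
  have hK : 2 * |k| + (8 * a + 18) / (c * x) = τ + 1 / b := by
    rw [hτ, hb]; field_simp; ring
  have hm : Measurable fun t => ENNReal.ofReal (t * scaleTerm a c f x t) :=
    (measurable_id.mul (measurable_scaleTerm hf)).ennreal_ofReal
  have htail : ∫⁻ t in Set.Ioi τ, ENNReal.ofReal (t * scaleTerm a c f x t) ≤
      ∫⁻ t, ENNReal.ofReal (1 / b * scaleTerm a c f x t) := by
    refine setLIntegral_Ioi_le_of_scaling hm fun s hs => ?_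
    have hsk : k < s := by
      have := le_abs_self k
      have : 0 < 4 * (a + 2) / b := by positivity
      linarith
    have hs0 : 0 < s := by linarith
    have hcs : 0 < c * s := by positivity
    rw [← ENNReal.ofReal_ofNat, ← ENNReal.ofReal_mul (by positivity)]
    refine ENNReal.ofReal_le_ofReal ?_
    have hff : f (2 * s) ≤ f s := hk hsk (show k < 2 * s by linarith) (by linarith)
    have h1 : scaleTerm a c f x (2 * s) ≤
        2 ^ a * Real.exp (-(b * s)) * scaleTerm a c f x s := by
      have e1 : (c * (2 * s)) ^ a = 2 ^ a * (c * s) ^ a := by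
        rw [← Real.mul_rpow (by positivity) (by positivity)]; ring_nf
      have e2 : Real.exp (-(c * x * (2 * s) / 2)) =
          Real.exp (-(b * s)) * Real.exp (-(c * x * s / 2)) := by
        rw [← Real.exp_add]; congr 1; rw [hb]; ring
      rw [scaleTerm, scaleTerm, e1, e2]
      calc _ ≤ 2 ^ a * (c * s) ^ a * (Real.exp (-(b * s)) * Real.exp (-(c * x * s / 2))) * f s := by
            gcongr
        _ = _ := by ring
    have h2 : s * Real.exp (-(b * s)) ≤ 1 / b * Real.exp (-(b * s / 2)) := by
      have h3 := Real.add_one_le_exp (b * s / 2 - 1)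
      have h4 : Real.exp (b * s / 2 - 1) ≤ Real.exp (b * s / 2) * (1 / 2) := by
        rw [Real.exp_sub, div_eq_mul_inv]
        gcongr
        rw [inv_le_comm₀ (Real.exp_pos _) (by norm_num)]
        linarith [Real.add_one_le_exp (1 : ℝ)]
      have h5 : Real.exp (-(b * s)) = Real.exp (-(b * s / 2)) * Real.exp (-(b * s / 2)) := by
        rw [← Real.exp_add]; congr 1; ring
      have h6 : b * s ≤ Real.exp (b * s / 2) := by linarith
      have h7 : b * s * Real.exp (-(b * s / 2)) ≤ 1 := by
        rw [Real.exp_neg, ← div_eq_mul_inv, div_le_one (Real.exp_pos _)]; exact h6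
      rw [h5]
      calc s * (Real.exp (-(b * s / 2)) * Real.exp (-(b * s / 2)))
          = 1 / b * (b * s * Real.exp (-(b * s / 2))) * Real.exp (-(b * s / 2)) := by
            field_simp
        _ ≤ 1 / b * 1 * Real.exp (-(b * s / 2)) := by gcongr
        _ = _ := by ring
    have h3 : Real.exp (-(b * s / 2)) ≤ 2 ^ (-(a + 2)) := by
      rw [Real.rpow_def_of_pos two_pos, Real.exp_le_exp]
      have h4 : 2 * (a + 2) ≤ b * s := by
        have : 4 * (a + 2) / b ≤ 2 * s := by
          have := abs_nonneg k
          linarith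
        rw [div_le_iff₀ hb0] at this
        linarith
      have h5 : Real.log 2 ≤ 1 := by linarith [Real.log_le_sub_one_of_pos (two_pos (α := ℝ))]
      nlinarith
    have h4 : (2 : ℝ) ^ (-(a + 2)) * 2 ^ a = 1 / 4 := by
      rw [← Real.rpow_add two_pos]
      norm_num [show -(a + 2) + a = -2 by ring, Real.rpow_neg]
    have hst := scaleTerm_nonneg (a := a) (x := x) hf hc s
    calc 2 * (2 * s * scaleTerm a c f x (2 * s))
        ≤ 2 * (2 * s * (2 ^ a * Real.exp (-(b * s)) * scaleTerm a c f x s)) := by gcongr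
      _ = 4 * 2 ^ a * (s * Real.exp (-(b * s))) * scaleTerm a c f x s := by ring
      _ ≤ 4 * 2 ^ a * (1 / b * 2 ^ (-(a + 2))) * scaleTerm a c f x s := by
          refine mul_le_mul_of_nonneg_right (mul_le_mul_of_nonneg_left ?_ (by positivity)) hst
          exact h2.trans (by gcongr)
      _ = 4 * (2 ^ (-(a + 2)) * 2 ^ a) * (1 / b) * scaleTerm a c f x s := by ring
      _ = _ := by rw [h4]; ring
  have hI := integrable_scaleTerm hf ha hc hx
  have hg : 0 ≤ ∫ t, scaleTerm a c f x t := integral_nonneg (scaleTerm_nonneg hf hc)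
  rw [← ENNReal.ofReal_le_ofReal_iff (by positivity), hK,
    ofReal_integral_eq_lintegral_ofReal (integrable_mul_scaleTerm hf ha hc hx) (ae_of_all _ hnn),
    ← integral_const_mul, ofReal_integral_eq_lintegral_ofReal (hI.const_mul _)
      (ae_of_all _ fun t => mul_nonneg (by positivity) (scaleTerm_nonneg hf hc t)),
    ← lintegral_add_compl _ (measurableSet_Iic (a := τ)), Set.compl_Iic]
  calc _ ≤ (∫⁻ t in Set.Iic τ, ENNReal.ofReal (τ * scaleTerm a c f x t)) +
        ∫⁻ t, ENNReal.ofReal (1 / b * scaleTerm a c f x t) := by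
        refine add_le_add (setLIntegral_mono' measurableSet_Iic fun t ht => ?_) htail
        exact ENNReal.ofReal_le_ofReal
          (mul_le_mul_of_nonneg_right ht (scaleTerm_nonneg hf hc t))
    _ ≤ (∫⁻ t, ENNReal.ofReal (τ * scaleTerm a c f x t)) +
        ∫⁻ t, ENNReal.ofReal (1 / b * scaleTerm a c f x t) := by
        gcongr
        exact Measure.restrict_le_self
    _ = _ := by
        rw [← lintegral_add_left ((measurable_scaleTerm hf).const_mul τ).ennreal_ofReal]
        refine lintegral_congr fun t => ?_
        have := scaleTerm_nonneg (a := a) (x := x) hf hc t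
        rw [← ENNReal.ofReal_add (by positivity) (by positivity)]
        congr 1
        ring

/-- Jensen's inequality for the density proportional to `scaleTerm a c f x`: changing x multiplies
the integrand by at least exp(-ht), and the mean of t is at most K. As K depends only on x₀, the
bound may be used with x and x' exchanged. -/
theorem integral_scaleTerm_ge (hf : IsPosDensity f) (hk : AntitoneOn f (Set.Ioi k))
    (ha : 0 < a) (hc : 0 < c) {x₀ x' : ℝ} (hx₀ : 0 < x₀) (hx : x₀ ≤ x) (hx' : x₀ ≤ x') :
    Real.exp (-(c / 2 * |x' - x| * (2 * |k| + (8 * a + 18) / (c * x₀)))) *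
      ∫ t, scaleTerm a c f x t ≤ ∫ t, scaleTerm a c f x' t := by
  have hxp := hx₀.trans_le hx
  have hx'p := hx₀.trans_le hx'
  have hI := integrable_scaleTerm hf ha hc hxp
  have hIt := integrable_mul_scaleTerm hf ha hc hxp
  have hI' := integrable_scaleTerm hf ha hc hx'p
  set K := 2 * |k| + (8 * a + 18) / (c * x₀) with hK
  have hK0 : 0 ≤ K := by positivity
  set g := ∫ t, scaleTerm a c f x t with hg
  have hg0 : 0 ≤ g := integral_nonneg (scaleTerm_nonneg hf hc)
  set h := c / 2 * |x' - x| with hh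
  have hh0 : 0 ≤ h := by positivity
  have hmean : ∫ t, t * scaleTerm a c f x t ≤ K * g := by
    refine (integral_mul_scaleTerm_le hf hk ha hc hxp).trans (mul_le_mul_of_nonneg_right ?_ hg0)
    rw [hK]
    gcongr
  have hpt : ∀ t, Real.exp (-(h * K)) * ((1 + h * K) * scaleTerm a c f x t -
      h * (t * scaleTerm a c f x t)) ≤ scaleTerm a c f x' t := by
    intro t
    by_cases ht : t ≤ 0
    · simp [scaleTerm, hf.support t ht]
    have ht0 : 0 < t := not_le.1 ht
    have hst := scaleTerm_nonneg (a := a) (x := x) hf hc t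
    have e : scaleTerm a c f x' t = Real.exp (-(c / 2 * (x' - x) * t)) * scaleTerm a c f x t := by
      rw [scaleTerm, scaleTerm]
      have : Real.exp (-(c * x' * t / 2)) =
          Real.exp (-(c / 2 * (x' - x) * t)) * Real.exp (-(c * x * t / 2)) := by
        rw [← Real.exp_add]; congr 1; ring
      rw [this]; ring
    have h1 : Real.exp (-(h * t)) ≤ Real.exp (-(c / 2 * (x' - x) * t)) := by
      rw [Real.exp_le_exp, hh]
      have := le_abs_self (x' - x)
      gcongr
    -- Tangent line of the exponential at -hK.
    have h2 : Real.exp (-(h * K)) * (1 + h * K - h * t) ≤ Real.exp (-(h * t)) := by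
      have h3 := Real.add_one_le_exp (h * K - h * t)
      have h4 : Real.exp (-(h * t)) = Real.exp (-(h * K)) * Real.exp (h * K - h * t) := by
        rw [← Real.exp_add]; congr 1; ring
      rw [h4]
      gcongr
      linarith
    rw [e]
    calc _ = Real.exp (-(h * K)) * (1 + h * K - h * t) * scaleTerm a c f x t := by ring
      _ ≤ _ := by gcongr; exact h2.trans h1
  calc Real.exp (-(h * K)) * g
      ≤ Real.exp (-(h * K)) * ((1 + h * K) * g - h * ∫ t, t * scaleTerm a c f x t) := by
        gcongr
        nlinarith
    _ = ∫ t, Real.exp (-(h * K)) * ((1 + h * K) * scaleTerm a c f x t -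
          h * (t * scaleTerm a c f x t)) := by
        rw [integral_const_mul, integral_sub (hI.const_mul _) (hIt.const_mul _),
          integral_const_mul, integral_const_mul]
    _ ≤ _ := integral_mono (((hI.const_mul _).sub (hIt.const_mul _)).const_mul _) hI' hpt

end MixingDensities

/-! ### The prior density in product form and its flatness. -/

section DSIW

variable {p : ℕ} {ν c k : ℝ} {mix : Fin p → ℝ → ℝ}

theorem multiGamma_pos (hν : 0 < ν) : 0 < multiGamma p ((ν + p - 1) / 2) := by
  unfold multiGamma
  refine mul_pos (Real.rpow_pos_of_pos Real.pi_pos _) (Finset.prod_pos fun j _ => ?_)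
  refine Real.Gamma_pos_of_pos ?_
  have : (((j : ℕ) + 1 : ℕ) : ℝ) ≤ p := by exact_mod_cast j.2
  push_cast at this
  linarith

theorem scale_exponent_pos (hp : 1 ≤ p) (hν : 0 < ν) : 0 < (ν + p - 1) / 2 := by
  have : (1 : ℝ) ≤ p := by exact_mod_cast hp
  linarith

/-- The normalizing constant of the inverse Wishart prior. -/
noncomputable def iwConst (p : ℕ) (ν : ℝ) : ℝ :=
  (2 ^ ((ν + p - 1) * p / 2) * multiGamma p ((ν + p - 1) / 2))⁻¹

theorem iwConst_pos (hν : 0 < ν) : 0 < iwConst p ν :=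
  inv_pos.2 (mul_pos (by positivity) (multiGamma_pos hν))

theorem trace_smul_diagonal_mul (c : ℝ) (δ : Fin p → ℝ) (M : Matrix (Fin p) (Fin p) ℝ) :
    ((c • Matrix.diagonal δ) * M).trace = ∑ i, c * (δ i * M i i) := by
  simp [Matrix.trace, Matrix.diagonal_mul]

theorem iwDensity_mul_prod (hc : 0 < c) (hmix : ∀ i, IsPosDensity (mix i))
    {A : Matrix (Fin p) (Fin p) ℝ} (hA : A.PosDef) (δ : Fin p → ℝ) :
    iwDensity (ν + p - 1) (c • Matrix.diagonal δ) A * ∏ i, mix i (δ i) =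
      iwConst p ν * A.det ^ (-(ν + 2 * p) / 2) *
        ∏ i, scaleTerm ((ν + p - 1) / 2) c (mix i) (A⁻¹ i i) (δ i) := by
  by_cases hδ : ∀ i, 0 < δ i
  · have hdet : (c • Matrix.diagonal δ).det ^ ((ν + p - 1) / 2) =
        ∏ i, (c * δ i) ^ ((ν + p - 1) / 2) := by
      rw [Real.finsetProd_rpow _ _ fun i _ => (mul_pos hc (hδ i)).le, Finset.prod_mul_distrib,
        Matrix.det_smul, Matrix.det_diagonal]
      simp
    have htr : Real.exp (-((c • Matrix.diagonal δ) * A⁻¹).trace / 2) =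
        ∏ i, Real.exp (-(c * A⁻¹ i i * δ i / 2)) := by
      rw [trace_smul_diagonal_mul, ← Real.exp_sum, Finset.sum_neg_distrib, neg_div,
        Finset.sum_div]
      congr 2
      exact Finset.sum_congr rfl fun i _ => by ring
    have he : -(ν + p - 1 + p + 1) / 2 = -(ν + 2 * p) / 2 := by ring
    simp only [iwDensity, if_pos hA, hdet, htr, he, scaleTerm, Finset.prod_mul_distrib, iwConst]
    ring
  · push Not at hδ
    obtain ⟨i, hi⟩ := hδ
    rw [Finset.prod_eq_zero (Finset.mem_univ i) ((hmix i).support _ hi),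
      Finset.prod_eq_zero (f := fun i => scaleTerm ((ν + p - 1) / 2) c (mix i) (A⁻¹ i i) (δ i))
        (Finset.mem_univ i) (by simp [scaleTerm, (hmix i).support _ hi])]
    simp

/-- For diagonal Δ both the determinant and the trace split over coordinates, so Fubini reduces the
mixture to p one-dimensional integrals. -/
theorem dsiwDensity_eq (hc : 0 < c) (hmix : ∀ i, IsPosDensity (mix i))
    {A : Matrix (Fin p) (Fin p) ℝ} (hA : A.PosDef) :
    dsiwDensity ν c mix A = iwConst p ν * A.det ^ (-(ν + 2 * p) / 2) *
      ∏ i, ∫ t, scaleTerm ((ν + p - 1) / 2) c (mix i) (A⁻¹ i i) t := by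
  unfold dsiwDensity
  simp_rw [iwDensity_mul_prod hc hmix hA]
  rw [integral_const_mul, integral_fintype_prod_volume_eq_prod
    (f := fun i t => scaleTerm ((ν + p - 1) / 2) c (mix i) (A⁻¹ i i) t)]

theorem dsiwDensity_pos (hp : 1 ≤ p) (hν : 0 < ν) (hc : 0 < c) (hmix : ∀ i, IsPosDensity (mix i))
    {A : Matrix (Fin p) (Fin p) ℝ} (hA : A.PosDef) : 0 < dsiwDensity ν c mix A := by
  rw [dsiwDensity_eq hc hmix hA]
  refine mul_pos (mul_pos (iwConst_pos hν) (Real.rpow_pos_of_pos hA.det_pos _))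
    (Finset.prod_pos fun i _ => ?_)
  exact integral_scaleTerm_pos (hmix i) (scale_exponent_pos hp hν) hc hA.inv.diag_pos

/-- One-sided comparison of the prior density at two nearby matrices. -/
theorem dsiwDensity_ge (hp : 1 ≤ p) (hν : 0 < ν) (hc : 0 < c) (hmix : ∀ i, IsPosDensity (mix i))
    (hk : ∀ i, AntitoneOn (mix i) (Set.Ioi k)) {A B : Matrix (Fin p) (Fin p) ℝ} (hA : A.PosDef)
    (hB : B.PosDef) {x₀ d e : ℝ} (hx₀ : 0 < x₀) (hAx : ∀ i, x₀ ≤ A⁻¹ i i)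
    (hBx : ∀ i, x₀ ≤ B⁻¹ i i) (hd : |Real.log A.det - Real.log B.det| ≤ d)
    (he : ∀ i, |A⁻¹ i i - B⁻¹ i i| ≤ e) :
    Real.exp (-((ν + 2 * p) / 2 * d + p * (c / 2 * e *
      (2 * |k| + (4 * (ν + p - 1) + 18) / (c * x₀))))) * dsiwDensity ν c mix B ≤
      dsiwDensity ν c mix A := by
  have ha := scale_exponent_pos hp hν
  have hp' : (1 : ℝ) ≤ p := by exact_mod_cast hp
  set K := 2 * |k| + (4 * (ν + p - 1) + 18) / (c * x₀) with hK
  have hK' : 2 * |k| + (8 * ((ν + p - 1) / 2) + 18) / (c * x₀) = K := by rw [hK]; ring_nf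
  have hK0 : 0 ≤ K := by rw [← hK']; positivity
  rw [dsiwDensity_eq hc hmix hA, dsiwDensity_eq hc hmix hB]
  have h1 : Real.exp (-((ν + 2 * p) / 2 * d)) * B.det ^ (-(ν + 2 * p) / 2) ≤
      A.det ^ (-(ν + 2 * p) / 2) := by
    rw [Real.rpow_def_of_pos hA.det_pos, Real.rpow_def_of_pos hB.det_pos, ← Real.exp_add,
      Real.exp_le_exp]
    have := (abs_le.1 hd).2
    nlinarith
  have h2 : Real.exp (-(p * (c / 2 * e * K))) *
      ∏ i, ∫ t, scaleTerm ((ν + p - 1) / 2) c (mix i) (B⁻¹ i i) t ≤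
      ∏ i, ∫ t, scaleTerm ((ν + p - 1) / 2) c (mix i) (A⁻¹ i i) t := by
    have e1 : Real.exp (-(p * (c / 2 * e * K))) = ∏ _i : Fin p, Real.exp (-(c / 2 * e * K)) := by
      rw [Finset.prod_const, ← Real.exp_nat_mul]
      simp
    rw [e1, ← Finset.prod_mul_distrib]
    refine Finset.prod_le_prod (fun i _ => mul_nonneg (Real.exp_pos _).le
      (integral_scaleTerm_pos (hmix i) ha hc hB.inv.diag_pos).le) fun i _ => ?_
    refine le_trans ?_ (integral_scaleTerm_ge (hmix i) (hk i) ha hc hx₀ (hBx i) (hAx i))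
    rw [hK']
    refine mul_le_mul_of_nonneg_right ?_
      (integral_scaleTerm_pos (hmix i) ha hc hB.inv.diag_pos).le
    have := he i
    gcongr
  have e2 : Real.exp (-((ν + 2 * p) / 2 * d + p * (c / 2 * e * K))) =
      Real.exp (-((ν + 2 * p) / 2 * d)) * Real.exp (-(p * (c / 2 * e * K))) := by
    rw [← Real.exp_add]; congr 1; ring
  rw [e2]
  have hP : 0 ≤ ∏ i, ∫ t, scaleTerm ((ν + p - 1) / 2) c (mix i) (B⁻¹ i i) t :=
    Finset.prod_nonneg fun i _ => (integral_scaleTerm_pos (hmix i) ha hc hB.inv.diag_pos).le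
  have hC := (iwConst_pos (p := p) hν).le
  have hAd := (Real.rpow_pos_of_pos hA.det_pos (-(ν + 2 * p) / 2)).le
  calc _ = iwConst p ν * ((Real.exp (-((ν + 2 * p) / 2 * d)) * B.det ^ (-(ν + 2 * p) / 2)) *
        (Real.exp (-(p * (c / 2 * e * K))) *
          ∏ i, ∫ t, scaleTerm ((ν + p - 1) / 2) c (mix i) (B⁻¹ i i) t)) := by ring
    _ ≤ iwConst p ν * (A.det ^ (-(ν + 2 * p) / 2) *
        ∏ i, ∫ t, scaleTerm ((ν + p - 1) / 2) c (mix i) (A⁻¹ i i) t) := by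
        refine mul_le_mul_of_nonneg_left (mul_le_mul h1 h2 ?_ hAd) hC
        positivity
    _ = _ := by ring

/-- The ratio lies between e^{-R} and e^R, and 1 - e^{-R} ≤ e^R - 1 because e^R + e^{-R} ≥ 2. -/
theorem abs_div_sub_one_le {x y R : ℝ} (hy : 0 < y) (h1 : Real.exp (-R) * y ≤ x)
    (h2 : Real.exp (-R) * x ≤ y) : |x / y - 1| ≤ Real.exp R - 1 := by
  have h3 : x ≤ Real.exp R * y := by
    rw [Real.exp_neg, inv_mul_le_iff₀ (Real.exp_pos R)] at h2; exact h2
  have h4 : Real.exp (-R) ≤ x / y := (le_div_iff₀ hy).2 h1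
  have h5 : x / y ≤ Real.exp R := (div_le_iff₀ hy).2 h3
  have h6 := Real.add_one_le_exp R
  have h7 := Real.add_one_le_exp (-R)
  have h8 : 2 ≤ Real.exp R + Real.exp (-R) := by linarith
  rw [abs_le]
  constructor <;> linarith

/-- The constant in the flatness bound. -/
noncomputable def flatConst (ν c k κ : ℝ) : ℝ :=
  2 * (ν + 2) / κ + c / κ ^ 2 * (2 * |k| + (8 * ν + 44) / (c * κ))

/-- Two factors p arise twice: the exponent of det times the trace bound on log det, and the number
of coordinates times the O(p) mean of a scale. -/
theorem flatness_dsiw_le {n : ℕ} (hp : 1 ≤ p) (hn : 1 ≤ n) (hν : 0 < ν) (hc : 0 < c)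
    (hmix : ∀ i, IsPosDensity (mix i)) (hk : ∀ i, AntitoneOn (mix i) (Set.Ioi k))
    {S : Matrix (Fin p) (Fin p) ℝ} (hS : S.IsSymm) {κ : ℝ} (hκ : 0 < κ) (hκ1 : κ ≤ 1)
    (hSlow : ∀ v, κ * (v ⬝ᵥ v) ≤ v ⬝ᵥ S *ᵥ v) (hSup : ∀ v, v ⬝ᵥ S *ᵥ v ≤ κ⁻¹ * (v ⬝ᵥ v))
    {ρ : ℝ} (hρ0 : 0 ≤ ρ) (hρ : ρ ≤ κ / 2) :
    flatness n (dsiwDensity ν c mix) S ρ ≤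
      ENNReal.ofReal (Real.exp (flatConst ν c k κ * (p ^ 2 * ρ)) - 1) := by
  have hp' : (1 : ℝ) ≤ p := by exact_mod_cast hp
  have hSpd : S.PosDef := posDef_of_le_quadForm hS hκ hSlow
  refine iSup_le fun T => iSup_le fun ⟨hTs, hApd, hT⟩ => ENNReal.ofReal_le_ofReal ?_
  set A := S + (√(n : ℝ))⁻¹ • T with hA
  have hn0 : 0 < √(n : ℝ) := Real.sqrt_pos.2 (by exact_mod_cast hn)
  have hAS : specNorm (A - S) ≤ ρ := by
    rw [hA, add_sub_cancel_left, specNorm_smul, abs_of_pos (inv_pos.2 hn0)]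
    rwa [inv_mul_le_iff₀ hn0]
  have hAlow : ∀ v, κ / 2 * (v ⬝ᵥ v) ≤ v ⬝ᵥ A *ᵥ v := fun v => by
    have := quadForm_le_of_sub hSlow (hAS.trans hρ) v
    linarith
  have hvv : ∀ v : Fin p → ℝ, 0 ≤ v ⬝ᵥ v := fun v => by
    rw [dotProduct_self_eq_norm_sq]; positivity
  have hκinv : κ ≤ κ⁻¹ := hκ1.trans ((one_le_inv₀ hκ).2 hκ1)
  -- A floor x₀ = κ/2 for the diagonal of both inverses, needed for a mean bound uniform along the
  -- perturbation.
  have hdiag : ∀ {M : Matrix (Fin p) (Fin p) ℝ}, M.PosDef →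
      (∀ v, v ⬝ᵥ M *ᵥ v ≤ 2 * κ⁻¹ * (v ⬝ᵥ v)) → ∀ i, κ / 2 ≤ M⁻¹ i i := by
    intro M hM h i
    refine le_trans ?_ (hM.inv_apply_self_ge i)
    have := h (Pi.single i 1)
    simp only [Matrix.mulVec_single_one, single_one_dotProduct, Matrix.col_apply,
      Pi.single_eq_same, mul_one] at this
    rw [le_inv_comm₀ (by positivity) hM.diag_pos]
    refine this.trans (le_of_eq ?_)
    field_simp
  have hAx := hdiag hApd fun v => by
    have := quadForm_ge_of_sub hSup (hAS.trans hρ) v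
    have := hvv v
    nlinarith
  have hSx := hdiag hSpd fun v => by
    have := hSup v
    have := hvv v
    have : 0 < κ⁻¹ := by positivity
    nlinarith
  have hAinv := hApd.specNorm_inv_le (by positivity) hAlow
  have hSinv := hSpd.specNorm_inv_le hκ hSlow
  have e1 : (κ / 2)⁻¹ = 2 * κ⁻¹ := by field_simp
  rw [e1] at hAinv
  have hκ0 : 0 < κ⁻¹ := by positivity
  have hdet : |Real.log A.det - Real.log S.det| ≤ p * (2 * κ⁻¹ * ρ) := by
    refine (hApd.abs_log_det_sub_le hSpd hAinv (by linarith)).trans ?_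
    gcongr
  have hinv : ∀ i, |A⁻¹ i i - S⁻¹ i i| ≤ 2 * κ⁻¹ * ρ * κ⁻¹ := fun i => by
    have h1 := abs_apply_self_le_specNorm (A⁻¹ - S⁻¹) i
    rw [Matrix.sub_apply] at h1
    refine h1.trans ((specNorm_inv_sub_inv_le hApd hSpd).trans ?_)
    have := specNorm_nonneg A⁻¹
    have := specNorm_nonneg (A - S)
    have := specNorm_nonneg S⁻¹
    gcongr
  have key1 := dsiwDensity_ge hp hν hc hmix hk hApd hSpd (by positivity : 0 < κ / 2) hAx hSx
    hdet hinv
  have key2 := dsiwDensity_ge hp hν hc hmix hk hSpd hApd (by positivity : 0 < κ / 2) hSx hAx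
    (d := p * (2 * κ⁻¹ * ρ)) (by rwa [abs_sub_comm]) (fun i => by rw [abs_sub_comm]; exact hinv i)
  refine (abs_div_sub_one_le (dsiwDensity_pos hp hν hc hmix hSpd) key1 key2).trans ?_
  gcongr
  have hk0 := abs_nonneg k
  have hb : 2 * |k| + (4 * (ν + p - 1) + 18) / (c * (κ / 2)) ≤
      p * (2 * |k| + (8 * ν + 44) / (c * κ)) := by
    have : (4 * (ν + p - 1) + 18) / (c * (κ / 2)) ≤ p * ((8 * ν + 44) / (c * κ)) := by
      have e : (4 * (ν + p - 1) + 18) / (c * (κ / 2)) =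
        (2 * (4 * (ν + p - 1) + 18)) / (c * κ) := by field_simp
      rw [e, ← mul_div_assoc]
      refine div_le_div_of_nonneg_right ?_ (by positivity)
      nlinarith
    nlinarith
  have ha : (ν + 2 * p) / 2 ≤ p * (ν + 2) := by nlinarith
  calc _ ≤ p * (ν + 2) * (p * (2 * κ⁻¹ * ρ)) + p * (c / 2 * (2 * κ⁻¹ * ρ * κ⁻¹) *
        (p * (2 * |k| + (8 * ν + 44) / (c * κ)))) := by
        gcongr
    _ = _ := by
        rw [flatConst]; field_simp

end DSIW

/-! ### The posterior as a mixture of inverse Wishart kernels and its concentration around S. -/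

section Posterior

variable {p : ℕ} {ν c k : ℝ} {mix : Fin p → ℝ → ℝ}

theorem iwIntegral_add_smul_vecMulVec {m s : ℝ} {Ψ : Matrix (Fin p) (Fin p) ℝ} {u : Fin p → ℝ}
    (hΨ : Ψ.PosDef) (hs : 0 ≤ s) :
    iwIntegral m (Ψ + s • Matrix.vecMulVec u u) =
      ENNReal.ofReal ((1 + s * (u ⬝ᵥ Ψ⁻¹ *ᵥ u)) ^ (-(m - p - 1) / 2)) * iwIntegral m Ψ := by
  have hpos : 0 ≤ 1 + s * (u ⬝ᵥ Ψ⁻¹ *ᵥ u) := by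
    have := hΨ.inv.quadForm_nonneg u
    positivity
  rw [iwIntegral_eq (hΨ.add_smul_vecMulVec hs u), iwIntegral_eq hΨ, ← mul_assoc,
    ← ENNReal.ofReal_mul (by positivity), hΨ.det_add_smul_vecMulVec,
    Real.mul_rpow hΨ.det_pos.le hpos, mul_comm (Ψ.det ^ _)]

/-- The scale matrix of the inverse Wishart posterior given the scale parameters. -/
noncomputable def postScale (n : ℕ) (c : ℝ) (S : Matrix (Fin p) (Fin p) ℝ) (δ : Fin p → ℝ) :
    Matrix (Fin p) (Fin p) ℝ := (n : ℝ) • S + c • Matrix.diagonal δ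

/-- The weight of the scale parameters. -/
noncomputable def scaleWeight (a c : ℝ) (mix : Fin p → ℝ → ℝ) (δ : Fin p → ℝ) : ℝ≥0∞ :=
  ∏ i, ENNReal.ofReal ((c * δ i) ^ a * mix i (δ i))

theorem quadForm_diagonal (δ v : Fin p → ℝ) :
    v ⬝ᵥ Matrix.diagonal δ *ᵥ v = ∑ i, δ i * v i ^ 2 := by
  simp only [dotProduct, Matrix.mulVec_diagonal]
  exact Finset.sum_congr rfl fun i _ => by ring

theorem quadForm_postScale (n : ℕ) (c : ℝ) (S : Matrix (Fin p) (Fin p) ℝ) (δ v : Fin p → ℝ) :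
    v ⬝ᵥ postScale n c S δ *ᵥ v = n * (v ⬝ᵥ S *ᵥ v) + c * ∑ i, δ i * v i ^ 2 := by
  rw [postScale, Matrix.add_mulVec, dotProduct_add, smul_quadForm, smul_quadForm,
    quadForm_diagonal]

theorem posDef_postScale {n : ℕ} (hn : 1 ≤ n) (hc : 0 < c) {S : Matrix (Fin p) (Fin p) ℝ}
    (hS : S.PosDef) {δ : Fin p → ℝ} (hδ : ∀ i, 0 ≤ δ i) : (postScale n c S δ).PosDef := by
  have hn' : (0 : ℝ) < n := by exact_mod_cast hn
  refine posDef_iff_real.2 ⟨?_, fun v hv => ?_⟩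
  · exact (hS.isSymm.smul _).add ((Matrix.isSymm_diagonal δ).smul _)
  · rw [quadForm_postScale]
    have h1 := hS.quadForm_pos hv
    have h2 : 0 ≤ ∑ i, δ i * v i ^ 2 :=
      Finset.sum_nonneg fun i _ => mul_nonneg (hδ i) (sq_nonneg _)
    positivity

theorem measurable_postScale (n : ℕ) (c : ℝ) (S : Matrix (Fin p) (Fin p) ℝ) :
    Measurable (postScale n c S) := by
  unfold postScale
  apply Continuous.measurable
  fun_prop

theorem measurable_scaleWeight (a c : ℝ) (hmix : ∀ i, IsPosDensity (mix i)) :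
    Measurable (scaleWeight a c mix) := by
  unfold scaleWeight
  refine Finset.measurable_prod _ fun i _ => ?_
  have h0 : Measurable fun δ : Fin p → ℝ => c * δ i := by fun_prop
  have h : Measurable fun δ : Fin p → ℝ => (c * δ i) ^ a := h0.pow_const a
  exact (h.mul ((hmix i).measurable.comp (measurable_pi_apply i))).ennreal_ofReal

theorem scaleWeight_eq_zero (a c : ℝ) (hmix : ∀ i, IsPosDensity (mix i)) {δ : Fin p → ℝ} {i : Fin p}
    (hi : δ i ≤ 0) : scaleWeight a c mix δ = 0 :=
  Finset.prod_eq_zero (Finset.mem_univ i) (by simp [(hmix i).support _ hi])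

/-- The constant in front of the mixture representation. -/
noncomputable def postConst (n p : ℕ) (ν : ℝ) : ℝ :=
  Real.exp (-(n * p / 2 : ℝ) * Real.log (2 * Real.pi)) * iwConst p ν

/-- Conjugacy: the exponents of likelihood and conditional prior are both linear in A⁻¹ and merge
into one kernel. Off the cone both sides vanish. -/
theorem exp_logLik_mul_dsiwDensity (n : ℕ) (hp : 1 ≤ p) (hν : 0 < ν) (hc : 0 < c)
    (hmix : ∀ i, IsPosDensity (mix i)) (S A : Matrix (Fin p) (Fin p) ℝ) :
    ENNReal.ofReal (Real.exp (logLik n S A) * dsiwDensity ν c mix A) =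
      ENNReal.ofReal (postConst n p ν) * ∫⁻ δ, scaleWeight ((ν + p - 1) / 2) c mix δ *
        iwKernel (n + ν + 2 * p) (postScale n c S δ) A := by
  by_cases hA : A.PosDef
  swap
  · simp [dsiwDensity, iwDensity, iwKernel, hA]
  have ha := scale_exponent_pos hp hν
  set a := (ν + p - 1) / 2 with ha_def
  have hint : Integrable fun δ : Fin p → ℝ => iwConst p ν * A.det ^ (-(ν + 2 * p) / 2) *
      ∏ i, scaleTerm a c (mix i) (A⁻¹ i i) (δ i) :=
    (Integrable.fintype_prod fun i =>
      integrable_scaleTerm (hmix i) ha hc hA.inv.diag_pos).const_mul _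
  have hC := iwConst_pos (p := p) hν
  have hd := hA.det_pos
  have hpc : 0 ≤ postConst n p ν := by unfold postConst; positivity
  have hnn : ∀ δ : Fin p → ℝ, 0 ≤ iwConst p ν * A.det ^ (-(ν + 2 * p) / 2) *
      ∏ i, scaleTerm a c (mix i) (A⁻¹ i i) (δ i) := fun δ => by
    have := Finset.prod_nonneg fun i (_ : i ∈ Finset.univ) =>
      scaleTerm_nonneg (a := a) (x := A⁻¹ i i) (hmix i) hc (δ i)
    positivity
  unfold dsiwDensity
  simp_rw [iwDensity_mul_prod hc hmix hA]
  rw [← integral_const_mul, ofReal_integral_eq_lintegral_ofReal (hint.const_mul _)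
    (ae_of_all _ fun δ => mul_nonneg (Real.exp_pos _).le (hnn δ)),
    ← lintegral_const_mul' _ _ ENNReal.ofReal_ne_top]
  refine lintegral_congr fun δ => ?_
  by_cases hδ : ∀ i, 0 < δ i
  swap
  · push Not at hδ
    obtain ⟨i, hi⟩ := hδ
    rw [scaleWeight_eq_zero a c hmix hi, Finset.prod_eq_zero (Finset.mem_univ i)
      (by simp [scaleTerm, (hmix i).support _ hi])]
    simp
  have hw : ∀ i, 0 ≤ (c * δ i) ^ a * mix i (δ i) := fun i => by
    have := hδ i
    have := (hmix i).nonneg (δ i)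
    positivity
  have hP := Finset.prod_nonneg fun i (_ : i ∈ Finset.univ) => hw i
  rw [scaleWeight, ← ENNReal.ofReal_prod_of_nonneg fun i _ => hw i, iwKernel, if_pos hA,
    ← ENNReal.ofReal_mul hP, ← ENNReal.ofReal_mul hpc]
  congr 1
  have e1 : (A⁻¹ * postScale n c S δ).trace =
      n * (A⁻¹ * S).trace + ∑ i, c * (δ i * A⁻¹ i i) := by
    rw [postScale, Matrix.mul_add, Matrix.trace_add, Matrix.trace_mul_comm A⁻¹ (c • _),
      trace_smul_diagonal_mul, Matrix.mul_smul, Matrix.trace_smul, smul_eq_mul]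
  have e2 : ∏ i, scaleTerm a c (mix i) (A⁻¹ i i) (δ i) =
      (∏ i, (c * δ i) ^ a * mix i (δ i)) *
        Real.exp (-(∑ i, c * (δ i * A⁻¹ i i)) / 2) := by
    rw [neg_div, Finset.sum_div, ← Finset.sum_neg_distrib, Real.exp_sum, ← Finset.prod_mul_distrib]
    refine Finset.prod_congr rfl fun i _ => ?_
    rw [scaleTerm, show -(c * (δ i * A⁻¹ i i) / 2) = -(c * A⁻¹ i i * δ i / 2) by ring]
    ring
  have e3 : Real.exp (logLik n S A) = Real.exp (-(n * p / 2 : ℝ) * Real.log (2 * Real.pi)) *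
      A.det ^ (-(n : ℝ) / 2) * Real.exp (-(n * (A⁻¹ * S).trace) / 2) := by
    rw [logLik, Real.rpow_def_of_pos hd, ← Real.exp_add, ← Real.exp_add]
    congr 1
    ring
  have e4 : A.det ^ (-(n + ν + 2 * p : ℝ) / 2) =
      A.det ^ (-(n : ℝ) / 2) * A.det ^ (-(ν + 2 * p) / 2) := by
    rw [← Real.rpow_add hd]; congr 1; ring
  have e5 : Real.exp (-(n * (A⁻¹ * S).trace + ∑ i, c * (δ i * A⁻¹ i i)) / 2) =
      Real.exp (-(n * (A⁻¹ * S).trace) / 2) * Real.exp (-(∑ i, c * (δ i * A⁻¹ i i)) / 2) := by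
    rw [← Real.exp_add]; congr 1; ring
  rw [e1, e2, e3, e4, e5, postConst]
  ring

/-- The posterior mass of a set as a mixture of inverse Wishart integrals. -/
theorem unnormPosterior_eq (n : ℕ) (hp : 1 ≤ p) (hν : 0 < ν) (hc : 0 < c)
    (hmix : ∀ i, IsPosDensity (mix i)) (S : Matrix (Fin p) (Fin p) ℝ)
    (E : Set (Matrix (Fin p) (Fin p) ℝ)) :
    unnormPosterior n (dsiwDensity ν c mix) S E =
      ENNReal.ofReal (postConst n p ν) * ∫⁻ δ, scaleWeight ((ν + p - 1) / 2) c mix δ *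
        ∫⁻ A in E, iwKernel (n + ν + 2 * p) (postScale n c S δ) A ∂symLebesgue p := by
  have hm : Measurable fun q : Matrix (Fin p) (Fin p) ℝ × (Fin p → ℝ) =>
      iwKernel (n + ν + 2 * p) (postScale n c S q.2) q.1 :=
    measurable_iwKernel _ ((measurable_postScale n c S).comp measurable_snd) measurable_fst
  rw [unnormPosterior, withDensity_apply']
  simp_rw [exp_logLik_mul_dsiwDensity n hp hν hc hmix]
  rw [lintegral_const_mul' _ _ ENNReal.ofReal_ne_top, lintegral_lintegral_swap]
  · congr 1
    refine lintegral_congr fun δ => ?_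
    rw [lintegral_const_mul]
    exact measurable_iwKernel _ measurable_const measurable_id
  · exact (((measurable_scaleWeight _ c hmix).comp measurable_snd).mul hm).aemeasurable

theorem measurable_iwIntegral_postScale (n : ℕ) (c m : ℝ) (S : Matrix (Fin p) (Fin p) ℝ) :
    Measurable fun δ => iwIntegral m (postScale n c S δ) := by
  unfold iwIntegral
  exact Measurable.lintegral_prod_right' (f := fun q : (Fin p → ℝ) × Matrix (Fin p) (Fin p) ℝ =>
    iwKernel m (postScale n c S q.1) q.2)
    (measurable_iwKernel _ ((measurable_postScale n c S).comp measurable_fst) measurable_snd)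

/-- Doubling one scale is a rank-one update of the scale matrix, so the determinant ratio is
explicit. -/
theorem postScale_update_two_mul (n : ℕ) (c : ℝ) (S : Matrix (Fin p) (Fin p) ℝ) (δ : Fin p → ℝ)
    (i : Fin p) (s : ℝ) : postScale n c S (Function.update δ i (2 * s)) =
      postScale n c S (Function.update δ i s) +
        (c * s) • Matrix.vecMulVec (Pi.single i 1) (Pi.single i 1) := by
  ext j l
  simp only [postScale, Matrix.add_apply, Matrix.smul_apply, smul_eq_mul, Matrix.vecMulVec_apply,
    add_assoc, Matrix.diagonal_apply]
  congr 1
  by_cases hj : j = i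
  · subst hj
    by_cases hl : j = l
    · subst hl; simp; ring
    · simp [hl, Ne.symm hl]
  · by_cases hl : j = l
    · subst hl; simp [hj]
    · simp [hj, hl]

/-- Large values of one scale parameter have small posterior mass. -/
theorem setLIntegral_scaleWeight_le {n : ℕ} (hp : 1 ≤ p) (hn : 1 ≤ n) (hν : 0 < ν) (hc : 0 < c)
    (hmix : ∀ i, IsPosDensity (mix i)) (hk : ∀ i, AntitoneOn (mix i) (Set.Ioi k))
    {S : Matrix (Fin p) (Fin p) ℝ} (hS : S.IsSymm) {κ : ℝ} (hκ : 0 < κ) (hκ1 : κ ≤ 1)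
    (hSlow : ∀ v, κ * (v ⬝ᵥ v) ≤ v ⬝ᵥ S *ᵥ v) (hSup : ∀ v, v ⬝ᵥ S *ᵥ v ≤ κ⁻¹ * (v ⬝ᵥ v))
    {h : ℝ} (hh : 0 < h) (hh1 : h ≤ 1) (hkh : k ≤ κ * n * h / (8 * c)) (i : Fin p) :
    ∫⁻ δ in {δ : Fin p → ℝ | κ * n * h / (4 * c) < δ i}, scaleWeight ((ν + p - 1) / 2) c mix δ *
        iwIntegral (n + ν + 2 * p) (postScale n c S δ) ≤
      ENNReal.ofReal (2 ^ ((ν + p + 1) / 2) * Real.exp (-(n * κ ^ 2 * h / 64))) *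
        ∫⁻ δ, scaleWeight ((ν + p - 1) / 2) c mix δ *
          iwIntegral (n + ν + 2 * p) (postScale n c S δ) := by
  have hp' : (1 : ℝ) ≤ p := by exact_mod_cast hp
  have hn' : (1 : ℝ) ≤ n := by exact_mod_cast hn
  have hSpd : S.PosDef := posDef_of_le_quadForm hS hκ hSlow
  set a := (ν + p - 1) / 2 with ha
  set τ := κ * n * h / (4 * c) with hτ
  have hτ0 : 0 < τ := by positivity
  have hkτ : k ≤ τ / 2 := by rw [hτ]; refine hkh.trans (le_of_eq ?_); field_simp; norm_num
  set C := ENNReal.ofReal (2 ^ ((ν + p + 1) / 2) * Real.exp (-(n * κ ^ 2 * h / 64))) with hC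
  set Φ : (Fin p → ℝ) → ℝ≥0∞ := fun δ => scaleWeight a c mix δ *
    iwIntegral (n + ν + 2 * p) (postScale n c S δ) with hΦ
  have hΦm : Measurable Φ :=
    (measurable_scaleWeight a c hmix).mul (measurable_iwIntegral_postScale n c _ S)
  have hE : MeasurableSet {δ : Fin p → ℝ | τ < δ i} :=
    measurableSet_lt measurable_const (measurable_pi_apply i)
  rw [← lintegral_indicator hE, ← lintegral_const_mul _ hΦm, volume_pi]
  -- It suffices to compare the integrals over the i-th scale with all the others fixed.
  refine lintegral_le_of_lmarginal_le {i} (hΦm.indicator hE) (hΦm.const_mul C) ?_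
  rw [lmarginal_singleton, lmarginal_singleton]
  intro δ
  have hupd : Measurable fun t => Φ (Function.update δ i t) := hΦm.comp (measurable_update δ)
  have hind : ∀ t, Set.indicator {δ : Fin p → ℝ | τ < δ i} Φ (Function.update δ i t) =
      Set.indicator (Set.Ioi τ) (fun t => Φ (Function.update δ i t)) t := fun t => by
    by_cases ht : τ < t
    · rw [Set.indicator_of_mem (by simpa using ht), Set.indicator_of_mem (by simpa using ht)]
    · rw [Set.indicator_of_notMem (by simpa using ht), Set.indicator_of_notMem (by simpa using ht)]
  refine (lintegral_congr hind).trans_le ?_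
  rw [lintegral_indicator measurableSet_Ioi]
  refine setLIntegral_Ioi_le_of_scaling hupd fun s hs => ?_
  have hs0 : 0 < s := by linarith
  by_cases hδ : ∀ j, j ≠ i → 0 < δ j
  swap
  · push Not at hδ
    obtain ⟨j, hji, hj⟩ := hδ
    simp only [hΦ]
    rw [scaleWeight_eq_zero a c hmix (i := j) (by rwa [Function.update_of_ne hji])]
    simp
  have hδs : ∀ j, 0 ≤ Function.update δ i s j := fun j => by
    by_cases hji : j = i
    · subst hji; simpa using hs0.le
    · rw [Function.update_of_ne hji]; exact (hδ j hji).le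
  have hΨ := posDef_postScale hn hc hSpd hδs
  set Ψ := postScale n c S (Function.update δ i s) with hΨ_def
  have hcs : 0 < c * s := by positivity
  -- the weight
  have hW : scaleWeight a c mix (Function.update δ i (2 * s)) ≤
      ENNReal.ofReal (2 ^ a) * scaleWeight a c mix (Function.update δ i s) := by
    unfold scaleWeight
    rw [← Finset.mul_prod_erase _ _ (Finset.mem_univ i),
      ← Finset.mul_prod_erase _ _ (Finset.mem_univ i), ← mul_assoc]
    refine mul_le_mul' ?_ (le_of_eq (Finset.prod_congr rfl fun j hj => ?_))
    · rw [Function.update_self, Function.update_self, ← ENNReal.ofReal_mul (by positivity)]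
      refine ENNReal.ofReal_le_ofReal ?_
      have hff : mix i (2 * s) ≤ mix i s :=
        hk i (show k < s by linarith) (show k < 2 * s by linarith) (by linarith)
      have e1 : (c * (2 * s)) ^ a = 2 ^ a * (c * s) ^ a := by
        rw [← Real.mul_rpow (by positivity) (by positivity)]; ring_nf
      rw [e1, mul_assoc]
      gcongr
    · rw [Function.update_of_ne (Finset.ne_of_mem_erase hj),
        Function.update_of_ne (Finset.ne_of_mem_erase hj)]
  -- the determinant
  set y := κ ^ 2 * h / 16 with hy
  have hy0 : 0 ≤ y := by positivity
  have hκ2 : κ ^ 2 ≤ 1 := pow_le_one₀ hκ.le hκ1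
  have hy1 : y ≤ 1 / 2 := by
    have : κ ^ 2 * h ≤ 1 := mul_le_one₀ hκ2 hh.le hh1
    rw [hy]; linarith
  have hdiag : Ψ i i ≤ n * κ⁻¹ + c * s := by
    have h1 := hSup (Pi.single i 1)
    simp only [Matrix.mulVec_single_one, single_one_dotProduct, Matrix.col_apply,
      Pi.single_eq_same, mul_one] at h1
    simp only [hΨ_def, postScale, Matrix.add_apply, Matrix.smul_apply, smul_eq_mul,
      Matrix.diagonal_apply_eq, Function.update_self]
    gcongr
  -- Here cs ≥ κnh/8 and Ψᵢᵢ ≤ n/κ + cs. The choice y = κ²h/16 makes y·n/κ at most cs/2, and y ≤ 1/2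
  -- handles the rest.
  have hq : y ≤ c * s * (Pi.single i 1 ⬝ᵥ Ψ⁻¹ *ᵥ Pi.single i 1) := by
    simp only [Matrix.mulVec_single_one, single_one_dotProduct, Matrix.col_apply]
    have h1 := hΨ.inv_apply_self_ge i
    have h2 : (n * κ⁻¹ + c * s)⁻¹ ≤ (Ψ i i)⁻¹ := inv_anti₀ hΨ.diag_pos hdiag
    have h3 : y * (n * κ⁻¹ + c * s) ≤ c * s := by
      have h4 : κ * n * h / 8 ≤ c * s := by
        have : c * (τ / 2) = κ * n * h / 8 := by rw [hτ]; field_simp; norm_num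
        rw [← this]; gcongr
      have h5 : y * (n * κ⁻¹) = κ * n * h / 16 := by rw [hy]; field_simp
      nlinarith
    calc y ≤ c * s * (n * κ⁻¹ + c * s)⁻¹ := by
          rw [← div_eq_mul_inv, le_div_iff₀ (by positivity)]; exact h3
      _ ≤ _ := by gcongr; exact h2.trans h1
  have hr : -((n : ℝ) + ν + 2 * p - p - 1) / 2 = -((n + ν + p - 1) / 2) := by ring
  have hdet : iwIntegral (n + ν + 2 * p) (postScale n c S (Function.update δ i (2 * s))) ≤
      ENNReal.ofReal (Real.exp (-(n * κ ^ 2 * h / 64))) * iwIntegral (n + ν + 2 * p) Ψ := by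
    rw [postScale_update_two_mul, ← hΨ_def, iwIntegral_add_smul_vecMulVec hΨ hcs.le, hr]
    gcongr
    calc _ ≤ (1 + y) ^ (-((n + ν + p - 1) / 2)) :=
          Real.rpow_le_rpow_of_nonpos (by linarith) (by linarith) (by linarith)
      _ ≤ Real.exp (-((n + ν + p - 1) / 2 * (y - y ^ 2))) :=
          one_add_rpow_neg_le hy0 (by linarith)
      _ ≤ _ := by
          rw [Real.exp_le_exp]
          have h1 : y / 2 ≤ y - y ^ 2 := by nlinarith
          have h2 : n / 2 * (y / 2) ≤ (n + ν + p - 1) / 2 * (y - y ^ 2) :=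
            mul_le_mul (by linarith) h1 (by positivity) (by linarith)
          have h3 : n / 2 * (y / 2) = n * κ ^ 2 * h / 64 := by rw [hy]; ring
          linarith
  have h2a : 2 * ENNReal.ofReal (2 ^ a) = ENNReal.ofReal (2 ^ ((ν + p + 1) / 2)) := by
    rw [← ENNReal.ofReal_ofNat, ← ENNReal.ofReal_mul (by positivity)]
    congr 1
    rw [show (ν + p + 1) / 2 = a + 1 by rw [ha]; ring, Real.rpow_add_one two_ne_zero, mul_comm]
  calc 2 * Φ (Function.update δ i (2 * s))
      ≤ 2 * ((ENNReal.ofReal (2 ^ a) * scaleWeight a c mix (Function.update δ i s)) *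
          (ENNReal.ofReal (Real.exp (-(n * κ ^ 2 * h / 64))) * iwIntegral (n + ν + 2 * p) Ψ)) := by
        gcongr
        exact mul_le_mul' hW hdet
    _ = (2 * ENNReal.ofReal (2 ^ a)) * ENNReal.ofReal (Real.exp (-(n * κ ^ 2 * h / 64))) *
          (scaleWeight a c mix (Function.update δ i s) * iwIntegral (n + ν + 2 * p) Ψ) := by ring
    _ = _ := by rw [h2a, hC, ENNReal.ofReal_mul (by positivity)]

/-- Posterior concentration around the sample covariance matrix. -/
theorem posterior_specNorm_le {n : ℕ} (hp : 1 ≤ p) (hn : 1 ≤ n) (hν : 0 < ν) (hc : 0 < c)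
    (hmix : ∀ i, IsPosDensity (mix i)) (hk : ∀ i, AntitoneOn (mix i) (Set.Ioi k))
    {S : Matrix (Fin p) (Fin p) ℝ} (hS : S.IsSymm) {κ : ℝ} (hκ : 0 < κ) (hκ1 : κ ≤ 1)
    (hSlow : ∀ v, κ * (v ⬝ᵥ v) ≤ v ⬝ᵥ S *ᵥ v) (hSup : ∀ v, v ⬝ᵥ S *ᵥ v ≤ κ⁻¹ * (v ⬝ᵥ v))
    {h : ℝ} (hh : 0 < h) (hhκ : h ≤ κ ^ 2 / 8) (hkh : k ≤ κ * n * h / (8 * c)) :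
    _root_.posterior n (dsiwDensity ν c mix) S {A | 8 * h / κ ^ 3 < specNorm (A - S)} ≤
      ENNReal.ofReal (p * (2 ^ ((ν + p + 1) / 2) * Real.exp (-(n * κ ^ 2 * h / 64))) +
        4 * 25 ^ p * Real.exp (-(n * h ^ 2 / 16) + (ν + p))) := by
  have hn' : (0 : ℝ) < n := by exact_mod_cast hn
  have hh1 : h ≤ 1 := by nlinarith [pow_le_one₀ hκ.le hκ1 (n := 2)]
  have hSpd : S.PosDef := posDef_of_le_quadForm hS hκ hSlow
  set τ := κ * n * h / (4 * c) with hτ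
  set a := (ν + p - 1) / 2 with ha
  set E := {A : Matrix (Fin p) (Fin p) ℝ | 8 * h / κ ^ 3 < specNorm (A - S)} with hE
  set b₁ := 2 ^ ((ν + p + 1) / 2) * Real.exp (-(n * κ ^ 2 * h / 64)) with hb₁
  set b₂ := 4 * 25 ^ p * Real.exp (-(n * h ^ 2 / 16) + (ν + p)) with hb₂
  set Φ : (Fin p → ℝ) → ℝ≥0∞ := fun δ => scaleWeight a c mix δ *
    iwIntegral (n + ν + 2 * p) (postScale n c S δ) with hΦ
  have hΦm : Measurable Φ :=
    (measurable_scaleWeight a c hmix).mul (measurable_iwIntegral_postScale n c _ S)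
  have hEi : ∀ i : Fin p, MeasurableSet {δ : Fin p → ℝ | τ < δ i} := fun i =>
    measurableSet_lt measurable_const (measurable_pi_apply i)
  have hpt : ∀ δ, scaleWeight a c mix δ *
      ∫⁻ A in E, iwKernel (n + ν + 2 * p) (postScale n c S δ) A ∂symLebesgue p ≤
      (∑ i, Set.indicator {δ : Fin p → ℝ | τ < δ i} Φ δ) + ENNReal.ofReal b₂ * Φ δ := by
    intro δ
    by_cases hδ : ∀ i, 0 < δ i
    swap
    · push Not at hδ
      obtain ⟨i, hi⟩ := hδ
      rw [scaleWeight_eq_zero a c hmix hi]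
      simp
    -- If all scales are at most τ, then cΔ ≤ (nh/4)κ·I ≤ (nh/4)S, the closeness of Ψ to nS required
    -- for concentration. Otherwise the event of one large scale takes the whole mass.
    by_cases hδτ : ∀ i, δ i ≤ τ
    · refine le_add_left ?_
      have hΨ := posDef_postScale hn hc hSpd fun i => (hδ i).le
      have h1 := setLIntegral_iwKernel_specNorm_le hp hΨ hn' hν hh hκ hκ1 hhκ hS hSlow hSup
        (fun v => by
          rw [quadForm_postScale]
          have : 0 ≤ ∑ i, δ i * v i ^ 2 :=
            Finset.sum_nonneg fun i _ => mul_nonneg (hδ i).le (sq_nonneg _)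
          have := mul_nonneg hc.le this
          linarith)
        (fun v => by
          rw [quadForm_postScale]
          have h2 : ∑ i, δ i * v i ^ 2 ≤ τ * (v ⬝ᵥ v) := by
            rw [dotProduct, Finset.mul_sum]
            refine Finset.sum_le_sum fun i _ => ?_
            have := mul_le_mul_of_nonneg_right (hδτ i) (sq_nonneg (v i))
            nlinarith
          have h3 : c * (∑ i, δ i * v i ^ 2) ≤ c * (τ * (v ⬝ᵥ v)) := by gcongr
          have h4 : c * (τ * (v ⬝ᵥ v)) = n * h / 4 * (κ * (v ⬝ᵥ v)) := by
            rw [hτ]; field_simp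
          have h5 : n * h / 4 * (κ * (v ⬝ᵥ v)) ≤ n * h / 4 * (v ⬝ᵥ S *ᵥ v) := by
            gcongr; exact hSlow v
          linarith)
      calc _ ≤ scaleWeight a c mix δ * (ENNReal.ofReal b₂ *
            iwIntegral (n + ν + 2 * p) (postScale n c S δ)) := by gcongr
        _ = _ := by rw [hΦ]; ring
    · push Not at hδτ
      obtain ⟨i, hi⟩ := hδτ
      refine le_add_right ?_
      refine le_trans ?_ (Finset.single_le_sum (f := fun i =>
        Set.indicator {δ : Fin p → ℝ | τ < δ i} Φ δ) (fun _ _ => zero_le) (Finset.mem_univ i))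
      simp only [Set.indicator_of_mem (show δ ∈ {δ : Fin p → ℝ | τ < δ i} from hi), hΦ]
      gcongr
      exact setLIntegral_le_lintegral _ _
  have hint : ∫⁻ δ, scaleWeight a c mix δ *
      ∫⁻ A in E, iwKernel (n + ν + 2 * p) (postScale n c S δ) A ∂symLebesgue p ≤
      ENNReal.ofReal (p * b₁ + b₂) * ∫⁻ δ, Φ δ := by
    refine (lintegral_mono hpt).trans ?_
    rw [lintegral_add_left (Finset.measurable_sum _ fun i _ => hΦm.indicator (hEi i)),
      lintegral_finsetSum _ fun i _ => hΦm.indicator (hEi i), lintegral_const_mul _ hΦm,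
      ENNReal.ofReal_add (by positivity) (by positivity), add_mul]
    gcongr
    calc _ ≤ ∑ _i : Fin p, ENNReal.ofReal b₁ * ∫⁻ δ, Φ δ := by
          refine Finset.sum_le_sum fun i _ => ?_
          rw [lintegral_indicator (hEi i)]
          exact setLIntegral_scaleWeight_le hp hn hν hc hmix hk hS hκ hκ1 hSlow hSup hh hh1 hkh i
      _ = _ := by
          rw [Finset.sum_const, Finset.card_univ, Fintype.card_fin, nsmul_eq_mul,
            ENNReal.ofReal_mul (p := (p : ℝ)) (q := b₁) (by positivity), ENNReal.ofReal_natCast,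
            mul_assoc]
  have hle : unnormPosterior n (dsiwDensity ν c mix) S E ≤
      ENNReal.ofReal (p * b₁ + b₂) * unnormPosterior n (dsiwDensity ν c mix) S Set.univ := by
    rw [unnormPosterior_eq n hp hν hc hmix, unnormPosterior_eq n hp hν hc hmix]
    simp only [Measure.restrict_univ]
    rw [mul_left_comm]
    gcongr
    exact hint
  rw [_root_.posterior, Measure.smul_apply, smul_eq_mul]
  set Z := unnormPosterior n (dsiwDensity ν c mix) S Set.univ with hZ
  -- A normaliser equal to ⊤ has inverse 0. If it is 0, its inverse is ⊤, but the mass of E also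
  -- vanishes and ⊤ * 0 = 0.
  by_cases hZtop : Z = ⊤
  · simp [hZtop]
  by_cases hZ0 : Z = 0
  · rw [hZ0, mul_zero] at hle
    rw [nonpos_iff_eq_zero.1 hle, mul_zero]
    exact zero_le
  calc Z⁻¹ * unnormPosterior n (dsiwDensity ν c mix) S E
      ≤ Z⁻¹ * (ENNReal.ofReal (p * b₁ + b₂) * Z) := by gcongr
    _ = _ := by rw [mul_left_comm, ENNReal.inv_mul_cancel hZ0 hZtop, mul_one]

end Posterior

/-! ### Squares of sub-Gaussian variables and Bernstein's inequality. -/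

section SubGaussian

variable {Ω : Type*} [MeasurableSpace Ω] {P : Measure Ω}

theorem hasSum_pow_div_factorial_exp (y : ℝ) :
    HasSum (fun j : ℕ => y ^ j / (j.factorial : ℝ)) (Real.exp y) := by
  rw [Real.exp_eq_exp_ℝ]
  exact NormedSpace.expSeries_div_hasSum_exp y

theorem pow_self_le_three_pow_mul_factorial (j : ℕ) :
    (j : ℝ) ^ j ≤ 3 ^ j * (j.factorial : ℝ) := by
  have h1 := Real.pow_div_factorial_le_exp (j : ℝ) (Nat.cast_nonneg j) j
  rw [div_le_iff₀ (by positivity)] at h1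
  refine h1.trans ?_
  gcongr
  rw [← Real.exp_one_pow]
  gcongr
  linarith [Real.exp_one_lt_d9]

/-- Even moments of a sub-Gaussian variable. -/
theorem integral_sq_pow_le {X : Ω → ℝ} (hX : AEStronglyMeasurable X P) {s : ℝ} (hs : 0 ≤ s)
    (h : ∀ q : ℝ, 1 ≤ q → eLpNorm X (ENNReal.ofReal q) P ≤ ENNReal.ofReal (√q * s)) (j : ℕ)
    (hj : 1 ≤ j) :
    Integrable (fun ω => (X ω ^ 2) ^ j) P ∧ ∫ ω, (X ω ^ 2) ^ j ∂P ≤ (2 * j * s ^ 2) ^ j := by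
  have hj' : (1 : ℝ) ≤ j := by exact_mod_cast hj
  have hq1 : (1 : ℝ) ≤ 2 * j := by linarith
  have hq0 : ENNReal.ofReal (2 * j) ≠ 0 := by
    rw [Ne, ENNReal.ofReal_eq_zero]; linarith
  have hmem : MemLp X (ENNReal.ofReal (2 * j)) P :=
    ⟨hX, (h _ hq1).trans_lt ENNReal.ofReal_lt_top⟩
  have htr : (ENNReal.ofReal (2 * (j : ℝ))).toReal = 2 * j := ENNReal.toReal_ofReal (by linarith)
  have hpow : ∀ ω, ‖X ω‖ ^ (2 * j : ℝ) = (X ω ^ 2) ^ j := fun ω => by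
    rw [show (2 * j : ℝ) = ((2 * j : ℕ) : ℝ) by push_cast; ring, Real.rpow_natCast, pow_mul,
      Real.norm_eq_abs, sq_abs]
  refine ⟨?_, ?_⟩
  · have := hmem.integrable_norm_rpow hq0 ENNReal.ofReal_ne_top
    rw [htr] at this
    simpa only [hpow] using this
  · have h1 := h _ hq1
    rw [hmem.eLpNorm_eq_integral_rpow_norm hq0 ENNReal.ofReal_ne_top, htr,
      ENNReal.ofReal_le_ofReal_iff (by positivity)] at h1
    simp only [hpow] at h1
    have hnn : 0 ≤ ∫ ω, (X ω ^ 2) ^ j ∂P := integral_nonneg fun ω => by positivity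
    rw [Real.rpow_inv_le_iff_of_pos hnn (by positivity) (by linarith)] at h1
    refine h1.trans (le_of_eq ?_)
    rw [show (2 * j : ℝ) = ((2 * j : ℕ) : ℝ) by push_cast; ring, Real.rpow_natCast, pow_mul,
      mul_pow, Real.sq_sqrt (by positivity)]

/-- The squares of sub-Gaussian variables are sub-exponential. -/
theorem mgf_sq_le [IsProbabilityMeasure P] {X : Ω → ℝ} (hX : AEStronglyMeasurable X P) {s : ℝ}
    (hs : 0 ≤ s)
    (h : ∀ q : ℝ, 1 ≤ q → eLpNorm X (ENNReal.ofReal q) P ≤ ENNReal.ofReal (√q * s))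
    {t : ℝ} (ht : |t| * (6 * s ^ 2) ≤ 1 / 2) :
    Integrable (fun ω => Real.exp (t * X ω ^ 2)) P ∧
      mgf (fun ω => X ω ^ 2) P t ≤
        Real.exp (t * ∫ ω, X ω ^ 2 ∂P + 2 * (t * (6 * s ^ 2)) ^ 2) := by
  set x := |t| * (6 * s ^ 2) with hx
  have hx0 : 0 ≤ x := by positivity
  -- From (2j s²)^j and j^j ≤ 3^j j!; the factorial cancels in the exponential series, leaving a
  -- geometric one with ratio |t|·6s².
  have hmom : ∀ j : ℕ, Integrable (fun ω => (X ω ^ 2) ^ j) P ∧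
      ∫ ω, (X ω ^ 2) ^ j ∂P ≤ (6 * s ^ 2) ^ j * (j.factorial : ℝ) := by
    intro j
    rcases Nat.eq_zero_or_pos j with rfl | hj
    · simp
    · obtain ⟨h1, h2⟩ := integral_sq_pow_le hX hs h j hj
      refine ⟨h1, h2.trans ?_⟩
      calc (2 * j * s ^ 2) ^ j = (2 * s ^ 2) ^ j * (j : ℝ) ^ j := by rw [← mul_pow]; ring_nf
        _ ≤ (2 * s ^ 2) ^ j * (3 ^ j * (j.factorial : ℝ)) := by
          gcongr; exact pow_self_le_three_pow_mul_factorial j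
        _ = _ := by rw [← mul_assoc, ← mul_pow]; ring_nf
  have key : ∀ t : ℝ, |t| * (6 * s ^ 2) ≤ 1 / 2 →
      HasSum (fun j : ℕ => t ^ j / (j.factorial : ℝ) * ∫ ω, (X ω ^ 2) ^ j ∂P)
        (∫ ω, Real.exp (t * X ω ^ 2) ∂P) := by
    intro t ht
    have hb : ∀ j : ℕ, |t| ^ j / (j.factorial : ℝ) * ∫ ω, (X ω ^ 2) ^ j ∂P ≤
        (|t| * (6 * s ^ 2)) ^ j := fun j => by
      calc _ ≤ |t| ^ j / (j.factorial : ℝ) * ((6 * s ^ 2) ^ j * (j.factorial : ℝ)) := by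
            gcongr; exact (hmom j).2
        _ = _ := by
          have : (j.factorial : ℝ) ≠ 0 := by positivity
          field_simp
          simp only [mul_pow]; ring
    have hsum : Summable fun j : ℕ => ∫ ω, ‖t ^ j / (j.factorial : ℝ) * (X ω ^ 2) ^ j‖ ∂P := by
      refine Summable.of_nonneg_of_le (fun j => integral_nonneg fun ω => norm_nonneg _)
        (fun j => ?_) (summable_geometric_of_lt_one (r := |t| * (6 * s ^ 2)) (by positivity)
          (by linarith))
      refine le_trans (le_of_eq ?_) (hb j)
      rw [← integral_const_mul]
      refine integral_congr_ae (ae_of_all _ fun ω => ?_)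
      simp
    have := hasSum_integral_of_summable_integral_norm
      (F := fun (j : ℕ) ω => t ^ j / (j.factorial : ℝ) * (X ω ^ 2) ^ j) (μ := P)
      (fun j => (hmom j).1.const_mul _) hsum
    simp only [integral_const_mul] at this
    have hexp : ∀ ω, ∑' j : ℕ, t ^ j / (j.factorial : ℝ) * (X ω ^ 2) ^ j =
        Real.exp (t * X ω ^ 2) := fun ω => by
      rw [← (hasSum_pow_div_factorial_exp (t * X ω ^ 2)).tsum_eq]
      exact tsum_congr fun j => by rw [mul_pow]; ring
    simpa only [hexp] using this
  have habs := key |t| (by rwa [abs_abs])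
  have hint_abs : Integrable (fun ω => Real.exp (|t| * X ω ^ 2)) P := by
    -- A non-integrable function would have integral 0 by convention, yet the series of nonnegative
    -- terms has j = 0 term equal to 1.
    by_contra hcon
    rw [integral_undef hcon] at habs
    have h0 := le_hasSum habs 0 fun j _ => by
      have : 0 ≤ ∫ ω, (X ω ^ 2) ^ j ∂P := integral_nonneg fun ω => by positivity
      positivity
    norm_num at h0
  have hint : Integrable (fun ω => Real.exp (t * X ω ^ 2)) P := by
    refine hint_abs.mono' ?_ (ae_of_all _ fun ω => ?_)
    · exact (((hX.aemeasurable.pow_const 2).const_mul t).exp).aestronglyMeasurable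
    · rw [Real.norm_of_nonneg (Real.exp_pos _).le, Real.exp_le_exp]
      exact mul_le_mul_of_nonneg_right (le_abs_self t) (sq_nonneg _)
  refine ⟨hint, ?_⟩
  have hs1 := key t ht
  have htail : HasSum (fun j : ℕ => x ^ 2 * x ^ j) (x ^ 2 * (1 - x)⁻¹) :=
    (hasSum_geometric_of_lt_one hx0 (by linarith)).mul_left _
  -- The first two terms are 1 + t·E X²; the remainder is at most x²/(1 - x) ≤ 2x², and 1 + z ≤ exp
  -- z finishes.
  have hs2 := (hasSum_nat_add_iff' 2).2 hs1
  have hle := hasSum_le (fun j => ?_) hs2 htail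
  · simp only [Finset.sum_range_succ, Finset.sum_range_zero, pow_zero, pow_one,
      Nat.factorial_zero, Nat.factorial_one, Nat.cast_one, div_one, integral_const,
      probReal_univ, smul_eq_mul, mul_one, zero_add] at hle
    have h2 : x ^ 2 * (1 - x)⁻¹ ≤ 2 * x ^ 2 := by
      have : (1 - x)⁻¹ ≤ 2 := by
        rw [inv_le_comm₀ (by linarith) two_pos]; linarith
      nlinarith [sq_nonneg x]
    have h3 : x ^ 2 = (t * (6 * s ^ 2)) ^ 2 := by rw [hx, mul_pow, sq_abs]; ring
    have h4 := Real.add_one_le_exp (t * ∫ ω, X ω ^ 2 ∂P + 2 * (t * (6 * s ^ 2)) ^ 2)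
    rw [mgf]
    linarith
  · have h1 : t ^ (j + 2) / ((j + 2).factorial : ℝ) ≤ |t| ^ (j + 2) / ((j + 2).factorial : ℝ) := by
      refine div_le_div_of_nonneg_right ?_ (by positivity)
      rw [← abs_pow]; exact le_abs_self _
    have h2 : 0 ≤ ∫ ω, (X ω ^ 2) ^ (j + 2) ∂P := integral_nonneg fun ω => by positivity
    calc _ ≤ |t| ^ (j + 2) / ((j + 2).factorial : ℝ) * ((6 * s ^ 2) ^ (j + 2) *
          ((j + 2).factorial : ℝ)) :=
          mul_le_mul h1 (hmom (j + 2)).2 h2 (by positivity)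
      _ = x ^ 2 * x ^ j := by
          have : ((j + 2).factorial : ℝ) ≠ 0 := by positivity
          rw [hx]; field_simp; simp only [mul_pow]; ring

/-- Bernstein's inequality for sums of squares of independent sub-Gaussian variables. -/
theorem measure_abs_sum_sq_sub_ge_le [IsProbabilityMeasure P] {n : ℕ} {X : Fin n → Ω → ℝ}
    (hX : ∀ i, AEStronglyMeasurable (X i) P) (hind : iIndepFun (fun i ω => X i ω ^ 2) P)
    {s m x : ℝ} (hs : 0 < s)
    (h : ∀ i, ∀ q : ℝ, 1 ≤ q → eLpNorm (X i) (ENNReal.ofReal q) P ≤ ENNReal.ofReal (√q * s))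
    (hm : ∀ i, ∫ ω, X i ω ^ 2 ∂P = m) (hx : 0 ≤ x) (hx2 : x ≤ 2 * (6 * s ^ 2)) :
    P {ω | n * x ≤ |∑ i, X i ω ^ 2 - n * m|} ≤
      ENNReal.ofReal (2 * Real.exp (-(n * x ^ 2 / (8 * (6 * s ^ 2) ^ 2)))) := by
  set L := 6 * s ^ 2 with hL
  have hL0 : 0 < L := by positivity
  have hmeas : ∀ i, AEMeasurable (fun ω => X i ω ^ 2) P := fun i => (hX i).aemeasurable.pow_const 2
  have hmgf : ∀ t : ℝ, |t| * L ≤ 1 / 2 →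
      Integrable (fun ω => Real.exp (t * (∑ i, fun ω => X i ω ^ 2) ω)) P ∧
      mgf (∑ i, fun ω => X i ω ^ 2) P t ≤ Real.exp (n * (t * m + 2 * (t * L) ^ 2)) := by
    intro t ht
    have h1 := fun i => mgf_sq_le (hX i) hs.le (h i) ht
    have h2 := hind.mgf_sum₀ (t := t) hmeas Finset.univ
    refine ⟨?_, ?_⟩
    -- The same convention: the mgf of the sum is a product of positive factors, hence cannot be the
    -- default value 0.
    · by_contra hcon
      have h3 : 0 < ∏ i, mgf (fun ω => X i ω ^ 2) P t :=
        Finset.prod_pos fun i _ => mgf_pos (h1 i).1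
      rw [← h2, mgf, integral_undef hcon] at h3
      exact lt_irrefl _ h3
    · rw [h2]
      calc _ ≤ ∏ _i : Fin n, Real.exp (t * m + 2 * (t * L) ^ 2) := by
            refine Finset.prod_le_prod (fun i _ => mgf_nonneg) fun i _ => ?_
            rw [← hm i]; exact (h1 i).2
        _ = _ := by
            rw [Finset.prod_const, ← Real.exp_nat_mul]
            simp
  -- The minimiser of -tx + 2t²L²; the condition x ≤ 2L is exactly tL ≤ 1/2.
  set t := x / (4 * L ^ 2) with ht
  have ht0 : 0 ≤ t := by positivity
  have htL : t * L = x / (4 * L) := by rw [ht]; field_simp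
  have htL2 : t * L ≤ 1 / 2 := by rw [htL, div_le_iff₀ (by positivity)]; linarith
  have hexp : n * (-(t * x) + 2 * (t * L) ^ 2) = -(n * x ^ 2 / (8 * L ^ 2)) := by
    rw [htL, ht]; field_simp; ring
  have hup := hmgf t (by rwa [abs_of_nonneg ht0])
  have hlo := hmgf (-t) (by rwa [abs_neg, abs_of_nonneg ht0])
  have e1 := measure_ge_le_exp_mul_mgf (n * (m + x)) ht0 hup.1
  have e2 := measure_le_le_exp_mul_mgf (n * (m - x)) (neg_nonpos.2 ht0) hlo.1
  have f1 : P.real {ω | n * (m + x) ≤ (∑ i, fun ω => X i ω ^ 2) ω} ≤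
      Real.exp (-(n * x ^ 2 / (8 * L ^ 2))) := by
    refine e1.trans ((mul_le_mul_of_nonneg_left hup.2 (Real.exp_pos _).le).trans (le_of_eq ?_))
    rw [← Real.exp_add, ← hexp]
    congr 1; ring
  have f2 : P.real {ω | (∑ i, fun ω => X i ω ^ 2) ω ≤ n * (m - x)} ≤
      Real.exp (-(n * x ^ 2 / (8 * L ^ 2))) := by
    refine e2.trans ((mul_le_mul_of_nonneg_left hlo.2 (Real.exp_pos _).le).trans (le_of_eq ?_))
    rw [← Real.exp_add, ← hexp]
    congr 1; ring
  rw [measureReal_def, ← ENNReal.le_ofReal_iff_toReal_le (measure_ne_top _ _)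
    (Real.exp_pos _).le] at f1 f2
  calc _ ≤ P ({ω | n * (m + x) ≤ (∑ i, fun ω => X i ω ^ 2) ω} ∪
        {ω | (∑ i, fun ω => X i ω ^ 2) ω ≤ n * (m - x)}) := by
        refine measure_mono fun ω hω => ?_
        simp only [Set.mem_ofPred_eq, Set.mem_union, Finset.sum_apply] at hω ⊢
        rcases le_abs.1 hω with h1 | h1
        · left; linarith
        · right; linarith
    _ ≤ _ := measure_union_le _ _
    _ ≤ _ := add_le_add f1 f2
    _ = _ := by rw [← ENNReal.ofReal_add (by positivity) (by positivity), two_mul]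

end SubGaussian

/-- Linear forms are linear forms in the standardised vector. -/
theorem WellConditioned.exists_dotProduct_eq_invSqrt {p : ℕ} {κ : ℝ} (hκ : 0 < κ)
    {S0 : Matrix (Fin p) (Fin p) ℝ} (h : WellConditioned κ S0) (v : Fin p → ℝ) :
    ∃ w : Fin p → ℝ, w ⬝ᵥ w = v ⬝ᵥ S0 *ᵥ v ∧ ∀ y, v ⬝ᵥ y = w ⬝ᵥ (invSqrt S0 *ᵥ y) := by
  obtain ⟨hH, hev⟩ := h
  have hsa : IsSelfAdjoint S0 := hH
  have hpos : ∀ x ∈ spectrum ℝ S0, 0 < x := by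
    intro x hx
    rw [hH.spectrum_real_eq_range_eigenvalues] at hx
    obtain ⟨i, rfl⟩ := hx
    exact hκ.trans_le (hev i).1
  have hc1 : ContinuousOn (fun x : ℝ => √x) (spectrum ℝ S0) := Real.continuous_sqrt.continuousOn
  have hc2 : ContinuousOn (fun x : ℝ => (√x)⁻¹) (spectrum ℝ S0) :=
    hc1.inv₀ fun x hx => (Real.sqrt_pos.2 (hpos x hx)).ne'
  -- The witness is w = S0^{1/2} v.
  set R : Matrix (Fin p) (Fin p) ℝ := cfc (fun x : ℝ => √x) S0 with hR
  have hRsymm : Rᵀ = R := by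
    have : IsSelfAdjoint R := cfc_predicate _ S0
    simpa [Matrix.conjTranspose_eq_transpose_of_trivial] using
      (show Rᴴ = R from this)
  have hRR : R * R = S0 := by
    rw [hR, ← cfc_mul _ _ S0 hc1 hc1]
    conv_rhs => rw [← cfc_id' ℝ S0 hsa]
    exact cfc_congr fun x hx => Real.mul_self_sqrt (hpos x hx).le
  have hRI : R * invSqrt S0 = 1 := by
    rw [hR, invSqrt, ← cfc_mul _ _ S0 hc1 hc2, ← cfc_const_one ℝ S0 hsa]
    exact cfc_congr fun x hx => mul_inv_cancel₀ (Real.sqrt_pos.2 (hpos x hx)).ne'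
  have hmove : ∀ z, (R *ᵥ v) ⬝ᵥ z = v ⬝ᵥ (R *ᵥ z) := fun z => by
    rw [Matrix.dotProduct_mulVec, ← Matrix.mulVec_transpose, hRsymm]
  refine ⟨R *ᵥ v, ?_, fun y => ?_⟩
  · rw [hmove, Matrix.mulVec_mulVec, hRR]
  · rw [hmove, Matrix.mulVec_mulVec, hRI, Matrix.one_mulVec]

/-! ### Concentration of the sample covariance matrix. -/

section Sample

variable {Ω : Type*} [MeasurableSpace Ω] {P : Measure Ω} {p : ℕ}

/-- Homogeneity extends the moment bound from unit vectors to all w. -/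
theorem eLpNorm_dotProduct_le_of_psiTwoNormVec_le {Z : Ω → Fin p → ℝ} {σ₀ : ℝ}
    (h : psiTwoNormVec P Z ≤ ENNReal.ofReal σ₀) (w : Fin p → ℝ) {q : ℝ} (hq : 1 ≤ q) :
    eLpNorm (fun ω => w ⬝ᵥ Z ω) (ENNReal.ofReal q) P ≤
      ENNReal.ofReal (√q * (σ₀ * √(w ⬝ᵥ w))) := by
  rcases eq_or_ne w 0 with rfl | hw
  · simp
  have hw0 : 0 < w ⬝ᵥ w := dotProduct_self_pos hw
  have hr : 0 < √(w ⬝ᵥ w) := Real.sqrt_pos.2 hw0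
  set r := √(w ⬝ᵥ w) with hrdef
  have hrr : r * r = w ⬝ᵥ w := Real.mul_self_sqrt hw0.le
  have hu : (r⁻¹ • w) ⬝ᵥ (r⁻¹ • w) = 1 := by
    rw [smul_dotProduct, dotProduct_smul, smul_eq_mul, smul_eq_mul, ← hrr]
    field_simp
  have h1 : eLpNorm (fun ω => (r⁻¹ • w) ⬝ᵥ Z ω) (ENNReal.ofReal q) P / ENNReal.ofReal √q ≤
      ENNReal.ofReal σ₀ := by
    refine le_trans ?_ h
    refine le_trans ?_ (le_iSup₂ (f := fun (u : Fin p → ℝ) (_ : u ⬝ᵥ u = 1) =>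
      psiTwoNorm P fun ω => u ⬝ᵥ Z ω) (r⁻¹ • w) hu)
    exact le_iSup₂ (f := fun (q : ℝ) (_ : 1 ≤ q) => eLpNorm (fun ω => (r⁻¹ • w) ⬝ᵥ Z ω)
      (ENNReal.ofReal q) P / ENNReal.ofReal (√q)) q hq
  have hq0 : 0 < √q := Real.sqrt_pos.2 (by linarith)
  rw [ENNReal.div_le_iff (by simpa using hq0) ENNReal.ofReal_ne_top] at h1
  have h2 : (fun ω => w ⬝ᵥ Z ω) = r • fun ω => (r⁻¹ • w) ⬝ᵥ Z ω := by
    funext ω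
    simp only [Pi.smul_apply, smul_dotProduct, smul_eq_mul]
    field_simp
  rw [h2, eLpNorm_const_smul, Real.enorm_eq_ofReal hr.le]
  calc _ ≤ ENNReal.ofReal r * (ENNReal.ofReal σ₀ * ENNReal.ofReal √q) := by gcongr
    _ = _ := by
      rw [← ENNReal.ofReal_mul' hq0.le, ← ENNReal.ofReal_mul hr.le]
      congr 1; ring

theorem dotProduct_sampleCov_mulVec {n : ℕ} (y : Fin n → Fin p → ℝ) (v : Fin p → ℝ) :
    v ⬝ᵥ sampleCov y *ᵥ v = (n : ℝ)⁻¹ * ∑ i, (v ⬝ᵥ y i) ^ 2 := by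
  simp only [sampleCov, Matrix.smul_mulVec, dotProduct_smul, Matrix.sum_mulVec,
    dotProduct_sum, smul_eq_mul]
  congr 1
  refine Finset.sum_congr rfl fun i _ => ?_
  rw [Matrix.vecMulVec_mulVec]
  simp [dotProduct_comm (y i) v, sq]

theorem sampleCov_isSymm {n : ℕ} (y : Fin n → Fin p → ℝ) : (sampleCov y).IsSymm := by
  ext i j
  simp [sampleCov, Matrix.sum_apply, Matrix.vecMulVec_apply, mul_comm]

theorem IsIIDSample.integral_dotProduct_sq {n : ℕ} {Y : Fin n → Ω → Fin p → ℝ}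
    {S0 : Matrix (Fin p) (Fin p) ℝ} (hY : IsIIDSample P Y S0) (i : Fin n)
    (hL2 : ∀ a, MemLp (fun ω => Y i ω a) 2 P) (v : Fin p → ℝ) :
    ∫ ω, (v ⬝ᵥ Y i ω) ^ 2 ∂P = v ⬝ᵥ S0 *ᵥ v := by
  have h1 : ∀ ω, (v ⬝ᵥ Y i ω) ^ 2 = ∑ a, ∑ b, v a * v b * (Y i ω a * Y i ω b) := fun ω => by
    simp only [dotProduct, sq, Finset.sum_mul_sum]
    exact Finset.sum_congr rfl fun a _ => Finset.sum_congr rfl fun b _ => by ring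
  have hint : ∀ a b, Integrable (fun ω => v a * v b * (Y i ω a * Y i ω b)) P := fun a b =>
    ((hL2 a).integrable_mul (hL2 b)).const_mul _
  simp only [h1]
  rw [integral_finsetSum _ fun a _ => integrable_finsetSum _ fun b _ => hint a b]
  simp only [dotProduct, Matrix.mulVec, Finset.mul_sum]
  refine Finset.sum_congr rfl fun a _ => ?_
  rw [integral_finsetSum _ fun b _ => hint a b]
  refine Finset.sum_congr rfl fun b _ => ?_
  rw [integral_const_mul, hY.cov]; ring

/-- Concentration of the sample covariance matrix of a sub-Gaussian sample. -/
theorem IsIIDSample.measure_specNorm_sampleCov_sub_le [IsProbabilityMeasure P] {n : ℕ}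
    (hn : 1 ≤ n) {Y : Fin n → Ω → Fin p → ℝ} {S0 : Matrix (Fin p) (Fin p) ℝ}
    (hY : IsIIDSample P Y S0) {κ : ℝ} (hκ : 0 < κ) (hS0 : WellConditioned κ S0) {σ₀ : ℝ}
    (hσ₀ : 0 < σ₀)
    (hsub : ∀ i, psiTwoNormVec P (fun ω => invSqrt S0 *ᵥ Y i ω) ≤ ENNReal.ofReal σ₀)
    {β : ℝ} (hβ : 0 ≤ β) (hβ2 : β ≤ 2 * (6 * σ₀ ^ 2 / κ)) :
    P {ω | 4 * β < specNorm (sampleCov (fun i => Y i ω) - S0)} ≤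
      ENNReal.ofReal (4 * 25 ^ p * Real.exp (-(n * β ^ 2 / (8 * (6 * σ₀ ^ 2 / κ) ^ 2)))) := by
  have hn0 : (0 : ℝ) < n := by exact_mod_cast hn
  -- Measurability of the sample is carried by identical distribution, here of a vector with itself.
  have hYm : ∀ i, AEMeasurable (Y i) P := fun i => (hY.ident i i).aemeasurable_fst
  have hdm : ∀ v : Fin p → ℝ, Measurable fun y : Fin p → ℝ => v ⬝ᵥ y := fun v =>
    (continuous_const.dotProduct continuous_id).measurable
  have hXm : ∀ i (v : Fin p → ℝ), AEStronglyMeasurable (fun ω => v ⬝ᵥ Y i ω) P := fun i v =>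
    ((hdm v).comp_aemeasurable (hYm i)).aestronglyMeasurable
  have hmom : ∀ i (v : Fin p → ℝ) (q : ℝ), 1 ≤ q →
      eLpNorm (fun ω => v ⬝ᵥ Y i ω) (ENNReal.ofReal q) P ≤
        ENNReal.ofReal (√q * (σ₀ * √(v ⬝ᵥ v / κ))) := by
    intro i v q hq
    obtain ⟨w, hw, hwy⟩ := hS0.exists_dotProduct_eq_invSqrt hκ v
    rw [show (fun ω => v ⬝ᵥ Y i ω) = fun ω => w ⬝ᵥ (invSqrt S0 *ᵥ Y i ω) from
      funext fun ω => hwy _]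
    refine (eLpNorm_dotProduct_le_of_psiTwoNormVec_le (hsub i) w hq).trans ?_
    gcongr
    rw [hw]
    refine (hS0.quadForm_bounds v).2.trans (le_of_eq ?_)
    ring
  have hL2 : ∀ i a, MemLp (fun ω => Y i ω a) 2 P := by
    intro i a
    have h1 := hmom i (Pi.single a 1) 2 one_le_two
    have h2 := hXm i (Pi.single a 1)
    simp only [single_one_dotProduct, ENNReal.ofReal_ofNat] at h1 h2
    exact ⟨h2, h1.trans_lt ENNReal.ofReal_lt_top⟩
  obtain ⟨T, hTcard, hT0, hT⟩ := exists_test_vectors p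
  have hone : ∀ v ∈ T, P {ω | β * (v ⬝ᵥ v) < |v ⬝ᵥ (sampleCov (fun i => Y i ω) - S0) *ᵥ v|} ≤
      ENNReal.ofReal (2 * Real.exp (-(n * β ^ 2 / (8 * (6 * σ₀ ^ 2 / κ) ^ 2)))) := by
    intro v hv
    have hvv : 0 < v ⬝ᵥ v := dotProduct_self_pos (hT0 v hv)
    -- The sub-exponential scale of (vᵀY)² is proportional to vᵀv, as is the allowed deviation, so
    -- the exponent does not depend on v.
    have hs : 6 * (σ₀ * √(v ⬝ᵥ v / κ)) ^ 2 = 6 * σ₀ ^ 2 / κ * (v ⬝ᵥ v) := by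
      rw [mul_pow, Real.sq_sqrt (by positivity)]; ring
    have h1 := measure_abs_sum_sq_sub_ge_le (P := P) (X := fun i ω => v ⬝ᵥ Y i ω)
      (x := β * (v ⬝ᵥ v)) (m := v ⬝ᵥ S0 *ᵥ v) (s := σ₀ * √(v ⬝ᵥ v / κ))
      (fun i => hXm i v)
      (hY.indep.comp (fun _ y => (v ⬝ᵥ y) ^ 2) fun _ => (hdm v).pow_const 2)
      (by positivity) (fun i => hmom i v)
      (fun i => hY.integral_dotProduct_sq i (hL2 i) v) (by positivity)
      (by rw [hs]; nlinarith)
    rw [hs] at h1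
    have h2 : n * (β * (v ⬝ᵥ v)) ^ 2 / (8 * (6 * σ₀ ^ 2 / κ * (v ⬝ᵥ v)) ^ 2) =
        n * β ^ 2 / (8 * (6 * σ₀ ^ 2 / κ) ^ 2) := by
      field_simp
    rw [h2] at h1
    refine (measure_mono fun ω hω => ?_).trans h1
    simp only [Set.mem_ofPred_eq] at hω ⊢
    rw [Matrix.sub_mulVec, dotProduct_sub, dotProduct_sampleCov_mulVec] at hω
    have h3 : ∑ i, (v ⬝ᵥ Y i ω) ^ 2 - n * (v ⬝ᵥ S0 *ᵥ v) =
        n * ((n : ℝ)⁻¹ * ∑ i, (v ⬝ᵥ Y i ω) ^ 2 - v ⬝ᵥ S0 *ᵥ v) := by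
      field_simp
    rw [h3, abs_mul, abs_of_pos hn0]
    exact mul_le_mul_of_nonneg_left hω.le hn0.le
  calc _ ≤ P (⋃ v ∈ T, {ω | β * (v ⬝ᵥ v) <
        |v ⬝ᵥ (sampleCov (fun i => Y i ω) - S0) *ᵥ v|}) := by
        refine measure_mono fun ω hω => ?_
        by_contra hcon
        simp only [Set.mem_iUnion, Set.mem_ofPred_eq, not_exists, not_lt] at hcon
        exact absurd (hT _ ((sampleCov_isSymm _).sub hS0.isSymm) β hβ hcon) (not_le.2 hω)
    _ ≤ ∑ v ∈ T, _ := measure_biUnion_finset_le _ _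
    _ ≤ ∑ _v ∈ T, _ := Finset.sum_le_sum hone
    _ = (T.card : ℝ≥0∞) * _ := by rw [Finset.sum_const, nsmul_eq_mul]
    _ = ENNReal.ofReal (T.card * (2 * Real.exp (-(n * β ^ 2 / (8 * (6 * σ₀ ^ 2 / κ) ^ 2))))) := by
        rw [ENNReal.ofReal_mul (Nat.cast_nonneg T.card), ENNReal.ofReal_natCast]
    _ ≤ _ := by
        have hcard : (T.card : ℝ) ≤ 2 * 25 ^ p := by exact_mod_cast hTcard
        refine ENNReal.ofReal_le_ofReal ?_
        calc _ ≤ 2 * 25 ^ p * (2 * Real.exp (-(n * β ^ 2 / (8 * (6 * σ₀ ^ 2 / κ) ^ 2)))) := by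
              gcongr
          _ = _ := by ring

end Sample

/-- All estimates given S are deterministic; randomness enters only through the bad set where S is
far from Σ₀. -/
theorem TendstoZeroInProb.of_good_event {Ω : ℕ → Type*} [∀ n, MeasurableSpace (Ω n)]
    {P : ∀ n, Measure (Ω n)} {X : ∀ n, Ω n → ℝ≥0∞} (B : ∀ n, Set (Ω n)) (b : ℕ → ℝ≥0∞)
    (hb : Tendsto b atTop (𝓝 0)) (hB : Tendsto (fun n => P n (B n)) atTop (𝓝 0))
    (h : ∀ᶠ n in atTop, ∀ ω, ω ∉ B n → X n ω ≤ b n) : TendstoZeroInProb P X := by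
  intro η hη
  refine tendsto_of_tendsto_of_tendsto_of_le_of_le' tendsto_const_nhds hB
    (Eventually.of_forall fun _ => zero_le) ?_
  filter_upwards [h, hb.eventually_lt_const hη] with n hn hbn
  refine measure_mono fun ω hω => ?_
  by_contra hcon
  have hω' : η ≤ X n ω := hω
  exact absurd (hω'.trans (hn ω hcon)) (not_le.2 hbn)

/-- Spectral bounds for a perturbation of a well-conditioned matrix. -/
theorem WellConditioned.quadForm_bounds_of_sub {p : ℕ} {κ : ℝ} (hκ : 0 < κ) (hκ1 : κ ≤ 1)
    {S0 S : Matrix (Fin p) (Fin p) ℝ} (hS0 : WellConditioned κ S0)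
    (h : specNorm (S - S0) ≤ κ / 2) (v : Fin p → ℝ) :
    κ / 2 * (v ⬝ᵥ v) ≤ v ⬝ᵥ S *ᵥ v ∧ v ⬝ᵥ S *ᵥ v ≤ (κ / 2)⁻¹ * (v ⬝ᵥ v) := by
  have h1 := quadForm_le_of_sub (fun v => (hS0.quadForm_bounds v).1) h v
  have h2 := quadForm_ge_of_sub (fun v => (hS0.quadForm_bounds v).2) h v
  refine ⟨by linarith, h2.trans ?_⟩
  refine mul_le_mul_of_nonneg_right ?_
    (by rw [dotProduct_self_eq_norm_sq]; positivity)
  have h3 : 1 ≤ 1 / κ := by rw [le_div_iff₀ hκ]; linarith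
  have h4 : (κ / 2)⁻¹ = 2 * (1 / κ) := by field_simp
  rw [h4]; linarith

/-! ### Consequences of the growth condition on the dimension. -/

section Growth

variable {p : ℕ → ℕ}

theorem tendsto_dim_div (hp : ∀ n, 1 ≤ p n)
    (hgrowth : Tendsto (fun n => (p n : ℝ) ^ 5 / (n : ℝ)) atTop (𝓝 0)) :
    Tendsto (fun n => (p n : ℝ) / n) atTop (𝓝 0) := by
  refine squeeze_zero (fun n => by positivity) (fun n => ?_) hgrowth
  have h1 : (1 : ℝ) ≤ p n := by exact_mod_cast hp n
  exact div_le_div_of_nonneg_right (le_self_pow₀ h1 (by norm_num)) (Nat.cast_nonneg n)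

theorem tendsto_sqrt_dim_div (hp : ∀ n, 1 ≤ p n)
    (hgrowth : Tendsto (fun n => (p n : ℝ) ^ 5 / (n : ℝ)) atTop (𝓝 0)) :
    Tendsto (fun n => √((p n : ℝ) / n)) atTop (𝓝 0) := by
  simpa using (tendsto_dim_div hp hgrowth).sqrt

/-- Since p²√(p/n) = √(p⁵/n), this is the quantity in the flatness bound and the reason for the
fifth power. -/
theorem tendsto_dim_sq_mul_sqrt
    (hgrowth : Tendsto (fun n => (p n : ℝ) ^ 5 / (n : ℝ)) atTop (𝓝 0)) :
    Tendsto (fun n => (p n : ℝ) ^ 2 * √((p n : ℝ) / n)) atTop (𝓝 0) := by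
  have h := hgrowth.sqrt
  rw [Real.sqrt_zero] at h
  refine h.congr fun n => ?_
  rw [show (p n : ℝ) ^ 5 / (n : ℝ) = ((p n : ℝ) ^ 2) ^ 2 * ((p n : ℝ) / n) by ring,
    Real.sqrt_mul (by positivity), Real.sqrt_sq (by positivity)]

theorem tendsto_inv_sqrt_dim_div (hp : ∀ n, 1 ≤ p n)
    (hgrowth : Tendsto (fun n => (p n : ℝ) ^ 5 / (n : ℝ)) atTop (𝓝 0)) :
    Tendsto (fun n => (√((p n : ℝ) / n))⁻¹) atTop atTop := by
  refine Tendsto.inv_tendsto_nhdsGT_zero (tendsto_nhdsWithin_iff.2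
    ⟨tendsto_sqrt_dim_div hp hgrowth, ?_⟩)
  filter_upwards [eventually_ge_atTop 1] with n hn
  have h1 : (0 : ℝ) < p n := by exact_mod_cast hp n
  have h2 : (0 : ℝ) < n := by exact_mod_cast hn
  exact Real.sqrt_pos.2 (by positivity)

theorem twentyFive_pow_le_exp (p : ℕ) : (25 : ℝ) ^ p ≤ Real.exp (4 * p) := by
  rw [mul_comm, Real.exp_nat_mul]
  gcongr
  have h1 : (2.7 : ℝ) ≤ Real.exp 1 := by linarith [Real.exp_one_gt_d9]
  calc (25 : ℝ) ≤ 2.7 ^ 4 := by norm_num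
    _ ≤ Real.exp 1 ^ 4 := by gcongr
    _ = Real.exp 4 := by rw [Real.exp_one_pow]; norm_num

theorem sample_size_mul_sq_rate {n p : ℕ} (hn : 1 ≤ n) (t : ℝ) :
    n * (t * √((p : ℝ) / n)) ^ 2 = t ^ 2 * p := by
  have h2 : (0 : ℝ) < n := by exact_mod_cast hn
  rw [mul_pow, Real.sq_sqrt (by positivity)]
  field_simp

theorem sample_size_mul_rate {n p : ℕ} (hn : 1 ≤ n) (hp : 1 ≤ p) (t : ℝ) :
    n * (t * √((p : ℝ) / n)) = t * (p * (√((p : ℝ) / n))⁻¹) := by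
  have h2 : (0 : ℝ) < n := by exact_mod_cast hn
  have h1 : (0 : ℝ) < p := by exact_mod_cast hp
  have h3 : 0 < √((p : ℝ) / n) := Real.sqrt_pos.2 (by positivity)
  have h4 : n * √((p : ℝ) / n) ^ 2 = p := by
    rw [Real.sq_sqrt (by positivity)]; field_simp
  generalize √((p : ℝ) / n) = e at h3 h4 ⊢
  rw [← h4]; field_simp

end Growth

/-! ### Asymptotic statements along a factor t n. -/

section Rates

variable {Ω : ℕ → Type*} [∀ n, MeasurableSpace (Ω n)] {P : ∀ n, Measure (Ω n)}
  [∀ n, IsProbabilityMeasure (P n)] {p : ℕ → ℕ} {Y : ∀ n, Fin n → Ω n → Fin (p n) → ℝ}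
  {S0 : ∀ n, Matrix (Fin (p n)) (Fin (p n)) ℝ} {κ σ₀ : ℝ}

/-- The sample covariance matrix concentrates at rate `t n * √(p n / n)`. -/
theorem tendsto_measure_specNorm_sampleCov_sub
    (hY : ∀ n, IsIIDSample (P n) (Y n) (S0 n)) (hκ0 : 0 < κ) (hS0 : ∀ n, WellConditioned κ (S0 n))
    (hσ₀ : 0 < σ₀)
    (hsub : ∀ n i, psiTwoNormVec (P n) (fun ω => invSqrt (S0 n) *ᵥ Y n i ω) ≤ ENNReal.ofReal σ₀)
    {t : ℕ → ℝ} (ht : ∀ᶠ n in atTop, 32 * (6 * σ₀ ^ 2 / κ) ≤ t n)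
    (htp : Tendsto (fun n => t n ^ 2 * p n) atTop atTop)
    (htε : Tendsto (fun n => t n * √((p n : ℝ) / n)) atTop (𝓝 0)) :
    Tendsto (fun n => P n {ω | t n * √((p n : ℝ) / n) <
      specNorm (sampleCov (fun i => Y n i ω) - S0 n)}) atTop (𝓝 0) := by
  set K := 6 * σ₀ ^ 2 / κ with hK
  have hK0 : 0 < K := by positivity
  have hlim : Tendsto (fun n => ENNReal.ofReal (4 * Real.exp (-(t n ^ 2 * p n / (256 * K ^ 2)))))
      atTop (𝓝 0) := by
    have h1 := Real.tendsto_exp_neg_atTop_nhds_zero.comp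
      (htp.atTop_div_const (show 0 < 256 * K ^ 2 by positivity))
    simpa using ENNReal.tendsto_ofReal (h1.const_mul 4)
  refine tendsto_of_tendsto_of_tendsto_of_le_of_le' tendsto_const_nhds hlim
    (Eventually.of_forall fun _ => zero_le) ?_
  filter_upwards [ht, eventually_ge_atTop 1, htε.eventually_lt_const (show 0 < 8 * K by positivity)]
    with n htn hn hsmall
  have ht0 : 0 ≤ t n := by linarith
  have h1 := (hY n).measure_specNorm_sampleCov_sub_le hn hκ0 (hS0 n) hσ₀ (hsub n)
    (β := t n * √((p n : ℝ) / n) / 4) (by positivity) (by linarith)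
  rw [mul_div_cancel₀ _ (four_ne_zero)] at h1
  refine h1.trans (ENNReal.ofReal_le_ofReal ?_)
  rw [mul_assoc]
  refine mul_le_mul_of_nonneg_left ?_ (by norm_num)
  refine (mul_le_mul_of_nonneg_right (twentyFive_pow_le_exp (p n)) (Real.exp_pos _).le).trans ?_
  rw [← Real.exp_add, Real.exp_le_exp]
  have h2 : n * (t n * √((p n : ℝ) / n) / 4) ^ 2 / (8 * K ^ 2) =
      2 * (t n ^ 2 * p n / (256 * K ^ 2)) := by
    rw [← sample_size_mul_sq_rate hn (t n)]; ring
  -- As 32²/256 = 4, half of the exponent already pays for 25^p ≤ e^{4p}.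
  have h3 : 4 * (p n : ℝ) ≤ t n ^ 2 * p n / (256 * K ^ 2) := by
    rw [le_div_iff₀ (by positivity)]
    have : (32 * K) ^ 2 ≤ t n ^ 2 := by gcongr
    nlinarith [Nat.cast_nonneg (α := ℝ) (p n)]
  rw [← hK, h2]; linarith

variable {ν c k : ℝ} {mix : ∀ n, Fin (p n) → ℝ → ℝ}

/-- Posterior contraction at every admissible multiple of the rate `√(p n / n)`. -/
theorem posteriorContracts_of_rate (hp : ∀ n, 1 ≤ p n)
    (hY : ∀ n, IsIIDSample (P n) (Y n) (S0 n)) (hκ0 : 0 < κ) (hκ1 : κ ≤ 1)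
    (hS0 : ∀ n, WellConditioned κ (S0 n)) (hσ₀ : 0 < σ₀)
    (hsub : ∀ n i, psiTwoNormVec (P n) (fun ω => invSqrt (S0 n) *ᵥ Y n i ω) ≤ ENNReal.ofReal σ₀)
    (hgrowth : Tendsto (fun n => (p n : ℝ) ^ 5 / (n : ℝ)) atTop (𝓝 0))
    (hν : 0 < ν) (hc : 0 < c) (hmix : ∀ n i, IsPosDensity (mix n i))
    (hk : ∀ n i, AntitoneOn (mix n i) (Set.Ioi k))
    {t : ℕ → ℝ} (ht : ∀ᶠ n in atTop, 32 * (6 * σ₀ ^ 2 / κ) + 13 ≤ t n)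
    (htp : Tendsto (fun n => t n ^ 2 * p n) atTop atTop)
    (htε : Tendsto (fun n => t n * √((p n : ℝ) / n)) atTop (𝓝 0))
    {ε : ℕ → ℝ} (hε : ∀ᶠ n in atTop, (8 / (κ / 2) ^ 3 + 1) * (t n * √((p n : ℝ) / n)) ≤ ε n) :
    PosteriorContracts P p Y S0 (fun n => dsiwDensity ν c (mix n)) ε := by
  have hK0 : 0 < 6 * σ₀ ^ 2 / κ := by positivity
  have hconc := tendsto_measure_specNorm_sampleCov_sub hY hκ0 hS0 hσ₀ hsub
    (ht.mono fun n hn => by linarith) htp htε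
  set r := fun n => (√((p n : ℝ) / n))⁻¹ with hr
  have hrt : Tendsto r atTop atTop := tendsto_inv_sqrt_dim_div hp hgrowth
  set a := (κ / 2) ^ 2 / 64 with ha
  have ha0 : 0 < a := by positivity
  have hlim : Tendsto (fun n => ENNReal.ofReal (Real.exp (-(a * r n + (-2 - (ν + 1) / 2))) +
      4 * Real.exp (-(t n ^ 2 * p n / 32 + -ν)))) atTop (𝓝 0) := by
    have h1 := Real.tendsto_exp_neg_atTop_nhds_zero.comp
      (tendsto_atTop_add_const_right atTop (-2 - (ν + 1) / 2) (hrt.const_mul_atTop ha0))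
    have h2 := Real.tendsto_exp_neg_atTop_nhds_zero.comp
      (tendsto_atTop_add_const_right atTop (-ν)
        (htp.atTop_div_const (show (0 : ℝ) < 32 by norm_num)))
    simpa using ENNReal.tendsto_ofReal (h1.add (h2.const_mul 4))
  refine TendstoZeroInProb.of_good_event _ _ hlim hconc ?_
  filter_upwards [ht, eventually_ge_atTop 1, hε,
    htε.eventually_lt_const (show 0 < (κ / 2) ^ 2 / 8 by positivity),
    hrt.eventually_ge_atTop (2 / a), hrt.eventually_ge_atTop (8 * c * |k| / (κ / 2))]
    with n htn hn hεn hsmall hr1 hr2 ω hω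
  replace hω := not_lt.1 hω
  have hn0 : (0 : ℝ) < n := by exact_mod_cast hn
  have hp1 : (1 : ℝ) ≤ p n := by exact_mod_cast hp n
  have hp0 : (0 : ℝ) < p n := by linarith
  have ht1 : 1 ≤ t n := by linarith
  have ht0 : 0 < t n := by linarith
  set h := t n * √((p n : ℝ) / n) with hh
  have hh0 : 0 < h := mul_pos ht0 (Real.sqrt_pos.2 (by positivity))
  have hr0 : 0 ≤ r n := inv_nonneg.2 (Real.sqrt_nonneg _)
  -- Since r n = 1/√(p/n), nh equals t·p·r: the bound for large scales is exponential in p times a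
  -- diverging factor.
  have hnh : p n * r n ≤ n * h := by
    rw [hh, sample_size_mul_rate hn (hp n)]
    exact le_mul_of_one_le_left (by positivity) ht1
  have hrnh : r n ≤ n * h := le_trans (le_mul_of_one_le_left hr0 hp1) hnh
  have hhκ : h ≤ κ / 2 := by nlinarith
  have hS := (hS0 n).quadForm_bounds_of_sub hκ0 hκ1 (hω.trans hhκ)
  have hkh : k ≤ κ / 2 * n * h / (8 * c) := by
    rw [le_div_iff₀ (by positivity)]
    rw [div_le_iff₀ (by positivity)] at hr2
    have : r n * (κ / 2) ≤ n * h * (κ / 2) := by gcongr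
    nlinarith [le_abs_self k]
  have hpost := posterior_specNorm_le (hp n) hn hν hc (hmix n) (hk n) (sampleCov_isSymm _)
    (show 0 < κ / 2 by positivity) (by linarith) (fun v => (hS v).1) (fun v => (hS v).2) hh0
    hsmall.le hkh
  -- Triangle inequality through S: 8h/(κ/2)³ from the posterior and h from the sample covariance
  -- matrix.
  refine (measure_mono fun A hA => ?_).trans (hpost.trans (ENNReal.ofReal_le_ofReal ?_))
  · simp only [Set.mem_ofPred_eq] at hA ⊢
    have h1 := specNorm_add_le (A - sampleCov fun i => Y n i ω)
      ((sampleCov fun i => Y n i ω) - S0 n)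
    rw [sub_add_sub_cancel] at h1
    have h2 : (8 / (κ / 2) ^ 3 + 1) * h = 8 * h / (κ / 2) ^ 3 + h := by ring
    linarith
  · refine add_le_add ?_ ?_
    · have h1 : (p n : ℝ) ≤ Real.exp (p n) := by linarith [Real.add_one_le_exp (p n : ℝ)]
      have h2 : (2 : ℝ) ^ ((ν + p n + 1) / 2) ≤ Real.exp ((ν + p n + 1) / 2) := by
        rw [← Real.exp_one_rpow]
        exact Real.rpow_le_rpow zero_le_two (by linarith [Real.exp_one_gt_d9]) (by positivity)
      have h3 : n * (κ / 2) ^ 2 * h / 64 = a * (n * h) := by rw [ha]; ring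
      have h4 : a * (p n * r n) ≤ a * (n * h) := by gcongr
      have h5 : 2 ≤ a * r n := by rw [div_le_iff₀ ha0] at hr1; linarith
      calc _ ≤ Real.exp (p n) * (Real.exp ((ν + p n + 1) / 2) *
            Real.exp (-(n * (κ / 2) ^ 2 * h / 64))) := by gcongr
        _ = Real.exp (p n + ((ν + p n + 1) / 2 + -(n * (κ / 2) ^ 2 * h / 64))) := by
            rw [Real.exp_add, Real.exp_add]
        _ ≤ _ := by
            rw [Real.exp_le_exp, h3]
            -- All terms linear in p are absorbed once a·r ≥ 2, because p(2 - a r) ≤ 2 - a r for p ≥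
            -- 1.
            nlinarith [mul_nonneg (sub_nonneg.2 hp1) (sub_nonneg.2 h5)]
    · have h1 : n * h ^ 2 / 16 = 2 * (t n ^ 2 * p n / 32) := by
        rw [hh, sample_size_mul_sq_rate hn]; ring
      have h2 : 5 * (p n : ℝ) ≤ t n ^ 2 * p n / 32 := by
        -- 13² ≥ 5·32, so half of the exponent covers 4p from the test vectors and p from the
        -- Chernoff bound.
        have : (13 : ℝ) ^ 2 ≤ t n ^ 2 := by gcongr; linarith
        nlinarith
      calc _ ≤ 4 * Real.exp (4 * p n) * Real.exp (-(n * h ^ 2 / 16) + (ν + p n)) := by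
            gcongr; exact twentyFive_pow_le_exp (p n)
        _ = 4 * Real.exp (4 * p n + (-(n * h ^ 2 / 16) + (ν + p n))) := by
            rw [Real.exp_add (4 * (p n : ℝ)), mul_assoc]
        _ ≤ _ := by
            gcongr; rw [h1]; linarith

/-- Flatness of the prior around the sample covariance matrix. -/
theorem flatAroundSampleCov_of_growth (hp : ∀ n, 1 ≤ p n)
    (hY : ∀ n, IsIIDSample (P n) (Y n) (S0 n)) (hκ0 : 0 < κ) (hκ1 : κ ≤ 1)
    (hS0 : ∀ n, WellConditioned κ (S0 n)) (hσ₀ : 0 < σ₀)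
    (hsub : ∀ n i, psiTwoNormVec (P n) (fun ω => invSqrt (S0 n) *ᵥ Y n i ω) ≤ ENNReal.ofReal σ₀)
    (hgrowth : Tendsto (fun n => (p n : ℝ) ^ 5 / (n : ℝ)) atTop (𝓝 0))
    (hν : 0 < ν) (hc : 0 < c) (hmix : ∀ n i, IsPosDensity (mix n i))
    (hk : ∀ n i, AntitoneOn (mix n i) (Set.Ioi k))
    {t : ℕ → ℝ} (ht : ∀ᶠ n in atTop, 32 * (6 * σ₀ ^ 2 / κ) ≤ t n)
    (htp : Tendsto (fun n => t n ^ 2 * p n) atTop atTop)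
    (htε : Tendsto (fun n => t n * √((p n : ℝ) / n)) atTop (𝓝 0)) {M : ℝ} (hM : 0 < M) :
    FlatAroundSampleCov P p Y (fun n => dsiwDensity ν c (mix n))
      (fun n => M * √((p n : ℝ) / n)) := by
  have hconc := tendsto_measure_specNorm_sampleCov_sub hY hκ0 hS0 hσ₀ hsub ht htp htε
  have hlim : Tendsto (fun n => ENNReal.ofReal (Real.exp (flatConst ν c k (κ / 2) *
      ((p n : ℝ) ^ 2 * (M * √((p n : ℝ) / n)))) - 1)) atTop (𝓝 0) := by
    have h1 := ((tendsto_dim_sq_mul_sqrt hgrowth).const_mul M).const_mul (flatConst ν c k (κ / 2))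
    have h2 := ENNReal.tendsto_ofReal
      (((Real.continuous_exp.tendsto _).comp h1).sub_const 1)
    simp only [mul_zero, Real.exp_zero, sub_self, ENNReal.ofReal_zero] at h2
    refine h2.congr fun n => ?_
    simp only [Function.comp_apply, mul_left_comm]
  refine TendstoZeroInProb.of_good_event _ _ hlim hconc ?_
  have hεM := (tendsto_sqrt_dim_div hp hgrowth).const_mul M
  rw [mul_zero] at hεM
  filter_upwards [eventually_ge_atTop 1,
    htε.eventually_lt_const (show 0 < κ / 2 by positivity),
    hεM.eventually_lt_const (show 0 < κ / 2 / 2 by positivity)] with n hn hsmall hεn ω hω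
  replace hω := not_lt.1 hω
  have hS := (hS0 n).quadForm_bounds_of_sub hκ0 hκ1 (hω.trans hsmall.le)
  exact flatness_dsiw_le (hp n) hn hν hc (hmix n) (hk n) (sampleCov_isSymm _)
    (show 0 < κ / 2 by positivity) (by linarith) (fun v => (hS v).1) (fun v => (hS v).2)
    (by positivity) hεn.le

end Rates

/-! ### The theorem, by choosing the factor t in each regime. -/

theorem mainTheorem9 {Ω : ℕ → Type*} [∀ n, MeasurableSpace (Ω n)]
    (P : ∀ n, Measure (Ω n)) [∀ n, IsProbabilityMeasure (P n)]
    (p : ℕ → ℕ) (hp : ∀ n, 1 ≤ p n)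
    (Y : ∀ n, Fin n → Ω n → Fin (p n) → ℝ)
    (S0 : ∀ n, Matrix (Fin (p n)) (Fin (p n)) ℝ)
    (hY : ∀ n, IsIIDSample (P n) (Y n) (S0 n))
    -- bounded eigenvalues and sub-Gaussian norm
    (κ : ℝ) (hκ0 : 0 < κ) (hκ1 : κ ≤ 1) (hS0 : ∀ n, WellConditioned κ (S0 n))
    (σ₀ : ℝ) (hσ₀ : 0 < σ₀)
    (hsub : ∀ n i, psiTwoNormVec (P n) (fun ω => invSqrt (S0 n) *ᵥ Y n i ω) ≤ ENNReal.ofReal σ₀)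
    -- growth of the dimension
    (hgrowth : Tendsto (fun n => (p n : ℝ) ^ 5 / (n : ℝ)) atTop (𝓝 0))
    -- the priors
    (ν c : ℝ) (hν : 0 < ν) (hc : 0 < c)
    (mix : ∀ n, Fin (p n) → ℝ → ℝ) (hmix : ∀ n i, IsPosDensity (mix n i))
    (k : ℝ) (hk : ∀ n i, AntitoneOn (mix n i) (Set.Ioi k)) :
    (∀ M : ℝ, 0 < M →
      FlatAroundSampleCov P p Y (fun n => dsiwDensity ν c (mix n))
        (fun n => M * √((p n : ℝ) / n))) ∧
    (∀ M : ℕ → ℝ, Tendsto M atTop atTop →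
      PosteriorContracts P p Y S0 (fun n => dsiwDensity ν c (mix n))
        (fun n => M n * √((p n : ℝ) / n))) ∧
    (Tendsto p atTop atTop →
      ∃ M₀ : ℝ, 0 < M₀ ∧ ∀ M : ℝ, M₀ ≤ M →
        PosteriorContracts P p Y S0 (fun n => dsiwDensity ν c (mix n))
          (fun n => M * √((p n : ℝ) / n))) := by
  have hrt := tendsto_inv_sqrt_dim_div hp hgrowth
  -- the slowly diverging factor `√(1 / √(p n / n))`
  have hslow : Tendsto (fun n => √(√((p n : ℝ) / n))⁻¹) atTop atTop :=
    Real.tendsto_sqrt_atTop.comp hrt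
  have hslowε : Tendsto (fun n => √(√((p n : ℝ) / n))⁻¹ * √((p n : ℝ) / n)) atTop (𝓝 0) := by
    have h1 := (tendsto_sqrt_dim_div hp hgrowth).sqrt
    rw [Real.sqrt_zero] at h1
    refine h1.congr fun n => ?_
    set e := √((p n : ℝ) / n) with he
    have he0 : 0 ≤ e := Real.sqrt_nonneg _
    rw [Real.sqrt_inv]
    -- The value 0 occurs only at n = 0, where division by zero returns 0.
    rcases he0.eq_or_lt with h0 | h0
    · rw [← h0]; simp
    · have := Real.sqrt_pos.2 h0
      field_simp
      rw [Real.sq_sqrt he0]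
  have hdim : ∀ {t : ℕ → ℝ}, Tendsto t atTop atTop →
      Tendsto (fun n => t n ^ 2 * p n) atTop atTop := fun {t} ht => by
    refine tendsto_atTop_mono (fun n => ?_) ((tendsto_pow_atTop two_ne_zero).comp ht)
    exact le_mul_of_one_le_right (sq_nonneg _) (by exact_mod_cast hp n)
  refine ⟨fun M hM => ?_, fun M hM => ?_, fun hpt => ?_⟩
  · exact flatAroundSampleCov_of_growth hp hY hκ0 hκ1 hS0 hσ₀ hsub hgrowth hν hc hmix hk
      (hslow.eventually_ge_atTop _) (hdim hslow) hslowε hM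
  · set C := 8 / (κ / 2) ^ 3 + 1 with hC
    have hC0 : 0 < C := by positivity
    -- A small radius gives the stronger conclusion, so t may be capped: it stays below M n / C,
    -- still diverges, and keeps t·√(p/n) → 0 however fast M grows.
    have ht : Tendsto (fun n => min (M n / C) √(√((p n : ℝ) / n))⁻¹) atTop atTop :=
      tendsto_atTop.2 fun b => by
        filter_upwards [(hM.atTop_div_const hC0).eventually_ge_atTop b,
          hslow.eventually_ge_atTop b] with n h1 h2 using le_min h1 h2
    refine posteriorContracts_of_rate hp hY hκ0 hκ1 hS0 hσ₀ hsub hgrowth hν hc hmix hk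
      (ht.eventually_ge_atTop _) (hdim ht) ?_ (Eventually.of_forall fun n => ?_)
    · refine tendsto_of_tendsto_of_tendsto_of_le_of_le' tendsto_const_nhds hslowε ?_
        (Eventually.of_forall fun n => ?_)
      · filter_upwards [ht.eventually_ge_atTop 0] with n hn using by positivity
      · exact mul_le_mul_of_nonneg_right (min_le_right _ _) (Real.sqrt_nonneg _)
    · rw [← mul_assoc]
      refine mul_le_mul_of_nonneg_right ?_ (Real.sqrt_nonneg _)
      calc C * min (M n / C) √(√((p n : ℝ) / n))⁻¹ ≤ C * (M n / C) := by
            gcongr; exact min_le_left _ _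
        _ = M n := by field_simp
  · set t := 32 * (6 * σ₀ ^ 2 / κ) + 13 with ht
    have ht0 : 0 < t := by positivity
    -- With constant t, the divergence of t²p comes from p → ∞ alone.
    refine ⟨(8 / (κ / 2) ^ 3 + 1) * t, by positivity, fun M hM => ?_⟩
    refine posteriorContracts_of_rate (t := fun _ => t) hp hY hκ0 hκ1 hS0 hσ₀ hsub hgrowth hν hc
      hmix hk (Eventually.of_forall fun _ => le_rfl) ?_ ?_ (Eventually.of_forall fun n => ?_)
    · exact (tendsto_natCast_atTop_atTop.comp hpt).const_mul_atTop (by positivity)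
    · simpa using (tendsto_sqrt_dim_div hp hgrowth).const_mul t
    · rw [← mul_assoc]
      exact mul_le_mul_of_nonneg_right hM (Real.sqrt_nonneg _)
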